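/- **Notation.** For an affine-linear map $\psi\colon\mathbb Z^d\to\mathbb Z^n$ let $\dot\psi$ be its linear part; write $\|\psi\|_N\le L$ if the matrix entries of $\dot\psi$ have absolute value $\le L$ and the entries of $\psi(0)$ have absolute value $\le NL$. Linear maps $\phi_1,\dots,\phi_t\colon\mathbb Z^d\to\mathbb Z^n$ have *(Cauchy–Schwarz) complexity $\le s$* if for every $i$ there is a partition $\{1,\dots,t\}\setminus\{i\}=C_1\sqcup\dots\sqcup C_{s+1}$ into possibly empty classes such that for every $k$ the restriction $\phi_i\colon\bigcap_{j\in C_k}\ker\phi_j\to\mathbb Z^n$ has finite cokernel; affine-linear maps have complexity $\le s$ if their linear parts do. For a finite subset $A$ of an abelian group $G$ and $f\colon A\to\mathbb C$, the Gowers norm $\|f\|_{U^{k}(A)}\ge0$ is defined by $$\|f\|_{U^k(A)}^{2^k}=\mathbb E_{(x,h)}\ \prod_{\omega\in\{0,1\}^k}\mathcal C^{|\omega|}f(x+\omega\cdot h),$$ the average being over all $(x,h)\in G\times G^k$ with $x+\omega\cdot h\in A$ for all $\omega\in\{0,1\}^k$, where $\mathcal C$ is complex conjugation, $\omega\cdot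 h=\sum_i\omega_ih_i$ and $|\omega|=\sum_i\omega_i$. Cubes such as $[-R,R]^n$ stand for their sets of lattice points when they appear in a norm, a bound or an average. A function $\nu\colon\mathbb Z^n\to\mathbb R_{\ge0}$ satisfies the *$(t,d,L)$-linear forms condition in scale $\ge N$ within error $<\rho$* if, for all $t'\le t$, $d'\le d$, all affine-linear maps $\psi_1,\dots,\psi_{t'}\colon\mathbb Z^{d'}\to\mathbb Z^n$ whose linear parts have matrix entries of absolute value $\le L$ and finite cokernels and satisfy $\ker\dot\psi_i\not\subset\ker\dot\psi_j$ for $i\ne j$, and all primes $p\ge N$, $$\Bigl|1-\mathbb E_{x\in\mathbb F_p^{d'}}\prod_{i=1}^{t'}\nu_p(\psi_{i}(x)\bmod p)\Bigr|<\rho ,$$ where $\nu_p\colon\mathbb F_p^n\to\mathbb R_{\ge 0}$ is $\nu$ evaluated at the coordinatewise representative in $(-p/2,p/2]^n$. **Theorem (generalized von Neumann theorem).** For every integer $n\ge1$ there is an exponent $A_0=A_0(n)$; for every integer $d\ge1$ there are an exponent $A=A(d,n)$ and a constant $K=K(d,n)>0$; and for every integer $s\ge1$ there is a constant $C=C(d,n,s)>0$,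 such that the following holds for all integers $t\ge1$ and all reals $L>0$ and $N>N_0:=K L^{A_0}$. Let $\psi_1,\dots,\psi_t\colon\mathbb Z^d\to\mathbb Z^n$ be affine-linear maps with $\|\psi_i\|_N\le L$ and of complexity $\le s$. Let $\delta>0$, $0<\rho<1$, and let $f_1,\dots,f_t\colon\mathbb Z^n\to\mathbb C$ satisfy: 1. $\|f_i\|_{U^{s+1}([-(d+1)LN,(d+1)LN]^n)}\le\delta$ for some $i\in\{1,\dots,t\}$; 2. $|f_i|\le\nu$ pointwise on $[-(d+1)LN,(d+1)LN]^n$ for all $i$, where $\nu\colon\mathbb Z^n\to\mathbb R_{\ge0}$ satisfies the $(t2^{s+1},\,4(s+2)d,\,K L^{A})$-linear forms condition in scale $\ge N$ within error $<\rho$. Let $\Omega\subset[-N,N]^d\subset\mathbb R^d$ be a convex set. Then for all real $M>0$ and $X\ge2$, $$\Bigl|\mathbb E_{x\in[-N,N]^d}\,1_\Omega(x)\prod_{i=1}^tf_i(\psi_i(x))\Bigr|\le C\,L^d\Bigl(X^d\bigl(\delta+\rho^{1/2^{s+2}}+2^t\rho^{1/2^{s+1}}\bigr)+\frac1M+M\,\frac{\log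 X}{X}\Bigr).$$ -/

import Mathlib

open scoped BigOperators Pointwise

/-- The lattice points of the cube `[-R, R]^d`. -/
noncomputable def intBox (d : ℕ) (R : ℝ) : Finset (Fin d → ℤ) :=
  Fintype.piFinset fun _ => Finset.Icc ⌈-R⌉ ⌊R⌋

theorem mem_intBox {d : ℕ} {R : ℝ} {x : Fin d → ℤ} :
    x ∈ intBox d R ↔ ∀ j, |(x j : ℝ)| ≤ R := by
  simp only [intBox, Fintype.mem_piFinset, Finset.mem_Icc, Int.ceil_le, Int.le_floor, abs_le]

/-- The vertex `x + ω · h` of the parallelepiped with base point `x` and edges `h`. -/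
def cubeVertex {G : Type*} [AddCommGroup G] {k : ℕ} (x : G) (h : Fin k → G)
    (ω : Fin k → Bool) : G :=
  x + ∑ i, if ω i then h i else 0

/-- All `k`-dimensional parallelepipeds `(x, h)`, `x ∈ G`, `h ∈ G^k`, with every vertex in `A`
(see `mem_gowersCubes`). -/
def gowersCubes {G : Type*} [AddCommGroup G] [DecidableEq G] (k : ℕ) (A : Finset G) :
    Finset (G × (Fin k → G)) :=
  (A ×ˢ Fintype.piFinset fun _ => A - A).filter fun c => ∀ ω, cubeVertex c.1 c.2 ω ∈ A

theorem mem_gowersCubes {G : Type*} [AddCommGroup G] [DecidableEq G] {k : ℕ} {A : Finset G}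
    {c : G × (Fin k → G)} : c ∈ gowersCubes k A ↔ ∀ ω, cubeVertex c.1 c.2 ω ∈ A := by
  simp only [gowersCubes, Finset.mem_filter, Finset.mem_product, Fintype.mem_piFinset,
    and_iff_right_iff_imp]
  intro H
  have h0 : c.1 ∈ A := by simpa [cubeVertex] using H fun _ => false
  refine ⟨h0, fun i => ?_⟩
  have h1 : c.1 + c.2 i ∈ A := by
    have := H fun j => decide (j = i)
    simpa [cubeVertex] using this
  exact Finset.mem_sub.2 ⟨_, h1, _, h0, by abel⟩

/-- The Gowers norm `‖f‖_{U^k(A)}` of a function on a finite subset `A` of an abelian group: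
the `2^k`-th root of the average of `∏_ω 𝒞^{|ω|} f(x + ω · h)` over all `k`-dimensional
parallelepipeds in `A`. (That average is a nonnegative real number for `k ≥ 1`.) -/
noncomputable def gowersNorm {G : Type*} [AddCommGroup G] [DecidableEq G] (k : ℕ) (A : Finset G)
    (f : G → ℂ) : ℝ :=
  ‖Finset.expect (gowersCubes k A) fun c => ∏ ω : Fin k → Bool,
    (starRingEnd ℂ)^[(Finset.univ.filter fun i => ω i = true).card] (f (cubeVertex c.1 c.2 ω))‖
      ^ ((1 : ℝ) / 2 ^ k)

/-- The `(i, j)` entry of the matrix of the linear part of an affine-linear map `ℤ^d → ℤ^n`. -/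
def linCoeff {d n : ℕ} (ψ : (Fin d → ℤ) →ᵃ[ℤ] (Fin n → ℤ)) (i : Fin n) (j : Fin d) : ℤ :=
  ψ.linear (Pi.single j 1) i

/-- All coefficients of the linear part have absolute value `≤ L`. -/
def LinCoeffsLE {d n : ℕ} (ψ : (Fin d → ℤ) →ᵃ[ℤ] (Fin n → ℤ)) (L : ℝ) : Prop :=
  ∀ i j, |(linCoeff ψ i j : ℝ)| ≤ L

/-- `‖ψ‖_N ≤ L`: linear coefficients of size `≤ L` and constant term of size `≤ N L`. -/
def AffineSizeLE {d n : ℕ} (ψ : (Fin d → ℤ) →ᵃ[ℤ] (Fin n → ℤ)) (N L : ℝ) : Prop :=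
  LinCoeffsLE ψ L ∧ ∀ i, |(ψ 0 i : ℝ)| ≤ N * L

/-- Cauchy–Schwarz complexity `≤ s` at the index `i`: the other indices can be partitioned into
`s + 1` (possibly empty) classes such that the restriction of `φ i` to the intersection of the
kernels of the maps in any one class has finite cokernel. -/
def ComplexityLEAt {t d n : ℕ} (φ : Fin t → (Fin d → ℤ) →ₗ[ℤ] (Fin n → ℤ)) (s : ℕ)
    (i : Fin t) : Prop :=
  ∃ c : {j : Fin t // j ≠ i} → Fin (s + 1), ∀ k : Fin (s + 1),
    Finite ((Fin n → ℤ) ⧸ Submodule.map (φ i)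
      (⨅ j : {j : Fin t // j ≠ i}, ⨅ _ : c j = k, LinearMap.ker (φ j)))

/-- Cauchy–Schwarz complexity `≤ s` (at every index). -/
def ComplexityLE {t d n : ℕ} (φ : Fin t → (Fin d → ℤ) →ₗ[ℤ] (Fin n → ℤ)) (s : ℕ) : Prop :=
  ∀ i, ComplexityLEAt φ s i

/-- The reduction `𝔽_p^d → 𝔽_p^n` of an affine-linear map `ℤ^d → ℤ^n`. -/
def affineMod {d n : ℕ} (p : ℕ) (ψ : (Fin d → ℤ) →ᵃ[ℤ] (Fin n → ℤ)) (x : Fin d → ZMod p) :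
    Fin n → ZMod p :=
  fun i => (∑ j, (linCoeff ψ i j : ZMod p) * x j) + (ψ 0 i : ZMod p)

/-- The function on `𝔽_p^n` obtained from `ν` by lifting each coordinate to its representative
in `(-p/2, p/2]`. -/
def restrictMod {n : ℕ} (p : ℕ) (ν : (Fin n → ℤ) → ℝ) (y : Fin n → ZMod p) : ℝ :=
  ν fun i => (y i).valMinAbs

/-- The `(t, d, L)`-linear forms condition in scale `≥ N` and within error `< ρ`. -/
def LinearFormsCondition {n : ℕ} (t d : ℕ) (L N ρ : ℝ) (ν : (Fin n → ℤ) → ℝ) : Prop :=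
  ∀ t' ≤ t, ∀ d' ≤ d, ∀ ψ : Fin t' → (Fin d' → ℤ) →ᵃ[ℤ] (Fin n → ℤ),
    (∀ i, LinCoeffsLE (ψ i) L) →
    (∀ i j, i ≠ j → ¬ LinearMap.ker (ψ i).linear ≤ LinearMap.ker (ψ j).linear) →
    (∀ i, Finite ((Fin n → ℤ) ⧸ LinearMap.range (ψ i).linear)) →
    ∀ (p : ℕ) [Fact p.Prime], N ≤ p →
      |1 - Finset.expect (Finset.univ : Finset (Fin d' → ZMod p))
        fun x => ∏ i, restrictMod p ν (affineMod p (ψ i) x)| < ρ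

/-! The box average is moved to `𝔽_p^d`, where `p` is a prime comparable to `L N` (up to constants
in `d` and `s`) and so large that nothing wraps around (`norm_expect_intBox_le`). This costs `(p /
N)^d`, which is the source of the factor `L^d`.

Let `i₀` be the index with small Gowers norm and `M_j` the matrix of the `j`-th linear part.
Complexity at `i₀` gives integer matrices `V_0, …, V_s` with `M_{i₀} V_k = D_k • 1`, `D_k ≠ 0`, such
that every other `M_j` is killed by some `V_k` (`exists_directions`). Cramer's rule bounds their
entries, so the linear forms condition covers all derived forms, and `p` can be chosen to divide no
`D_k`. One Cauchy–Schwarz step along `V_k` removes the forms killed by `V_k` at the price of their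
majorants. After `s + 1` steps only the function at `i₀` is left, multiplied over parallelepipeds
and accompanied by a weight `W` (`norm_expect_pow_le_cubeProd`). That function does not see
translations inside `ker M_{i₀}`; averaging `W` over these and computing a second moment replaces
`W` by `1` (`norm_expect_mul_weight_le`). As the `D_k` are invertible modulo `p`, what remains is
the Gowers average over `𝔽_p^n`, which the Gowers norm over the integer cube dominates
(`norm_expect_cubeProd_boxMod_le`).

Since `s + 1 ≥ 2`, a character disappears from a parallelepiped product, so the same bound holds for
averages twisted by any character (`CubeMoments.norm_expect_addChar_pow_le`). This handles the
cutoff to `Ω`: a cutoff convolved with a product Fejér kernel of order about `X` is a combination of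
characters of total mass at most `X^d`. The error of this smoothing is concentrated near the
boundary of `Ω`. There the functions are majorized by the product `P` of all weights, and `P` may be
replaced by `1` because `P - 1` has small Fourier coefficients. Convexity then bounds the proportion
of the boundary layer by `O(1/M)` (`norm_expect_cutoff_le`, `norm_expect_convex_cutoff_le`). -/

/-! ### Parallelepipeds and alternating conjugate products. -/

section Cubes

variable {G : Type*} [AddCommGroup G]

theorem cubeVertex_cons {k : ℕ} (x : G) (h : Fin (k + 1) → G) (b : Bool) (ω : Fin k → Bool) :
    cubeVertex x h (Fin.cons b ω) = cubeVertex (x + if b then h 0 else 0) (Fin.tail h) ω := by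
  simp [cubeVertex, Fin.sum_univ_succ, Fin.tail, add_assoc]

theorem cubeVertex_add {k : ℕ} (x y : G) (h : Fin k → G) (ω : Fin k → Bool) :
    cubeVertex (x + y) h ω = cubeVertex x h ω + y := by
  simp only [cubeVertex]; abel

theorem cubeVertex_false {k : ℕ} (x : G) (h : Fin k → G) :
    cubeVertex x h (fun _ => false) = x := by
  simp [cubeVertex]

theorem map_cubeVertex {G' F : Type*} [AddCommGroup G'] [FunLike F G G'] [AddMonoidHomClass F G G']
    (φ : F) {k : ℕ} (x : G) (h : Fin k → G) (ω : Fin k → Bool) :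
    φ (cubeVertex x h ω) = cubeVertex (φ x) (fun i => φ (h i)) ω := by
  simp only [cubeVertex, map_add, map_sum]
  congr 1
  refine Finset.sum_congr rfl fun i _ => ?_
  split_ifs <;> simp

theorem prod_bool_cube_succ {M : Type*} [CommMonoid M] {k : ℕ} (F : (Fin (k + 1) → Bool) → M) :
    ∏ ω, F ω = ∏ ω : Fin k → Bool, (F (Fin.cons false ω) * F (Fin.cons true ω)) := by
  rw [← (Fin.consEquiv fun _ => Bool).prod_comp, Fintype.prod_prod_type, Fintype.prod_bool,
    mul_comm, Finset.prod_mul_distrib]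
  rfl

/-- The alternating conjugate product `∏_ω 𝒞^{|ω|} f(x + ω · h)` over a parallelepiped. -/
noncomputable def cubeProd {k : ℕ} (f : G → ℂ) (x : G) (h : Fin k → G) : ℂ :=
  ∏ ω : Fin k → Bool,
    (starRingEnd ℂ)^[(Finset.univ.filter fun i => ω i = true).card] (f (cubeVertex x h ω))

theorem norm_conj_iterate (m : ℕ) (z : ℂ) : ‖(starRingEnd ℂ)^[m] z‖ = ‖z‖ := by
  induction m generalizing z with
  | zero => rfl
  | succ m ih => rw [Function.iterate_succ_apply, ih, RCLike.norm_conj]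

theorem norm_cubeProd {k : ℕ} (f : G → ℂ) (x : G) (h : Fin k → G) :
    ‖cubeProd f x h‖ = ∏ ω, ‖f (cubeVertex x h ω)‖ := by
  simp only [cubeProd, norm_prod, norm_conj_iterate]

theorem cubeProd_zero (f : G → ℂ) (x : G) (h : Fin 0 → G) : cubeProd f x h = f x := by
  simp [cubeProd, cubeVertex]

theorem card_filter_cons_true {k : ℕ} (b : Bool) (ω : Fin k → Bool) :
    (Finset.univ.filter fun i => (Fin.cons b ω : Fin (k + 1) → Bool) i = true).card =
      (Finset.univ.filter fun i => ω i = true).card + if b then 1 else 0 := by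
  rw [Fin.univ_succ, Finset.filter_cons]
  cases b <;> simp [Finset.filter_map]

/-- Pairing the vertices along the first edge turns `f` into its multiplicative derivative;
inductions on the dimension rest on this. -/
theorem cubeProd_succ {k : ℕ} (f : G → ℂ) (x : G) (h : Fin (k + 1) → G) :
    cubeProd f x h =
      cubeProd (fun y => f y * (starRingEnd ℂ) (f (y + h 0))) x (Fin.tail h) := by
  rw [cubeProd, cubeProd, prod_bool_cube_succ]
  refine Finset.prod_congr rfl fun ω _ => ?_
  rw [iterate_map_mul, card_filter_cons_true, card_filter_cons_true, cubeVertex_cons,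
    cubeVertex_cons, cubeVertex_add]
  simp [cubeVertex_add]

theorem cubeProd_mul {k : ℕ} (f g : G → ℂ) (x : G) (h : Fin k → G) :
    cubeProd (fun y => f y * g y) x h = cubeProd f x h * cubeProd g x h := by
  simp only [cubeProd, iterate_map_mul, Finset.prod_mul_distrib]

theorem cubeProd_one {k : ℕ} (x : G) (h : Fin k → G) : cubeProd (fun _ => 1) x h = 1 := by
  simp only [cubeProd, iterate_map_one, Finset.prod_const_one]

theorem cubeProd_ofReal {k : ℕ} (f : G → ℝ) (x : G) (h : Fin k → G) :
    cubeProd (fun y => (f y : ℂ)) x h = ((∏ ω, f (cubeVertex x h ω) : ℝ) : ℂ) := by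
  rw [cubeProd, Complex.ofReal_prod]
  refine Finset.prod_congr rfl fun ω _ => ?_
  exact Function.iterate_fixed (Complex.conj_ofReal _) _

/-- The alternating product of a character over a parallelepiped of dimension at least two is
trivial. -/
theorem cubeProd_addChar [Finite G] {k : ℕ} (χ : AddChar G ℂ) (x : G) (h : Fin (k + 2) → G) :
    cubeProd χ x h = 1 := by
  have h1 : ∀ y z, χ y * (starRingEnd ℂ) (χ (y + z)) = (starRingEnd ℂ) (χ z) := fun y z => by
    have : χ y * (starRingEnd ℂ) (χ y) = 1 := by
      rw [Complex.mul_conj, Complex.normSq_eq_norm_sq, AddChar.norm_apply]; simp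
    rw [AddChar.map_add_eq_mul, map_mul, ← mul_assoc, this, one_mul]
  have h2 : ∀ z, (starRingEnd ℂ) (χ z) * χ z = 1 := fun y => by
    rw [mul_comm, Complex.mul_conj, Complex.normSq_eq_norm_sq, AddChar.norm_apply]; simp
  -- The first derivative of a character is constant in the base point, the second is `1`.
  rw [cubeProd_succ, cubeProd_succ]
  simp only [h1, Complex.conj_conj, h2]
  exact cubeProd_one _ _

end Cubes

/-! ### Weighted van der Corput and Gowers–Cauchy–Schwarz inequalities. -/

section CauchySchwarz


theorem expect_add_right {Z M : Type*} [AddCommMonoid M] [Module ℚ≥0 M] [AddCommGroup Z] [Fintype Z]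
    (F : Z → M) (z : Z) :
    𝔼 x, F (x + z) = 𝔼 x, F x :=
  Fintype.expect_equiv (Equiv.addRight z) _ _ fun _ => rfl

theorem expect_prod_type {A B M : Type*} [Fintype A] [Fintype B] [AddCommMonoid M] [Module ℚ≥0 M]
    (F : A × B → M) : 𝔼 i, F i = 𝔼 a, 𝔼 b, F (a, b) := by
  rw [← Finset.univ_product_univ, Finset.expect_product]

theorem expect_fin_succ {H M : Type*} [Fintype H] [AddCommMonoid M] [Module ℚ≥0 M] {m : ℕ}
    (F : (Fin (m + 1) → H) → M) : 𝔼 g, F g = 𝔼 a, 𝔼 g : Fin m → H, F (Fin.cons a g) := by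
  rw [← Fintype.expect_equiv (Fin.consEquiv fun _ => H) (fun i => F (Fin.cons i.1 i.2)) F
    fun _ => rfl, expect_prod_type]

/-- Lets the parameter space `Λ` absorb one edge variable, as the induction on the dimension does at
each step. -/
theorem expect_prod_fin_succ {Λ Z H M : Type*} [Fintype Λ] [Fintype Z] [Fintype H]
    [AddCommMonoid M] [Module ℚ≥0 M] {m : ℕ} (F : Λ → Z → (Fin (m + 1) → H) → M) :
    𝔼 i : Λ × H, 𝔼 x, 𝔼 g : Fin m → H, F i.1 x (Fin.cons i.2 g : Fin (m + 1) → H) =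
      𝔼 l, 𝔼 x, 𝔼 g, F l x g := by
  rw [expect_prod_type]
  refine Finset.expect_congr rfl fun l _ => ?_
  rw [Finset.expect_comm]
  exact Finset.expect_congr rfl fun x _ => (expect_fin_succ (F l x)).symm

theorem cons_apply_eq {H Z : Type*} {m : ℕ} (V : Fin (m + 1) → H → Z) (a : H) (g : Fin m → H) :
    (fun k => V k ((Fin.cons a g : Fin (m + 1) → H) k)) =
      (Fin.cons (V 0 a) (fun k => V k.succ (g k)) : Fin (m + 1) → Z) := by
  funext k
  refine Fin.cases ?_ (fun k => ?_) k <;> simp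

/-- One step of van der Corput's inequality, with weights: a factor `A`, dominated by `w` and
invariant in the directions `V h`, is eliminated. -/
theorem norm_expect_sq_le_of_invariant {Λ Z H : Type} [Fintype Λ] [AddCommGroup Z] [Fintype Z]
    [AddCommGroup H] [Fintype H] (V : H →+ Z) (A R : Λ → Z → ℂ)
    (w : Λ → Z → ℝ) (hA : ∀ l x, ‖A l x‖ ≤ w l x) (hAV : ∀ l x h, A l (x + V h) = A l x)
    (hwV : ∀ l x h, w l (x + V h) = w l x) (c : ℝ) (hc : 𝔼 l, 𝔼 x, w l x ≤ c) :
    ‖𝔼 l, 𝔼 x, A l x * R l x‖ ^ 2 ≤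
      c * ‖𝔼 i : Λ × H, 𝔼 x, (w i.1 x : ℂ) * (R i.1 x * (starRingEnd ℂ) (R i.1 (x + V i.2)))‖ := by
  have hw : ∀ l x, 0 ≤ w l x := fun l x => (norm_nonneg _).trans (hA l x)
  set S : Λ → Z → ℂ := fun l x => 𝔼 h, R l (x + V h) with hS
  -- Shifting `x` by `V h` leaves `A` unchanged, so `R` may be replaced by its average `S` along the
  -- directions.
  have e1 : 𝔼 l, 𝔼 x, A l x * R l x = 𝔼 i : Λ × Z, A i.1 i.2 * S i.1 i.2 := by
    rw [expect_prod_type]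
    refine Finset.expect_congr rfl fun l _ => ?_
    calc 𝔼 x, A l x * R l x = 𝔼 h : H, 𝔼 x, A l (x + V h) * R l (x + V h) := by
          simp_rw [expect_add_right (fun x => A l x * R l x)]
          rw [Fintype.expect_const]
      _ = _ := by
          rw [Finset.expect_comm]
          refine Finset.expect_congr rfl fun x _ => ?_
          simp only [hS, hAV, Finset.mul_expect]
  -- Writing `w = √w · √w` makes Cauchy–Schwarz produce the mean of `w` and the mean of `w ‖S‖²`.
  have e2 : ‖𝔼 l, 𝔼 x, A l x * R l x‖ ≤
      𝔼 i : Λ × Z, √(w i.1 i.2) * (√(w i.1 i.2) * ‖S i.1 i.2‖) := by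
    rw [e1]
    refine (RCLike.norm_expect_le (K := ℝ)).trans (Finset.expect_le_expect fun i _ => ?_)
    rw [norm_mul, ← mul_assoc, Real.mul_self_sqrt (hw _ _)]
    exact mul_le_mul_of_nonneg_right (hA _ _) (norm_nonneg _)
  have e3 := (pow_le_pow_left₀ (norm_nonneg _) e2 2).trans
    (Finset.expect_mul_sq_le_sq_mul_sq _ _ _)
  -- Expand `‖S‖²` as a double average over `h, h'`; translating `x` along `V`, where `w` is
  -- invariant, leaves only the difference of the two shifts.
  have e4 : ((𝔼 i : Λ × Z, (√(w i.1 i.2) * ‖S i.1 i.2‖) ^ 2 : ℝ) : ℂ) =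
      𝔼 i : Λ × H, 𝔼 x, (w i.1 x : ℂ) * (R i.1 x * (starRingEnd ℂ) (R i.1 (x + V i.2))) := by
    rw [Complex.ofReal_expect, expect_prod_type, expect_prod_type]
    refine Finset.expect_congr rfl fun l _ => ?_
    have h1 : ∀ x, (((√(w l x) * ‖S l x‖) ^ 2 : ℝ) : ℂ) =
        𝔼 h, 𝔼 h', (w l x : ℂ) * (R l (x + V h) * (starRingEnd ℂ) (R l (x + V h'))) := fun x => by
      rw [mul_pow, Real.sq_sqrt (hw _ _), Complex.ofReal_mul, Complex.ofReal_pow,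
        ← Complex.mul_conj']
      simp only [hS, ← Finset.mul_expect, map_expect, ← Finset.expect_mul]
    simp only [h1]
    rw [Finset.expect_comm]
    have h2 : ∀ h, 𝔼 x, 𝔼 h', (w l x : ℂ) * (R l (x + V h) * (starRingEnd ℂ) (R l (x + V h'))) =
        𝔼 h', 𝔼 x, (w l x : ℂ) * (R l x * (starRingEnd ℂ) (R l (x + V h'))) := fun h => by
      rw [Finset.expect_comm, ← expect_add_right _ h]
      refine Finset.expect_congr rfl fun h' _ => ?_
      rw [← expect_add_right (fun x => (w l x : ℂ) * (R l x * (starRingEnd ℂ) (R l (x + V h'))))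
        (V h)]
      refine Finset.expect_congr rfl fun x _ => ?_
      rw [hwV, map_add, add_assoc, add_comm (V h') (V h)]
    simp only [h2]
    rw [Fintype.expect_const]
  rw [← e4, Complex.norm_real, Real.norm_of_nonneg
    (Finset.expect_nonneg fun _ _ => sq_nonneg _)]
  refine e3.trans (mul_le_mul_of_nonneg_right ?_ (Finset.expect_nonneg fun _ _ => sq_nonneg _))
  simp only [Real.sq_sqrt (hw _ _)]
  rwa [expect_prod_type]

open Classical in
/-- The product of the weights `μ j` over the vertices of a parallelepiped selected by `S`. -/
noncomputable def cubeWeight {Z J : Type} [AddCommGroup Z] [Fintype J] {m : ℕ}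
    (S : J → (Fin m → Bool) → Prop) (μ : J → Z → ℝ) (x : Z)
    (h : Fin m → Z) : ℝ :=
  ∏ j, ∏ ω, if S j ω then μ j (cubeVertex x h ω) else 1

-- If `B j` holds, `μ j` is doubled along the first edge; otherwise only the face `ω 0 = false`
-- carries it. The selector encodes exactly this choice.
open Classical in
theorem cubeWeight_succ {Z J : Type} [AddCommGroup Z] [Fintype J] {m : ℕ}
    (S : J → (Fin m → Bool) → Prop) (B : J → Bool) (μ : J → Z → ℝ)
    (x a : Z) (h : Fin m → Z) :
    cubeWeight (fun j (ω : Fin (m + 1) → Bool) => S j (Fin.tail ω) ∧ (ω 0 → B j)) μ x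
        (Fin.cons a h : Fin (m + 1) → Z) =
      cubeWeight S (fun j y => if B j then μ j y * μ j (y + a) else μ j y) x h := by
  unfold cubeWeight
  refine Finset.prod_congr rfl fun j _ => ?_
  rw [prod_bool_cube_succ]
  refine Finset.prod_congr rfl fun ω _ => ?_
  simp only [cubeVertex_cons, Fin.tail_cons, Fin.cons_zero, cubeVertex_add]
  by_cases hS : S j ω <;> by_cases hB : B j <;> simp [hS, hB]

set_option maxHeartbeats 800000 in
/-- The weighted Gowers–Cauchy–Schwarz inequality. The functions `G j`, dominated by `μ j`, are
invariant in the directions `V k` with `k ∉ B j`. -/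
theorem norm_expect_pow_le_cubeProd {Z H J : Type} [AddCommGroup Z] [Fintype Z] [AddCommGroup H]
    [Fintype H] [Fintype J] (m : ℕ) : ∀ {Λ : Type} [Fintype Λ] [Nonempty Λ]
    (V : Fin m → H →+ Z) (B : J → Fin m → Bool) (f : Λ → Z → ℂ) (G : J → Λ → Z → ℂ)
    (μ : J → Λ → Z → ℝ) (c : ℝ), 1 ≤ c → (∀ j l x, ‖G j l x‖ ≤ μ j l x) →
    (∀ j k, B j k = false → ∀ l x h, G j l (x + V k h) = G j l x) →
    (∀ j k, B j k = false → ∀ l x h, μ j l (x + V k h) = μ j l x) →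
    (∀ j, (∃ k, B j k = false) ∨ ∀ l x, G j l x = μ j l x) →
    (∀ S : J → (Fin m → Bool) → Prop, (∀ j ω, S j ω → ∀ k, ω k → B j k) →
      𝔼 l, 𝔼 x, 𝔼 g : Fin m → H, cubeWeight S (fun j => μ j l) x (fun k => V k (g k)) ≤ c) →
    ‖𝔼 l, 𝔼 x, f l x * ∏ j, G j l x‖ ^ 2 ^ m ≤ c ^ (2 ^ m - 1) *
      ‖𝔼 l, 𝔼 x, 𝔼 g : Fin m → H, cubeProd (f l) x (fun k => V k (g k)) *
        (cubeWeight (fun j ω => ∀ k, ω k → B j k) (fun j => μ j l) x (fun k => V k (g k)) : ℂ)‖ := by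
  induction m with
  | zero =>
    intro Λ _ _ V B f G μ c hc hG hGV hμV hB hmom
    have hG' : ∀ j l x, G j l x = μ j l x := fun j => (hB j).resolve_left (by simp)
    simp [cubeProd_zero, cubeWeight, hG', cubeVertex]
  | succ m ih =>
    intro Λ _ _ V B f G μ c hc hG hGV hμV hB hmom
    have hμ0 : ∀ j l x, 0 ≤ μ j l x := fun j l x => (norm_nonneg _).trans (hG j l x)
    set V' : Fin m → H →+ Z := fun k => V k.succ
    set B' : J → Fin m → Bool := fun j k => B j k.succ
    set f' : Λ × H → Z → ℂ := fun i x => f i.1 x * (starRingEnd ℂ) (f i.1 (x + V 0 i.2))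
    -- Factors invariant under `V 0` are eliminated now and leave only their majorant; the others
    -- are differenced along with `f`. Once a factor equals its weight it needs no further
    -- elimination, which is why the hypothesis on `B` is a disjunction.
    set G' : J → Λ × H → Z → ℂ := fun j i x =>
      if B j 0 then G j i.1 x * (starRingEnd ℂ) (G j i.1 (x + V 0 i.2)) else (μ j i.1 x : ℂ)
    set μ' : J → Λ × H → Z → ℝ := fun j i x =>
      if B j 0 then μ j i.1 x * μ j i.1 (x + V 0 i.2) else μ j i.1 x
    have hmom' : ∀ S : J → (Fin m → Bool) → Prop, (∀ j ω, S j ω → ∀ k, ω k → B' j k) →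
        𝔼 i, 𝔼 x, 𝔼 g : Fin m → H,
          cubeWeight S (fun j => μ' j i) x (fun k => V' k (g k)) ≤ c := by
      intro S hS
      refine le_of_eq_of_le ?_ (hmom (fun j ω => S j (Fin.tail ω) ∧ (ω 0 → B j 0)) ?_)
      · rw [← expect_prod_fin_succ]
        simp only [cons_apply_eq (fun k => V k), cubeWeight_succ S (fun j => B j 0), μ', V']
      · intro j ω hω k
        refine Fin.cases hω.2 (fun k hk => hS j _ hω.1 k hk) k
    -- The mean of the weight in the first step is the moment that selects the base vertex alone.
    have hfirst : 𝔼 l, 𝔼 x, ∏ j, (if B j 0 then 1 else μ j l x) ≤ c := by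
      refine le_of_eq_of_le ?_ (hmom (fun j ω => ω = (fun _ => false) ∧ B j 0 = false) ?_)
      · refine Finset.expect_congr rfl fun l _ => Finset.expect_congr rfl fun x _ => ?_
        have : ∀ g : Fin (m + 1) → H, cubeWeight (fun j ω => ω = (fun _ => false) ∧ B j 0 = false)
            (fun j => μ j l) x (fun k => V k (g k)) = ∏ j, (if B j 0 then 1 else μ j l x) := by
          intro g
          refine Finset.prod_congr rfl fun j _ => ?_
          rw [Finset.prod_eq_single (fun _ => false)]
          · by_cases hB : B j 0 <;> simp [hB, cubeVertex_false]
          · intro ω _ hω; simp [hω]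
          · simp
        simp only [this, Fintype.expect_const]
      · rintro j ω ⟨rfl, -⟩ k hk
        simp at hk
    have step := norm_expect_sq_le_of_invariant (V 0)
      (fun l x => ∏ j, (if B j 0 then 1 else G j l x))
      (fun l x => f l x * ∏ j, (if B j 0 then G j l x else 1))
      (fun l x => ∏ j, (if B j 0 then 1 else μ j l x))
      (fun l x => by
        rw [norm_prod]
        refine Finset.prod_le_prod (fun _ _ => norm_nonneg _) fun j _ => ?_
        split_ifs
        · simp
        · exact hG j l x)
      (fun l x h => Finset.prod_congr rfl fun j _ => by
        split_ifs with hj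
        · rfl
        · exact hGV j 0 (by simpa using hj) l x h)
      (fun l x h => Finset.prod_congr rfl fun j _ => by
        split_ifs with hj
        · rfl
        · exact hμV j 0 (by simpa using hj) l x h)
      c hfirst
    have e1 : ∀ l x, (∏ j, (if B j 0 then 1 else G j l x)) *
        (f l x * ∏ j, (if B j 0 then G j l x else 1)) = f l x * ∏ j, G j l x := by
      intro l x
      rw [mul_left_comm, ← Finset.prod_mul_distrib]
      congr 1
      refine Finset.prod_congr rfl fun j _ => ?_
      split_ifs <;> simp
    have e2 : ∀ (i : Λ × H) x, ((∏ j, (if B j 0 then 1 else μ j i.1 x) : ℝ) : ℂ) *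
        (f i.1 x * (∏ j, (if B j 0 then G j i.1 x else 1)) *
          (starRingEnd ℂ) (f i.1 (x + V 0 i.2) *
            ∏ j, (if B j 0 then G j i.1 (x + V 0 i.2) else 1))) = f' i x * ∏ j, G' j i x := by
      intro i x
      rw [map_mul, map_prod, mul_mul_mul_comm, ← Finset.prod_mul_distrib, mul_left_comm,
        Complex.ofReal_prod, ← Finset.prod_mul_distrib]
      congr 1
      refine Finset.prod_congr rfl fun j _ => ?_
      simp only [G']
      split_ifs <;> simp
    simp only [e1, e2] at step
    have hih := ih V' B' f' G' μ' c hc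
      (fun j i x => by
        simp only [G', μ']
        split_ifs
        · rw [norm_mul, RCLike.norm_conj]
          exact mul_le_mul (hG _ _ _) (hG _ _ _) (norm_nonneg _) (hμ0 _ _ _)
        · rw [Complex.norm_real, Real.norm_of_nonneg (hμ0 _ _ _)])
      (fun j k hk i x h => by
        simp only [G', V']
        rw [add_right_comm, hGV j k.succ hk, hGV j k.succ hk, hμV j k.succ hk])
      (fun j k hk i x h => by
        simp only [μ', V']
        rw [add_right_comm, hμV j k.succ hk, hμV j k.succ hk])
      (fun j => by
        by_cases h0 : B j 0
        · rcases hB j with ⟨k, hk⟩ | hj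
          · left
            obtain ⟨k', rfl⟩ : ∃ k', k = Fin.succ k' :=
              Fin.exists_succ_eq.2 (fun h => by simp [h, h0] at hk) |>.imp fun _ h => h.symm
            exact ⟨k', hk⟩
          · right
            intro i x
            simp [G', μ', h0, hj]
        · right
          intro i x
          simp [G', μ', h0])
      hmom'
    have e3 : (𝔼 i, 𝔼 x, 𝔼 g : Fin m → H, cubeProd (f' i) x (fun k => V' k (g k)) *
        (cubeWeight (fun j ω => ∀ k, ω k → B' j k) (fun j => μ' j i) x
          (fun k => V' k (g k)) : ℂ)) =
        𝔼 l, 𝔼 x, 𝔼 g : Fin (m + 1) → H, cubeProd (f l) x (fun k => V k (g k)) *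
          (cubeWeight (fun j ω => ∀ k, ω k → B j k) (fun j => μ j l) x
            (fun k => V k (g k)) : ℂ) := by
      rw [← expect_prod_fin_succ]
      refine Finset.expect_congr rfl fun i _ => Finset.expect_congr rfl fun x _ =>
        Finset.expect_congr rfl fun g _ => ?_
      rw [cons_apply_eq (fun k => V k), cubeProd_succ]
      simp only [Fin.cons_zero, Fin.tail_cons, f']
      congr 2
      have := cubeWeight_succ (fun j ω => ∀ k, ω k → B' j k) (fun j => B j 0)
        (fun j => μ j i.1) x (V 0 i.2) (fun k => V' k (g k))
      refine this.symm.trans ?_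
      congr 1
      funext j ω
      exact propext ⟨fun h k => Fin.cases h.2 (fun k => h.1 k) k,
        fun h => ⟨fun k => h k.succ, h 0⟩⟩
    rw [e3] at hih
    calc ‖𝔼 l, 𝔼 x, f l x * ∏ j, G j l x‖ ^ 2 ^ (m + 1)
        = (‖𝔼 l, 𝔼 x, f l x * ∏ j, G j l x‖ ^ 2) ^ 2 ^ m := by rw [← pow_mul, pow_succ']
      _ ≤ (c * ‖𝔼 i, 𝔼 x, f' i x * ∏ j, G' j i x‖) ^ 2 ^ m :=
          pow_le_pow_left₀ (sq_nonneg _) step _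
      _ ≤ c ^ 2 ^ m * (c ^ (2 ^ m - 1) * _) := by
          rw [mul_pow]
          exact mul_le_mul_of_nonneg_left hih (by positivity)
      _ = _ := by
          rw [← mul_assoc, ← pow_add]
          congr 2
          have := Nat.one_le_two_pow (n := m)
          rw [pow_succ]
          omega

end CauchySchwarz

/-! ### Bounded integer directions from Cauchy–Schwarz complexity. -/

section LinearAlgebra

open Matrix

theorem abs_det_le_of_abs_le {d : ℕ} {M : Matrix (Fin d) (Fin d) ℤ} {L : ℝ}
    (h : ∀ i j, |(M i j : ℝ)| ≤ L) : |(M.det : ℝ)| ≤ d.factorial * L ^ d := by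
  have := Matrix.det_le (A := M.map (fun x : ℤ => (x : ℝ))) (abv := AbsoluteValue.abs) (x := L)
    (fun i j => by simpa using h i j)
  rw [Int.cast_det]
  simpa using this

theorem abs_adjugate_le_of_abs_le {d : ℕ} {M : Matrix (Fin d) (Fin d) ℤ} {L : ℝ} (hL : 1 ≤ L)
    (h : ∀ i j, |(M i j : ℝ)| ≤ L) (i j : Fin d) :
    |(M.adjugate i j : ℝ)| ≤ d.factorial * L ^ d := by
  rw [Matrix.adjugate_apply]
  refine abs_det_le_of_abs_le fun a b => ?_
  rw [Matrix.updateRow_apply]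
  split_ifs
  · by_cases hb : b = i
    · subst hb; simpa using hL
    · simpa [Pi.single_apply, hb] using zero_le_one.trans hL
  · exact h a b

/-- A Cramer type statement: if the rows `Q i` vanish on vectors `v b` which `P` maps to multiples
of the standard basis vectors, then there are such vectors with small entries. -/
theorem exists_bounded_scaled_section {ι : Type} {d n : ℕ} (P : Matrix (Fin n) (Fin d) ℤ)
    (Q : ι → Fin d → ℤ) {L : ℝ} (hL : 1 ≤ L) (hP : ∀ a b, |(P a b : ℝ)| ≤ L)
    (hQ : ∀ i b, |(Q i b : ℝ)| ≤ L) {D₀ : ℤ} (hD₀ : D₀ ≠ 0) (v : Fin n → Fin d → ℤ)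
    (hPv : ∀ b, P *ᵥ v b = Pi.single b D₀) (hQv : ∀ i b, Q i ⬝ᵥ v b = 0) :
    ∃ (V : Matrix (Fin d) (Fin n) ℤ) (D : ℤ), D ≠ 0 ∧ (∀ i, Q i ᵥ* V = 0) ∧ P * V = D • 1 ∧
      (∀ a b, |(V a b : ℝ)| ≤ d.factorial * L ^ d) ∧ |(D : ℝ)| ≤ d.factorial * L ^ d := by
  classical
  let u : (Fin n ⊕ ι) ⊕ Fin d → Fin d → ℤ := Sum.elim (Sum.elim P Q) (fun a => Pi.single a 1)
  let uQ : (Fin n ⊕ ι) ⊕ Fin d → Fin d → ℚ := fun i a => u i a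
  have hu : ∀ i a, |(u i a : ℝ)| ≤ L := by
    rintro ((i | i) | i) a
    · exact hP i a
    · exact hQ i a
    · by_cases h : a = i
      · subst h; simpa [u] using hL
      · simpa [u, Pi.single_apply, h] using zero_le_one.trans hL
  have cast_dot : ∀ (x y : Fin d → ℤ), (fun a => (x a : ℚ)) ⬝ᵥ (fun a => (y a : ℚ)) =
      ((x ⬝ᵥ y : ℤ) : ℚ) := fun x y => by simp [dotProduct]
  have hPv' : ∀ a b, P a ⬝ᵥ v b = if a = b then D₀ else 0 := fun a b => by
    have := congrFun (hPv b) a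
    rwa [Pi.single_apply] at this
  have hind : LinearIndepOn ℚ uQ (Set.range fun b : Fin n => Sum.inl (Sum.inl b)) := by
    rw [linearIndepOn_range_iff (fun a b h => Sum.inl_injective (Sum.inl_injective h)),
      Fintype.linearIndependent_iff]
    intro g hg b
    have h1 := congrArg (· ⬝ᵥ (fun a => (v b a : ℚ))) hg
    have h2 : ∀ x : Fin n, (uQ ∘ fun b : Fin n => Sum.inl (Sum.inl b)) x ⬝ᵥ
        (fun a => (v b a : ℚ)) = if x = b then (D₀ : ℚ) else 0 := fun x => by
      refine (cast_dot (P x) (v b)).trans ?_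
      rw [hPv']; split_ifs <;> simp
    simp only [sum_dotProduct, smul_dotProduct, h2, zero_dotProduct] at h1
    simpa [hD₀] using h1
  -- The rows of `P` are independent, as the `v b` show. They are extended by rows of `Q` to a basis
  -- `b₁` of the span of all rows of `P` and `Q`, and then by coordinate vectors to a basis `b₂` of
  -- `ℚ^d`.
  obtain ⟨b₁, hb₁t, hsb₁, hspan₁, hind₁⟩ := exists_linearIndepOn_extension hind
    (t := Set.range Sum.inl) (by rintro _ ⟨b, rfl⟩; exact ⟨_, rfl⟩)
  obtain ⟨b₂, -, hb₁₂, hspan₂, hind₂⟩ := exists_linearIndepOn_extension hind₁ (Set.subset_univ _)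
  have htop : ⊤ ≤ Submodule.span ℚ (Set.range fun x : b₂ => uQ x) := by
    rw [← (Pi.basisFun ℚ (Fin d)).span_eq, Submodule.span_le]
    rintro _ ⟨a, rfl⟩
    have := hspan₂ ⟨Sum.inr a, Set.mem_univ _, rfl⟩
    rw [Set.image_eq_range] at this
    convert this using 1
    funext c
    simp [uQ, u, Pi.single_apply]
  let e : Fin d ≃ b₂ :=
    (Pi.basisFun ℚ (Fin d)).indexEquiv (Module.Basis.mk hind₂.linearIndependent htop)
  let M : Matrix (Fin d) (Fin d) ℤ := fun i => u (e i)
  have hdet : M.det ≠ 0 := by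
    have h1 : LinearIndependent ℚ (M.map (fun x : ℤ => (x : ℚ))).row :=
      hind₂.linearIndependent.comp e e.injective
    rw [Matrix.linearIndependent_rows_iff_isUnit, Matrix.isUnit_iff_isUnit_det,
      ← Int.cast_det] at h1
    exact_mod_cast h1.ne_zero
  have hmem : ∀ b : Fin n, (Sum.inl (Sum.inl b) : (Fin n ⊕ ι) ⊕ Fin d) ∈ b₂ :=
    fun b => hb₁₂ (hsb₁ ⟨b, rfl⟩)
  -- Cramer's rule: these columns of the adjugate are `det M` times the dual basis vectors of the
  -- rows of `P`, with entries bounded by minors.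
  let col : Fin n → Fin d → ℤ := fun b a => M.adjugate a (e.symm ⟨_, hmem b⟩)
  have hcol : ∀ i (hi : i ∈ b₂) b, u i ⬝ᵥ col b = if i = Sum.inl (Sum.inl b) then M.det else 0 := by
    intro i hi b
    have h1 : M (e.symm ⟨i, hi⟩) = u i := by simp [M]
    have h2 := congrFun (congrFun M.mul_adjugate (e.symm ⟨i, hi⟩)) (e.symm ⟨_, hmem b⟩)
    rw [Matrix.mul_apply', h1] at h2
    refine h2.trans ?_
    simp [Matrix.one_apply]
  have hzero : ∀ i b, Q i ⬝ᵥ col b = 0 := by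
    intro i b
    -- On the basis `b₁` both `D₀ • col b` and `det M • v b` pair to `D₀ det M` with row `b` of `P`
    -- and to `0` with the other elements. Hence they agree on the whole span, which contains every
    -- row of `Q`.
    have key : ∀ x ∈ Submodule.span ℚ (uQ '' b₁),
        (D₀ : ℚ) * (x ⬝ᵥ fun a => (col b a : ℚ)) = M.det * (x ⬝ᵥ fun a => (v b a : ℚ)) := by
      intro x hx
      induction hx using Submodule.span_induction with
      | mem x h =>
        obtain ⟨k, hk, rfl⟩ := h
        simp only [uQ, cast_dot, hcol k (hb₁₂ hk)]
        obtain ⟨k, rfl⟩ := hb₁t hk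
        rcases k with k | k
        · have : u (Sum.inl (Sum.inl k)) ⬝ᵥ v b = if k = b then D₀ else 0 := hPv' k b
          rw [this]
          by_cases hkb : k = b <;> simp [hkb, mul_comm]
        · have : u (Sum.inl (Sum.inr k)) ⬝ᵥ v b = 0 := hQv k b
          simp [this]
      | zero => simp
      | add x y _ _ hx hy => rw [add_dotProduct, add_dotProduct, mul_add, mul_add, hx, hy]
      | smul a x _ hx =>
        rw [smul_dotProduct, smul_dotProduct, smul_eq_mul, smul_eq_mul, mul_left_comm, hx]; ring
    have h1 := key _ (hspan₁ ⟨Sum.inl (Sum.inr i), ⟨_, rfl⟩, rfl⟩)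
    simp only [uQ, cast_dot] at h1
    have h2 : u (Sum.inl (Sum.inr i)) ⬝ᵥ v b = 0 := hQv i b
    rw [h2] at h1
    have h3 : (u (Sum.inl (Sum.inr i)) ⬝ᵥ col b : ℤ) = 0 := by
      have : (D₀ : ℚ) ≠ 0 := by exact_mod_cast hD₀
      simpa [this] using h1
    exact h3
  refine ⟨Matrix.of fun a b => col b a, M.det, hdet, fun i => funext fun b => hzero i b, ?_, ?_, ?_⟩
  · ext a b
    rw [Matrix.mul_apply']
    refine (hcol _ (hmem a) b).trans ?_
    simp [Matrix.one_apply]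
  · exact fun a b => abs_adjugate_le_of_abs_le hL (fun i j => hu _ _) _ _
  · exact abs_det_le_of_abs_le fun i j => hu _ _

/-- The matrix of the linear part of an affine-linear map. -/
def linMatrix {d n : ℕ} (ψ : (Fin d → ℤ) →ᵃ[ℤ] (Fin n → ℤ)) : Matrix (Fin n) (Fin d) ℤ :=
  Matrix.of (linCoeff ψ)

theorem linear_eq_linMatrix_mulVec {d n : ℕ} (ψ : (Fin d → ℤ) →ᵃ[ℤ] (Fin n → ℤ)) (x : Fin d → ℤ) :
    ψ.linear x = linMatrix ψ *ᵥ x := by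
  have : linMatrix ψ = LinearMap.toMatrix' ψ.linear := by
    ext i j; simp [linMatrix, linCoeff, LinearMap.toMatrix'_apply]
  rw [this, LinearMap.toMatrix'_mulVec]

theorem exists_smul_mem_of_finite_quotient {M : Type*} [AddCommGroup M] (S : Submodule ℤ M)
    [Finite (M ⧸ S)] : ∃ D : ℤ, D ≠ 0 ∧ ∀ y, D • y ∈ S := by
  refine ⟨Nat.card (M ⧸ S), by exact_mod_cast Nat.card_pos.ne', fun y => ?_⟩
  rw [← Submodule.Quotient.mk_eq_zero, Submodule.Quotient.mk_smul, natCast_zsmul]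
  exact card_nsmul_eq_zero'

/-- The order `D` of a finite cokernel carries every basis vector into the image; the preimages,
taken in the common kernel of a class, are the directions, still without any bound on their size. -/
theorem exists_kernel_sections {t d n s : ℕ} (ψ : Fin t → (Fin d → ℤ) →ᵃ[ℤ] (Fin n → ℤ))
    (i : Fin t) (h : ComplexityLEAt (fun i => (ψ i).linear) s i) :
    ∃ c : {j : Fin t // j ≠ i} → Fin (s + 1), ∀ k, ∃ (D : ℤ) (v : Fin n → Fin d → ℤ), D ≠ 0 ∧
      (∀ b, linMatrix (ψ i) *ᵥ v b = Pi.single b D) ∧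
        ∀ j, c j = k → ∀ b, linMatrix (ψ j) *ᵥ v b = 0 := by
  obtain ⟨c, hc⟩ := h
  refine ⟨c, fun k => ?_⟩
  have := hc k
  obtain ⟨D, hD, hS⟩ := exists_smul_mem_of_finite_quotient (Submodule.map ((ψ i).linear)
    (⨅ j : {j : Fin t // j ≠ i}, ⨅ _ : c j = k, LinearMap.ker ((ψ j).linear)))
  have h1 : ∀ b : Fin n, ∃ v, (∀ j, c j = k → linMatrix (ψ j) *ᵥ v = 0) ∧
      linMatrix (ψ i) *ᵥ v = Pi.single b D := by
    intro b
    obtain ⟨v, hv, hv'⟩ := Submodule.mem_map.1 (hS (Pi.single b 1))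
    simp only [Submodule.mem_iInf, LinearMap.mem_ker, linear_eq_linMatrix_mulVec] at hv hv'
    refine ⟨v, fun j hj => hv j hj, ?_⟩
    rw [hv', ← Pi.single_smul]
    simp
  choose v hv hv' using h1
  exact ⟨D, v, hD, hv', fun j hj b => hv b j hj⟩

/-- For `L < 1` the integer matrix would vanish, and the zero map to `ℤ^n` has infinite cokernel. -/
theorem one_le_of_complexityLEAt {t d n s : ℕ} (hn : 0 < n)
    (ψ : Fin t → (Fin d → ℤ) →ᵃ[ℤ] (Fin n → ℤ)) (i : Fin t)
    (h : ComplexityLEAt (fun i => (ψ i).linear) s i) {L : ℝ} (hL : LinCoeffsLE (ψ i) L) :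
    1 ≤ L := by
  by_contra! hlt
  obtain ⟨c, hc⟩ := exists_kernel_sections ψ i h
  obtain ⟨D, v, hD, hv, -⟩ := hc 0
  have h0 : linMatrix (ψ i) = 0 := by
    ext a b
    have h1 : |(linCoeff (ψ i) a b : ℝ)| < 1 := (hL a b).trans_lt hlt
    have h2 : |linCoeff (ψ i) a b| < 1 := by exact_mod_cast h1
    exact Int.abs_lt_one_iff.1 h2
  have := congrFun (hv ⟨0, hn⟩) ⟨0, hn⟩
  rw [h0] at this
  simp at this
  exact hD this.symm

/-- Complexity at most `s` yields `s + 1` bounded integer systems of directions, each of which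
maps isomorphically (over `ℚ`) under the `i`-th form; every other form is killed by one of them. -/
theorem exists_directions {t d n s : ℕ} (ψ : Fin t → (Fin d → ℤ) →ᵃ[ℤ] (Fin n → ℤ))
    (i : Fin t) (h : ComplexityLEAt (fun i => (ψ i).linear) s i) {L : ℝ} (hL1 : 1 ≤ L)
    (hL : ∀ j, LinCoeffsLE (ψ j) L) :
    ∃ (V : Fin (s + 1) → Matrix (Fin d) (Fin n) ℤ) (D : Fin (s + 1) → ℤ), (∀ k, D k ≠ 0) ∧
      (∀ k, linMatrix (ψ i) * V k = D k • 1) ∧ (∀ j, j ≠ i → ∃ k, linMatrix (ψ j) * V k = 0) ∧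
      (∀ k a b, |(V k a b : ℝ)| ≤ d.factorial * L ^ d) ∧
      ∀ k, |(D k : ℝ)| ≤ d.factorial * L ^ d := by
  obtain ⟨c, hc⟩ := exists_kernel_sections ψ i h
  have h1 : ∀ k, ∃ (V : Matrix (Fin d) (Fin n) ℤ) (D : ℤ), D ≠ 0 ∧
      (∀ j, c j = k → linMatrix (ψ j) * V = 0) ∧ linMatrix (ψ i) * V = D • 1 ∧
      (∀ a b, |(V a b : ℝ)| ≤ d.factorial * L ^ d) ∧ |(D : ℝ)| ≤ d.factorial * L ^ d := by
    intro k
    obtain ⟨D₀, v, hD₀, hv, hv'⟩ := hc k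
    obtain ⟨V, D, hD, hQ, hP, hV, hD'⟩ := exists_bounded_scaled_section
      (ι := {j // c j = k} × Fin n) (linMatrix (ψ i)) (fun a => linMatrix (ψ a.1.1) a.2) hL1
      (hL i) (fun a => hL a.1.1 a.2) hD₀ v hv (fun a b => congrFun (hv' a.1.1 a.1.2 b) a.2)
    refine ⟨V, D, hD, fun j hj => ?_, hP, hV, hD'⟩
    ext a b
    exact congrFun (hQ (⟨j, hj⟩, a)) b
  choose V D hD hQ hP hV hD' using h1
  exact ⟨V, D, hD, hP, fun j hj => ⟨c ⟨j, hj⟩, hQ _ ⟨j, hj⟩ rfl⟩, hV, hD'⟩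

end LinearAlgebra

/-- Iterated Bertrand postulate: a prime of controlled size not dividing a given integer. -/
theorem exists_prime_not_dvd (k : ℕ) : ∀ (P : ℕ) (D : ℤ), P ≠ 0 → D ≠ 0 → D.natAbs < P ^ k →
    ∃ p, p.Prime ∧ P < p ∧ p ≤ 2 ^ k * P ∧ ¬ (p : ℤ) ∣ D := by
  induction k with
  | zero =>
    intro P D _ hD h
    simp at h
    exact absurd h hD
  | succ k ih =>
    intro P D hP hD h
    obtain ⟨p, hp, h1, h2⟩ := Nat.exists_prime_lt_and_le_two_mul P hP
    -- If the Bertrand prime `p ≤ 2P` divides `D`, restart from `2P` with `D / p`, which has lost a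
    -- factor larger than `P`. The new prime exceeds `2P`, so it differs from `p`.
    by_cases hdvd : (p : ℤ) ∣ D
    · obtain ⟨D', rfl⟩ := hdvd
      have hD' : D' ≠ 0 := fun h0 => hD (by simp [h0])
      have hlt : D'.natAbs < (2 * P) ^ k := by
        rw [Int.natAbs_mul, Int.natAbs_natCast, pow_succ'] at h
        have h3 : P * D'.natAbs < P * P ^ k :=
          lt_of_le_of_lt (Nat.mul_le_mul_right _ h1.le) h
        exact (Nat.lt_of_mul_lt_mul_left h3).trans_le (Nat.pow_le_pow_left (by omega) k)
      obtain ⟨q, hq, hq1, hq2, hq3⟩ := ih (2 * P) D' (by omega) hD' hlt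
      refine ⟨q, hq, by omega, ?_, fun hdiv => ?_⟩
      · rw [pow_succ, mul_assoc]; exact hq2
      · rcases (Nat.prime_iff_prime_int.1 hq).dvd_or_dvd hdiv with h4 | h4
        · have := (Nat.prime_dvd_prime_iff_eq hq hp).1 (by exact_mod_cast h4)
          omega
        · exact hq3 h4
    · refine ⟨p, hp, h1, h2.trans ?_, hdvd⟩
      have := Nat.one_le_two_pow (n := k)
      rw [pow_succ]
      nlinarith

/-! ### The linear forms condition for systems of parallelepiped vertices. -/

section LinearForms

open Matrix

/-- The reduction of an integer matrix to a ring. -/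
abbrev castMatrix (R : Type*) [Ring R] {α β : Type*} (M : Matrix α β ℤ) : Matrix α β R :=
  M.map (Int.cast : ℤ → R)

theorem castMatrix_mul (R : Type*) [CommRing R] {α β γ : Type*} [Fintype β] (M : Matrix α β ℤ)
    (M' : Matrix β γ ℤ) : castMatrix R (M * M') = castMatrix R M * castMatrix R M' :=
  Matrix.map_mul (f := Int.castRingHom R)

theorem castMatrix_zero (R : Type*) [Ring R] {α β : Type*} :
    castMatrix R (0 : Matrix α β ℤ) = 0 := by
  ext; simp

theorem castMatrix_smul_one (R : Type*) [Ring R] {α : Type*} [DecidableEq α] (D : ℤ) :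
    castMatrix R (D • (1 : Matrix α α ℤ)) = (D : R) • 1 := by
  ext i j
  change (((D • (1 : Matrix α α ℤ)) i j : ℤ) : R) = ((D : R) • (1 : Matrix α α R)) i j
  rw [Matrix.smul_apply, Matrix.smul_apply, Matrix.one_apply, Matrix.one_apply]
  split_ifs <;> simp

theorem castMatrix_int {α β : Type*} (M : Matrix α β ℤ) : castMatrix ℤ M = M := by
  ext; simp

theorem affineMod_eq_mulVec {d n : ℕ} (p : ℕ) (ψ : (Fin d → ℤ) →ᵃ[ℤ] (Fin n → ℤ))
    (x : Fin d → ZMod p) :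
    affineMod p ψ x = castMatrix (ZMod p) (linMatrix ψ) *ᵥ x + fun i => (ψ 0 i : ZMod p) := rfl

theorem affineMod_add {d n : ℕ} (p : ℕ) (ψ : (Fin d → ℤ) →ᵃ[ℤ] (Fin n → ℤ))
    (x y : Fin d → ZMod p) :
    affineMod p ψ (x + y) = affineMod p ψ x + castMatrix (ZMod p) (linMatrix ψ) *ᵥ y := by
  rw [affineMod_eq_mulVec, affineMod_eq_mulVec, mulVec_add]; abel

/-- The linear forms condition for systems with arbitrary finite index types. -/
theorem LinearFormsCondition.of_fintype {n t d : ℕ} {L N ρ : ℝ} {ν : (Fin n → ℤ) → ℝ}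
    (h : LinearFormsCondition t d L N ρ ν) {I κ : Type} [Fintype I] [Fintype κ]
    [DecidableEq κ] (hI : Fintype.card I ≤ t) (hκ : Fintype.card κ ≤ d) (A : I → Matrix (Fin n) κ ℤ)
    (a : I → Fin n → ℤ) (hL : ∀ i b k, |(A i b k : ℝ)| ≤ L)
    (hker : ∀ i j, i ≠ j → ∃ x, A i *ᵥ x = 0 ∧ A j *ᵥ x ≠ 0)
    (hcok : ∀ i, ∃ D : ℤ, D ≠ 0 ∧ ∀ b, ∃ x, A i *ᵥ x = Pi.single b D)
    (p : ℕ) [Fact p.Prime] (hp : N ≤ p) :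
    |1 - 𝔼 x : κ → ZMod p, ∏ i, restrictMod p ν
      (castMatrix (ZMod p) (A i) *ᵥ x + fun b => (a i b : ZMod p))| < ρ := by
  classical
  let eI := (Fintype.equivFin I).symm
  let e := (Fintype.equivFin κ).symm
  let ψ : Fin (Fintype.card I) → (Fin (Fintype.card κ) → ℤ) →ᵃ[ℤ] (Fin n → ℤ) := fun i =>
    ((A (eI i)).submatrix id e).mulVecLin.toAffineMap + AffineMap.const ℤ _ (a (eI i))
  have hlin : ∀ i x, (ψ i).linear x = A (eI i) *ᵥ (x ∘ e.symm) := fun i x => by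
    simp [ψ, submatrix_mulVec_equiv]
  have hcoeff : ∀ i b k, linCoeff (ψ i) b k = A (eI i) b (e k) := fun i b k => by
    simp [linCoeff, ψ]
  have h0 : ∀ i b, ψ i 0 b = a (eI i) b := fun i b => by simp [ψ]
  have hcomp : ∀ x : κ → ℤ, (x ∘ e) ∘ e.symm = x := fun x => by
    funext k; simp
  have key := h _ hI _ hκ ψ (fun i b k => by rw [hcoeff]; exact hL _ _ _)
    (fun i j hij hle => by
      obtain ⟨x, hx, hx'⟩ := hker (eI i) (eI j) (fun h => hij (eI.injective h))
      have := hle (x := x ∘ e) (by rw [LinearMap.mem_ker, hlin, hcomp, hx])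
      rw [LinearMap.mem_ker, hlin, hcomp] at this
      exact hx' this)
    (fun i => by
      obtain ⟨D, hD, hx⟩ := hcok (eI i)
      -- The integer `D` annihilates the cokernel, which is finitely generated and therefore finite.
      refine Module.finite_of_fg_torsion _ fun {y} => ?_
      obtain ⟨y, rfl⟩ := Submodule.Quotient.mk_surjective _ y
      refine ⟨⟨D, mem_nonZeroDivisors_of_ne_zero hD⟩, ?_⟩
      refine (Submodule.Quotient.mk_eq_zero _).2 ?_
      choose x hx using hx
      refine ⟨(∑ b, y b • x b) ∘ e, ?_⟩
      rw [hlin, hcomp, mulVec_sum]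
      simp only [mulVec_smul, hx]
      funext c
      simp [Finset.sum_apply, Pi.single_apply, mul_comm])
    p hp
  convert key using 3
  refine Fintype.expect_equiv (e.symm.arrowCongr (Equiv.refl _)) _ _ fun x => ?_
  rw [← eI.prod_comp]
  refine Finset.prod_congr rfl fun i _ => ?_
  congr 1
  funext b
  simp only [affineMod, hcoeff, h0, Pi.add_apply, mulVec, dotProduct, Matrix.map_apply,
    Equiv.arrowCongr_apply, Equiv.coe_refl, Function.comp_apply, id, Equiv.symm_symm]
  congr 1
  exact (e.sum_comp fun k => (A (eI i) b k : ZMod p) * x k).symm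

/-- The coefficient matrix of the form `M (X + ∑ k, ω k • V k (g k) + θ (w ε))` in the variables
`X`, `g`, `w`. -/
def cubeFormMatrix {d n e m : ℕ} (M : Matrix (Fin n) (Fin d) ℤ)
    (V : Fin m → Matrix (Fin d) (Fin e) ℤ) (θ : Matrix (Fin d) (Fin d) ℤ) (ω : Fin m → Bool)
    (ε : Bool) : Matrix (Fin n) (Fin d ⊕ ((Fin m × Fin e) ⊕ (Bool × Fin d))) ℤ :=
  fun b => Sum.elim (M b) (Sum.elim (fun k => if ω k.1 then (M * V k.1) b k.2 else 0)
    (fun k => if k.1 = ε then (M * θ) b k.2 else 0))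

theorem cubeFormMatrix_mulVec (R : Type*) [CommRing R] {d n e m : ℕ}
    (M : Matrix (Fin n) (Fin d) ℤ) (V : Fin m → Matrix (Fin d) (Fin e) ℤ)
    (θ : Matrix (Fin d) (Fin d) ℤ) (ω : Fin m → Bool) (ε : Bool) (X : Fin d → R)
    (g : Fin m → Fin e → R) (w : Bool → Fin d → R) :
    castMatrix R (cubeFormMatrix M V θ ω ε) *ᵥ
        Sum.elim X (Sum.elim (Function.uncurry g) (Function.uncurry w)) =
      castMatrix R M *ᵥ (cubeVertex X (fun k => castMatrix R (V k) *ᵥ g k) ω +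
        castMatrix R θ *ᵥ w ε) := by
  have h1 : castMatrix R M *ᵥ cubeVertex X (fun k => castMatrix R (V k) *ᵥ g k) ω =
      cubeVertex (castMatrix R M *ᵥ X) (fun k => castMatrix R (M * V k) *ᵥ g k) ω := by
    refine (map_cubeVertex (castMatrix R M).mulVecLin _ _ _).trans ?_
    simp only [mulVecLin_apply, mulVec_mulVec, castMatrix_mul]
  rw [mulVec_add, h1, mulVec_mulVec, ← castMatrix_mul]
  funext b
  simp only [mulVec, dotProduct, Fintype.sum_sum_type, Fintype.sum_prod_type, Sum.elim_inl,
    Sum.elim_inr, Function.uncurry, cubeFormMatrix, Matrix.map_apply, cubeVertex, Pi.add_apply,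
    Finset.sum_apply]
  rw [add_assoc]
  congr 2
  · refine Finset.sum_congr rfl fun k _ => ?_
    by_cases hk : ω k <;> simp [hk, mulVec, dotProduct]
  · rw [Finset.sum_eq_single ε]
    · simp
    · intro c _ hc; simp [hc]
    · simp

/-- Splitting the variables of a cube system. -/
def cubeVarEquiv (R : Type*) (d e m : ℕ) :
    (Fin d → R) × ((Fin m → Fin e → R) × (Bool → Fin d → R)) ≃
      (Fin d ⊕ ((Fin m × Fin e) ⊕ (Bool × Fin d)) → R) where
  toFun y := Sum.elim y.1 (Sum.elim (Function.uncurry y.2.1) (Function.uncurry y.2.2))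
  invFun x := (fun a => x (Sum.inl a), fun k a => x (Sum.inr (Sum.inl (k, a))),
    fun k a => x (Sum.inr (Sum.inr (k, a))))
  left_inv _ := rfl
  right_inv x := by
    funext k
    rcases k with k | k | k <;> rfl

/-- The linear forms condition for the vertices of parallelepipeds. -/
theorem LinearFormsCondition.cube_system {n t d e m T D' : ℕ} {L N ρ : ℝ} {ν : (Fin n → ℤ) → ℝ}
    (h : LinearFormsCondition T D' L N ρ ν) (ψ : Fin t → (Fin d → ℤ) →ᵃ[ℤ] (Fin n → ℤ))
    (V : Fin m → Matrix (Fin d) (Fin e) ℤ) (θ : Matrix (Fin d) (Fin d) ℤ)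
    (I : Finset (Fin t × (Fin m → Bool) × Bool)) (hI : I.card ≤ T)
    (hD' : d + (m * e + 2 * d) ≤ D') (hL0 : 0 ≤ L) (hψ : ∀ j, LinCoeffsLE (ψ j) L)
    (hV : ∀ j k b c, |((linMatrix (ψ j) * V k) b c : ℝ)| ≤ L)
    (hθ : ∀ j b c, |((linMatrix (ψ j) * θ) b c : ℝ)| ≤ L)
    (hker : ∀ i j, i ≠ j → ∃ x, linMatrix (ψ i) *ᵥ x = 0 ∧ linMatrix (ψ j) *ᵥ x ≠ 0)
    (hcok : ∀ i, ∃ D : ℤ, D ≠ 0 ∧ ∀ b, ∃ x, linMatrix (ψ i) *ᵥ x = Pi.single b D)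
    (hω : ∀ j ω ω' ε ε', (j, ω, ε) ∈ I → (j, ω', ε') ∈ I → ω ≠ ω' →
      ∃ k, ω k ≠ ω' k ∧ linMatrix (ψ j) * V k ≠ 0)
    (hε : ∀ j ω ε ε', (j, ω, ε) ∈ I → (j, ω, ε') ∈ I → ε ≠ ε' → linMatrix (ψ j) * θ ≠ 0)
    (p : ℕ) [Fact p.Prime] (hp : N ≤ p) :
    |1 - 𝔼 X : Fin d → ZMod p, 𝔼 g : Fin m → Fin e → ZMod p, 𝔼 w : Bool → Fin d → ZMod p,
      ∏ i ∈ I, restrictMod p ν (affineMod p (ψ i.1)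
        (cubeVertex X (fun k => castMatrix (ZMod p) (V k) *ᵥ g k) i.2.1 +
          castMatrix (ZMod p) θ *ᵥ w i.2.2))| < ρ := by
  have hmul : ∀ (i : Fin t × (Fin m → Bool) × Bool) X g w,
      cubeFormMatrix (linMatrix (ψ i.1)) V θ i.2.1 i.2.2 *ᵥ
        Sum.elim X (Sum.elim (Function.uncurry g) (Function.uncurry w)) =
      linMatrix (ψ i.1) *ᵥ (cubeVertex X (fun k => V k *ᵥ g k) i.2.1 + θ *ᵥ w i.2.2) := by
    intro i X g w
    simpa only [castMatrix_int] using
      cubeFormMatrix_mulVec ℤ (linMatrix (ψ i.1)) V θ i.2.1 i.2.2 X g w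
  have hX : ∀ (i : Fin t × (Fin m → Bool) × Bool) X,
      cubeFormMatrix (linMatrix (ψ i.1)) V θ i.2.1 i.2.2 *ᵥ
        Sum.elim X (Sum.elim (Function.uncurry 0) (Function.uncurry 0)) =
      linMatrix (ψ i.1) *ᵥ X := by
    intro i X
    rw [hmul]
    simp [cubeVertex]
  have key := h.of_fintype (I := I) (κ := Fin d ⊕ ((Fin m × Fin e) ⊕ (Bool × Fin d)))
    (by simpa using hI) (by simpa using hD')
    (fun i => cubeFormMatrix (linMatrix (ψ i.1.1)) V θ i.1.2.1 i.1.2.2) (fun i => ψ i.1.1 0)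
    (by
      rintro i b (k | k | k)
      · exact hψ _ _ _
      · simp only [cubeFormMatrix, Sum.elim_inr, Sum.elim_inl]
        split_ifs
        · exact hV _ _ _ _
        · simpa using hL0
      · simp only [cubeFormMatrix, Sum.elim_inr]
        split_ifs
        · exact hθ _ _ _
        · simpa using hL0)
    (by
      rintro ⟨⟨j, ω, ε⟩, hi⟩ ⟨⟨j', ω', ε'⟩, hi'⟩ hne
      by_cases hj : j = j'
      · subst hj
        by_cases hωω : ω = ω'
        · subst hωω
          have hεε : ε ≠ ε' := fun h => hne (by simp [h])
          have h1 := hε j ω ε ε' hi hi' hεε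
          obtain ⟨z, hz⟩ : ∃ z, (linMatrix (ψ j) * θ) *ᵥ z ≠ 0 := by
            by_contra! hz
            exact h1 (Matrix.ext_of_mulVec_single fun c => by rw [hz, zero_mulVec])
          -- Same form and vertex: moving only the translation copy `ε'` changes one form and not
          -- the other.
          refine ⟨Sum.elim 0 (Sum.elim (Function.uncurry 0)
            (Function.uncurry fun c => if c = ε' then z else 0)), ?_, ?_⟩
          · rw [hmul (j, ω, ε)]
            simp [cubeVertex, hεε]
          · rw [hmul (j, ω, ε')]
            simpa [cubeVertex] using hz
        · obtain ⟨k, hk, hk'⟩ := hω j ω ω' ε ε' hi hi' hωω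
          obtain ⟨z, hz⟩ : ∃ z, (linMatrix (ψ j) * V k) *ᵥ z ≠ 0 := by
            by_contra! hz
            exact hk' (Matrix.ext_of_mulVec_single fun c => by rw [hz, zero_mulVec])
          have hvert : ∀ (Y : Fin d → ℤ) (σ : Fin m → Bool),
              cubeVertex Y (fun k' => V k' *ᵥ (Pi.single k z : Fin m → Fin e → ℤ) k') σ =
                Y + if σ k then V k *ᵥ z else 0 := by
            intro Y σ
            rw [cubeVertex, Finset.sum_eq_single k]
            · simp
            · intro b _ hb; simp [hb]
            · simp
          -- Same form, different vertices: move along edge `k` and shift the base point so that the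
          -- vertex `ω` stays fixed; the vertex `ω'` then moves by `± V k z`.
          refine ⟨Sum.elim (-if ω k then V k *ᵥ z else 0) (Sum.elim
            (Function.uncurry (Pi.single k z : Fin m → Fin e → ℤ)) (Function.uncurry 0)), ?_, ?_⟩
          · rw [hmul (j, ω, ε), hvert]
            simp
          · rw [hmul (j, ω', ε'), hvert]
            cases h1 : ω k <;> cases h2 : ω' k
            · simp [h1, h2] at hk
            · simpa [h2] using hz
            · simpa [h2, mulVec_neg] using hz
            · simp [h1, h2] at hk
      · obtain ⟨x, hx, hx'⟩ := hker j j' hj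
        refine ⟨Sum.elim x (Sum.elim (Function.uncurry 0) (Function.uncurry 0)), ?_, ?_⟩
        · rw [hX (j, ω, ε), hx]
        · rwa [hX (j', ω', ε')])
    (by
      intro i
      obtain ⟨D, hD, hx⟩ := hcok i.1.1
      refine ⟨D, hD, fun b => ?_⟩
      obtain ⟨x, hx⟩ := hx b
      exact ⟨_, (hX i.1 x).trans hx⟩)
    p hp
  convert key using 3
  rw [← Fintype.expect_equiv (cubeVarEquiv (ZMod p) d e m) (fun y => ∏ i : I, restrictMod p ν
      (castMatrix (ZMod p) (cubeFormMatrix (linMatrix (ψ i.1.1)) V θ i.1.2.1 i.1.2.2) *ᵥ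
        cubeVarEquiv (ZMod p) d e m y + fun b => (ψ i.1.1 0 b : ZMod p))) _ fun _ => rfl,
    expect_prod_type]
  refine Finset.expect_congr rfl fun X _ => ?_
  rw [expect_prod_type]
  refine Finset.expect_congr rfl fun g _ => Finset.expect_congr rfl fun w _ => ?_
  rw [← Finset.prod_coe_sort]
  refine Finset.prod_congr rfl fun i _ => ?_
  rw [affineMod_eq_mulVec, ← cubeFormMatrix_mulVec]
  rfl

end LinearForms

/-! ### The von Neumann estimate over the finite field, twisted by characters. -/

section CharacterEstimate

open Matrix

theorem norm_expect_mul_sq_le {A : Type*} [Fintype A] (Φ : A → ℂ) (N E : A → ℝ)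
    (h : ∀ a, ‖Φ a‖ ≤ N a) :
    ‖𝔼 a, Φ a * (E a : ℂ)‖ ^ 2 ≤ (𝔼 a, N a) * 𝔼 a, N a * E a ^ 2 := by
  have hN : ∀ a, 0 ≤ N a := fun a => (norm_nonneg _).trans (h a)
  have h1 : ‖𝔼 a, Φ a * (E a : ℂ)‖ ≤ 𝔼 a, √(N a) * (√(N a) * |E a|) := by
    refine (RCLike.norm_expect_le (K := ℝ)).trans (Finset.expect_le_expect fun a _ => ?_)
    rw [norm_mul, ← mul_assoc, Real.mul_self_sqrt (hN a), Complex.norm_real, Real.norm_eq_abs]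
    exact mul_le_mul_of_nonneg_right (h a) (abs_nonneg _)
  refine (pow_le_pow_left₀ (norm_nonneg _) h1 2).trans
    ((Finset.expect_mul_sq_le_sq_mul_sq _ _ _).trans_eq ?_)
  simp only [mul_pow, Real.sq_sqrt (hN _), sq_abs]

theorem expect_bool_fun {A M : Type*} [Fintype A] [AddCommMonoid M] [Module ℚ≥0 M]
    (F : A → A → M) : 𝔼 w : Bool → A, F (w false) (w true) = 𝔼 a, 𝔼 b, F a b := by
  rw [← expect_prod_type (fun i : A × A => F i.1 i.2)]
  exact Fintype.expect_equiv ((Equiv.boolArrowEquivProd A)) _ _ fun w => rfl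

theorem expect_units_smul {A M : Type*} [Fintype A] [AddCommMonoid M] [Module ℚ≥0 M] {R : Type*}
    [Field R] [AddCommGroup A] [Module R A] {c : R} (hc : c ≠ 0) (F : A → M) :
    𝔼 a, F (c • a) = 𝔼 a, F a :=
  Fintype.expect_equiv (MulAction.toPerm (Units.mk0 c hc)) _ _ fun _ => rfl

theorem expect_pi_smul {A M : Type*} [Fintype A] [AddCommMonoid M] [Module ℚ≥0 M] {R : Type*}
    [Field R] [AddCommGroup A] [Module R A] {m : ℕ} {c : Fin m → R} (hc : ∀ k, c k ≠ 0)
    (F : (Fin m → A) → M) : 𝔼 g : Fin m → A, F (fun k => c k • g k) = 𝔼 g, F g :=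
  Fintype.expect_equiv (Equiv.piCongrRight fun k => MulAction.toPerm (Units.mk0 (c k) (hc k)))
    _ _ fun _ => rfl

/-- A weight all of whose relevant moments are close to `1` can be replaced by `1`. -/
theorem norm_expect_mul_weight_le {Z Γ : Type*} [AddCommGroup Z] [Fintype Z] [Fintype Γ]
    [Nonempty Γ] (τ : Z → Z) (W Nu : Z → Γ → ℝ) (Φ : Z → Γ → ℂ) {ρ : ℝ} (hρ : ρ < 1)
    (hΦτ : ∀ x z g, Φ (x + τ z) g = Φ x g) (hΦN : ∀ x g, ‖Φ x g‖ ≤ Nu x g)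
    (hmom : ∀ E : Bool → Bool, |1 - 𝔼 x, 𝔼 g, 𝔼 w : Bool → Z,
      Nu x g * ∏ ε, if E ε then W (x + τ (w ε)) g else 1| < ρ) :
    ‖𝔼 x, 𝔼 g, Φ x g * (W x g : ℂ)‖ ≤ ‖𝔼 x, 𝔼 g, Φ x g‖ + √(8 * ρ) := by
  let A : Z → Γ → ℝ := fun x g => 𝔼 z, W (x + τ z) g
  -- Since `Φ` is invariant under `τ`, only the average `A` of `W` over `τ`-translates matters.
  have e2 : 𝔼 x, 𝔼 g, Φ x g * (W x g : ℂ) = 𝔼 x, 𝔼 g, Φ x g * (A x g : ℂ) := by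
    rw [Finset.expect_comm]
    conv_rhs => rw [Finset.expect_comm]
    refine Finset.expect_congr rfl fun g _ => ?_
    calc 𝔼 x, Φ x g * (W x g : ℂ) = 𝔼 z, 𝔼 x, Φ (x + τ z) g * (W (x + τ z) g : ℂ) := by
          simp only [expect_add_right (fun x => Φ x g * (W x g : ℂ)), Fintype.expect_const]
      _ = _ := by
          rw [Finset.expect_comm]
          refine Finset.expect_congr rfl fun x _ => ?_
          simp only [hΦτ, A, Complex.ofReal_expect, Finset.mul_expect]
  have e3 : 𝔼 x, 𝔼 g, Φ x g * (W x g : ℂ) =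
      𝔼 x, 𝔼 g, Φ x g + 𝔼 i : Z × Γ, Φ i.1 i.2 * ((A i.1 i.2 - 1 : ℝ) : ℂ) := by
    rw [e2, expect_prod_type, ← Finset.expect_add_distrib]
    refine Finset.expect_congr rfl fun x _ => ?_
    rw [← Finset.expect_add_distrib]
    refine Finset.expect_congr rfl fun g _ => ?_
    push_cast
    ring
  have hsecond : (𝔼 i : Z × Γ, Nu i.1 i.2) * 𝔼 i : Z × Γ, Nu i.1 i.2 * (A i.1 i.2 - 1) ^ 2 ≤
      8 * ρ := by
    have m0 := hmom (fun _ => false)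
    have m1 := hmom (fun ε => !ε)
    have m2 := hmom (fun ε => ε)
    have m3 := hmom (fun _ => true)
    simp only [Fintype.prod_bool, Bool.false_eq_true, if_false, if_true, Bool.not_true,
      Bool.not_false, mul_one, one_mul, Fintype.expect_const] at m0 m1 m2 m3
    -- Two independent copies of the translation variable represent `A²`. The four moments are all
    -- within `ρ` of `1`, so their signed sum is at most `4ρ`; the mean of `Nu` is at most `2`.
    have e4 : 𝔼 i : Z × Γ, Nu i.1 i.2 * (A i.1 i.2 - 1) ^ 2 =
        𝔼 x, 𝔼 g, 𝔼 w : Bool → Z, Nu x g * (W (x + τ (w true)) g * W (x + τ (w false)) g) -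
        𝔼 x, 𝔼 g, 𝔼 w : Bool → Z, Nu x g * W (x + τ (w true)) g -
        𝔼 x, 𝔼 g, 𝔼 w : Bool → Z, Nu x g * W (x + τ (w false)) g + 𝔼 x, 𝔼 g, Nu x g := by
      rw [expect_prod_type, ← Finset.expect_sub_distrib, ← Finset.expect_sub_distrib,
        ← Finset.expect_add_distrib]
      refine Finset.expect_congr rfl fun x _ => ?_
      rw [← Finset.expect_sub_distrib, ← Finset.expect_sub_distrib, ← Finset.expect_add_distrib]
      refine Finset.expect_congr rfl fun g _ => ?_
      rw [← Finset.mul_expect, ← Finset.mul_expect, ← Finset.mul_expect,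
        expect_bool_fun (fun a b => W (x + τ b) g * W (x + τ a) g),
        expect_bool_fun (fun _ b => W (x + τ b) g),
        expect_bool_fun (fun a _ => W (x + τ a) g)]
      simp only [Fintype.expect_const, ← Finset.expect_mul, ← Finset.mul_expect]
      change Nu x g * (A x g - 1) ^ 2 = Nu x g * (A x g * A x g) - Nu x g * A x g -
        Nu x g * A x g + Nu x g
      ring
    rw [e4, expect_prod_type]
    rw [abs_lt] at m0 m1 m2 m3
    have hNu : 0 ≤ 𝔼 x, 𝔼 g, Nu x g := Finset.expect_nonneg fun x _ =>
      Finset.expect_nonneg fun g _ => (norm_nonneg _).trans (hΦN x g)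
    calc _ ≤ (𝔼 x, 𝔼 g, Nu x g) * (4 * ρ) :=
          mul_le_mul_of_nonneg_left (by linarith) hNu
      _ ≤ 2 * (4 * ρ) := mul_le_mul_of_nonneg_right (by linarith) (by linarith)
      _ = 8 * ρ := by ring
  rw [e3]
  have e5 := (norm_expect_mul_sq_le (fun i : Z × Γ => Φ i.1 i.2) (fun i => Nu i.1 i.2)
    (fun i => A i.1 i.2 - 1) fun i => hΦN _ _).trans hsecond
  exact (norm_add_le _ _).trans (add_le_add le_rfl (Real.le_sqrt_of_sq_le e5))

variable {n t d m p : ℕ} [Fact p.Prime]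

theorem affineMod_cubeVertex (ψ : (Fin d → ℤ) →ᵃ[ℤ] (Fin n → ℤ)) (x : Fin d → ZMod p)
    (h : Fin m → Fin d → ZMod p) (ω : Fin m → Bool) :
    affineMod p ψ (cubeVertex x h ω) =
      cubeVertex (affineMod p ψ x) (fun k => castMatrix (ZMod p) (linMatrix ψ) *ᵥ h k) ω := by
  have h1 := map_cubeVertex (castMatrix (ZMod p) (linMatrix ψ)).mulVecLin x h ω
  simp only [mulVecLin_apply] at h1
  rw [affineMod_eq_mulVec, h1, affineMod_eq_mulVec, cubeVertex_add]

/-- The average of a parallelepiped product of a function of a form along its sections is the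
average over all parallelepipeds of the target. -/
theorem expect_cubeProd_affineMod (ψ : (Fin d → ℤ) →ᵃ[ℤ] (Fin n → ℤ))
    (V : Fin (m + 1) → Matrix (Fin d) (Fin n) ℤ) (D : Fin (m + 1) → ℤ)
    (hMV : ∀ k, linMatrix ψ * V k = D k • 1) (hD : ∀ k, (D k : ZMod p) ≠ 0)
    (F : (Fin n → ZMod p) → ℂ) :
    𝔼 x : Fin d → ZMod p, 𝔼 g : Fin (m + 1) → Fin n → ZMod p,
        cubeProd (fun x => F (affineMod p ψ x)) x (fun k => castMatrix (ZMod p) (V k) *ᵥ g k) =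
      𝔼 y : Fin n → ZMod p, 𝔼 g : Fin (m + 1) → Fin n → ZMod p, cubeProd F y g := by
  have hMVp : ∀ k (h : Fin n → ZMod p), castMatrix (ZMod p) (linMatrix ψ) *ᵥ
      (castMatrix (ZMod p) (V k) *ᵥ h) = (D k : ZMod p) • h := fun k h => by
    rw [mulVec_mulVec, ← castMatrix_mul, hMV, castMatrix_smul_one, smul_mulVec, one_mulVec]
  set Q : (Fin n → ZMod p) → ℂ := fun y => 𝔼 g : Fin (m + 1) → Fin n → ZMod p, cubeProd F y g
  have h1 : ∀ x : Fin d → ZMod p, 𝔼 g : Fin (m + 1) → Fin n → ZMod p,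
      cubeProd (fun x => F (affineMod p ψ x)) x (fun k => castMatrix (ZMod p) (V k) *ᵥ g k) =
      Q (affineMod p ψ x) := fun x => by
    -- The form maps the edge `V k (g k)` to `D k • g k`, and rescaling by the unit `D k` does not
    -- change the average.
    refine Eq.trans ?_ (expect_pi_smul hD (fun g => cubeProd F (affineMod p ψ x) g))
    refine Finset.expect_congr rfl fun g _ => ?_
    simp only [cubeProd, affineMod_cubeVertex, hMVp]
  simp only [h1]
  -- Moving `x` along `V 0` moves the image by `D 0 • h`, which runs uniformly over `𝔽_p^n`; so the
  -- base point is uniformly distributed.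
  calc 𝔼 x, Q (affineMod p ψ x)
      = 𝔼 h : Fin n → ZMod p, 𝔼 x : Fin d → ZMod p,
          Q (affineMod p ψ (x + castMatrix (ZMod p) (V 0) *ᵥ h)) := by
        simp only [expect_add_right (fun x => Q (affineMod p ψ x)), Fintype.expect_const]
    _ = 𝔼 x : Fin d → ZMod p, 𝔼 h : Fin n → ZMod p, Q (h + affineMod p ψ x) := by
        rw [Finset.expect_comm]
        refine Finset.expect_congr rfl fun x _ => ?_
        refine Eq.trans ?_ (expect_units_smul (hD 0) fun h => Q (h + affineMod p ψ x))
        refine Finset.expect_congr rfl fun h _ => ?_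
        rw [affineMod_add, hMVp, add_comm]
    _ = _ := by simp only [expect_add_right, Fintype.expect_const]

/-- The pull-back of the weight `ν` to `𝔽_p^d` under a form. -/
noncomputable def formWeight {n d : ℕ} (p : ℕ) (ν : (Fin n → ℤ) → ℝ)
    (ψ : (Fin d → ℤ) →ᵃ[ℤ] (Fin n → ℤ)) (x : Fin d → ZMod p) : ℝ :=
  restrictMod p ν (affineMod p ψ x)

theorem formWeight_add_of_mul_eq_zero {e : ℕ} (ν : (Fin n → ℤ) → ℝ)
    (ψ : (Fin d → ℤ) →ᵃ[ℤ] (Fin n → ℤ)) (V : Matrix (Fin d) (Fin e) ℤ)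
    (h : linMatrix ψ * V = 0) (x : Fin d → ZMod p) (y : Fin e → ZMod p) :
    formWeight p ν ψ (x + castMatrix (ZMod p) V *ᵥ y) = formWeight p ν ψ x := by
  rw [formWeight, affineMod_add, mulVec_mulVec, ← castMatrix_mul, h, castMatrix_zero, zero_mulVec,
    add_zero, formWeight]

/-- All moments of the weights over vertices of parallelepipeds are within `ρ` of `1`. -/
def CubeMoments (p : ℕ) [Fact p.Prime] (ν : (Fin n → ℤ) → ℝ)
    (ψ : Fin t → (Fin d → ℤ) →ᵃ[ℤ] (Fin n → ℤ)) (i₀ : Fin t)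
    (V : Fin m → Matrix (Fin d) (Fin n) ℤ) (θ : Matrix (Fin d) (Fin d) ℤ) (ρ : ℝ) : Prop :=
  ∀ I : Finset (Fin t × (Fin m → Bool) × Bool),
    -- These restrictions prevent the repetition of a form: a form killed by `V k` ignores the
    -- coordinate `ω k`, and in the application `θ` maps into the kernel of the form at `i₀`.
    (∀ i ∈ I, (i.1 = i₀ → i.2.2 = false) ∧ ∀ k, i.2.1 k → linMatrix (ψ i.1) * V k ≠ 0) →
    |1 - 𝔼 X : Fin d → ZMod p, 𝔼 g : Fin m → Fin n → ZMod p, 𝔼 w : Bool → Fin d → ZMod p,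
      ∏ i ∈ I, formWeight p ν (ψ i.1)
        (cubeVertex X (fun k => castMatrix (ZMod p) (V k) *ᵥ g k) i.2.1 +
          castMatrix (ZMod p) θ *ᵥ w i.2.2)| < ρ

variable {ν : (Fin n → ℤ) → ℝ} {ψ : Fin t → (Fin d → ℤ) →ᵃ[ℤ] (Fin n → ℤ)} {i₀ : Fin t}
  {V : Fin m → Matrix (Fin d) (Fin n) ℤ} {θ : Matrix (Fin d) (Fin d) ℤ} {ρ : ℝ}

/-- Only the copy `ε = false` is used, and its translation is absorbed into the base point. This is
the moment hypothesis of the Gowers–Cauchy–Schwarz inequality. -/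
theorem CubeMoments.expect_cubeWeight_le (h : CubeMoments p ν ψ i₀ V θ ρ)
    (S : {j : Fin t // j ≠ i₀} → (Fin m → Bool) → Prop)
    (hS : ∀ j ω, S j ω → ∀ k, ω k → linMatrix (ψ j) * V k ≠ 0) :
    𝔼 x : Fin d → ZMod p, 𝔼 g : Fin m → Fin n → ZMod p,
      cubeWeight S (fun j => formWeight p ν (ψ j)) x
        (fun k => castMatrix (ZMod p) (V k) *ᵥ g k) ≤ 1 + ρ := by
  classical
  have h1 := h (Finset.univ.filter fun i => ∃ hi : i.1 ≠ i₀, S ⟨i.1, hi⟩ i.2.1 ∧ i.2.2 = false)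
    (by
      rintro ⟨j, ω, ε⟩ hi
      obtain ⟨hj, hω, hε⟩ := (Finset.mem_filter.1 hi).2
      exact ⟨fun _ => hε, hS ⟨j, hj⟩ ω hω⟩)
  have h2 : ∀ (X : Fin d → ZMod p) (g : Fin m → Fin n → ZMod p) (w : Bool → Fin d → ZMod p),
      (∏ i ∈ Finset.univ.filter
        fun i : Fin t × (Fin m → Bool) × Bool =>
          ∃ hi : i.1 ≠ i₀, S ⟨i.1, hi⟩ i.2.1 ∧ i.2.2 = false, formWeight p ν (ψ i.1)
        (cubeVertex X (fun k => castMatrix (ZMod p) (V k) *ᵥ g k) i.2.1 +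
          castMatrix (ZMod p) θ *ᵥ w i.2.2)) =
      cubeWeight S (fun j => formWeight p ν (ψ j)) (X + castMatrix (ZMod p) θ *ᵥ w false)
        (fun k => castMatrix (ZMod p) (V k) *ᵥ g k) := by
    intro X g w
    rw [Finset.prod_filter, Fintype.prod_prod_type, Fintype.prod_eq_mul_prod_subtype_ne _ i₀,
      Finset.prod_eq_one (by simp), one_mul, cubeWeight]
    refine Finset.prod_congr rfl fun j _ => ?_
    rw [Fintype.prod_prod_type]
    refine Finset.prod_congr rfl fun ω _ => ?_
    rw [Fintype.prod_bool, cubeVertex_add]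
    simp [j.2]
  simp only [h2] at h1
  have h3 : 𝔼 X : Fin d → ZMod p, 𝔼 g : Fin m → Fin n → ZMod p, 𝔼 w : Bool → Fin d → ZMod p,
      cubeWeight S (fun j => formWeight p ν (ψ j)) (X + castMatrix (ZMod p) θ *ᵥ w false)
        (fun k => castMatrix (ZMod p) (V k) *ᵥ g k) =
      𝔼 x : Fin d → ZMod p, 𝔼 g : Fin m → Fin n → ZMod p,
        cubeWeight S (fun j => formWeight p ν (ψ j)) x
          (fun k => castMatrix (ZMod p) (V k) *ᵥ g k) := by
    rw [Finset.expect_comm]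
    conv_rhs => rw [Finset.expect_comm]
    refine Finset.expect_congr rfl fun g _ => ?_
    rw [Finset.expect_comm]
    simp only [expect_add_right (fun X => cubeWeight S (fun j => formWeight p ν (ψ j)) X
        (fun k => castMatrix (ZMod p) (V k) *ᵥ g k)), Fintype.expect_const]
  rw [h3] at h1
  linarith [(abs_lt.1 h1).1]

/-- The second moment input of the generalized von Neumann theorem. -/
theorem CubeMoments.abs_one_sub_expect_lt (h : CubeMoments p ν ψ i₀ V θ ρ)
    (hV : ∀ k, linMatrix (ψ i₀) * V k ≠ 0) (hθ : linMatrix (ψ i₀) * θ = 0) (E : Bool → Bool) :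
    |1 - 𝔼 X : Fin d → ZMod p, 𝔼 g : Fin m → Fin n → ZMod p, 𝔼 w : Bool → Fin d → ZMod p,
      (∏ ω, formWeight p ν (ψ i₀) (cubeVertex X (fun k => castMatrix (ZMod p) (V k) *ᵥ g k) ω)) *
      ∏ ε, if E ε then cubeWeight
          (fun (j : {j : Fin t // j ≠ i₀}) ω => ∀ k, ω k → linMatrix (ψ j) * V k ≠ 0)
          (fun j => formWeight p ν (ψ j)) (X + castMatrix (ZMod p) θ *ᵥ w ε)
          (fun k => castMatrix (ZMod p) (V k) *ᵥ g k) else 1| < ρ := by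
  classical
  have h1 := h (Finset.univ.filter fun i => (i.1 = i₀ ∧ i.2.2 = false) ∨
      (i.1 ≠ i₀ ∧ E i.2.2 ∧ ∀ k, i.2.1 k → linMatrix (ψ i.1) * V k ≠ 0))
    (by
      rintro ⟨j, ω, ε⟩ hi
      rcases (Finset.mem_filter.1 hi).2 with ⟨rfl, h2⟩ | ⟨h1, h2, h3⟩
      · exact ⟨fun _ => h2, fun k _ => hV k⟩
      · exact ⟨fun h => absurd h h1, h3⟩)
  convert h1 using 9 with X _ g _ w _
  rw [Finset.prod_filter, Fintype.prod_prod_type, Fintype.prod_eq_mul_prod_subtype_ne _ i₀]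
  congr 1
  · rw [Fintype.prod_prod_type]
    refine Finset.prod_congr rfl fun ω _ => ?_
    rw [Fintype.prod_bool]
    simp [formWeight_add_of_mul_eq_zero ν (ψ i₀) θ hθ]
  · have h2 : ∀ ε, (if E ε then cubeWeight
          (fun (j : {j : Fin t // j ≠ i₀}) ω => ∀ k, ω k → linMatrix (ψ j) * V k ≠ 0)
          (fun j => formWeight p ν (ψ j)) (X + castMatrix (ZMod p) θ *ᵥ w ε)
          (fun k => castMatrix (ZMod p) (V k) *ᵥ g k) else 1) =
        ∏ j : {j : Fin t // j ≠ i₀}, ∏ ω, if E ε ∧ ∀ k, ω k → linMatrix (ψ j) * V k ≠ 0 then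
          formWeight p ν (ψ j) (cubeVertex (X + castMatrix (ZMod p) θ *ᵥ w ε)
            (fun k => castMatrix (ZMod p) (V k) *ᵥ g k) ω) else 1 := by
      intro ε
      by_cases hE : E ε
      · simp [hE, cubeWeight]
      · simp [hE]
    simp only [h2]
    rw [Finset.prod_comm]
    refine Finset.prod_congr rfl fun j _ => ?_
    rw [Fintype.prod_prod_type, Finset.prod_comm]
    refine Finset.prod_congr rfl fun ω _ => Finset.prod_congr rfl fun ε _ => ?_
    simp [j.2, cubeVertex_add]

/-- The generalized von Neumann estimate on `𝔽_p^d`, twisted by a character: the average is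
controlled by the average of the function at `i₀` over parallelepipeds. -/
theorem CubeMoments.norm_expect_addChar_pow_le {V : Fin (m + 2) → Matrix (Fin d) (Fin n) ℤ}
    (h : CubeMoments p ν ψ i₀ V θ ρ) (hρ : ρ < 1) (hn : 0 < n)
    {D : Fin (m + 2) → ℤ} (hMV : ∀ k, linMatrix (ψ i₀) * V k = D k • 1)
    (hD : ∀ k, (D k : ZMod p) ≠ 0) (hkill : ∀ j, j ≠ i₀ → ∃ k, linMatrix (ψ j) * V k = 0)
    (hθ : linMatrix (ψ i₀) * θ = 0) (F : Fin t → (Fin n → ZMod p) → ℂ)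
    (hF : ∀ j y, ‖F j y‖ ≤ restrictMod p ν y) (χ : AddChar (Fin d → ZMod p) ℂ) :
    ‖𝔼 x, χ x * ∏ j, F j (affineMod p (ψ j) x)‖ ^ 2 ^ (m + 2) ≤ 2 ^ (2 ^ (m + 2) - 1) *
      (‖𝔼 y : Fin n → ZMod p, 𝔼 g : Fin (m + 2) → Fin n → ZMod p, cubeProd (F i₀) y g‖ +
        √(8 * ρ)) := by
  classical
  have hV : ∀ k, linMatrix (ψ i₀) * V k ≠ 0 := fun k hk => by
    have h1 := hMV k
    rw [hk] at h1
    have h2 := congrFun (congrFun h1 ⟨0, hn⟩) ⟨0, hn⟩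
    have h3 : (0 : ℤ) = D k := by simpa [Matrix.smul_apply, Matrix.one_apply] using h2
    exact hD k (by rw [← h3]; simp)
  have hinv : ∀ j k, linMatrix (ψ j) * V k = 0 → ∀ (x : Fin d → ZMod p) (y : Fin n → ZMod p),
      affineMod p (ψ j) (x + castMatrix (ZMod p) (V k) *ᵥ y) = affineMod p (ψ j) x := by
    intro j k hjk x y
    rw [affineMod_add, mulVec_mulVec, ← castMatrix_mul, hjk, castMatrix_zero, zero_mulVec, add_zero]
  have hinvθ : ∀ (x y : Fin d → ZMod p),
      affineMod p (ψ i₀) (x + castMatrix (ZMod p) θ *ᵥ y) = affineMod p (ψ i₀) x := by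
    intro x y
    rw [affineMod_add, mulVec_mulVec, ← castMatrix_mul, hθ, castMatrix_zero, zero_mulVec, add_zero]
  let dir : (Fin (m + 2) → Fin n → ZMod p) → Fin (m + 2) → Fin d → ZMod p :=
    fun g k => castMatrix (ZMod p) (V k) *ᵥ g k
  let sel : {j : Fin t // j ≠ i₀} → (Fin (m + 2) → Bool) → Prop :=
    fun j ω => ∀ k, ω k → linMatrix (ψ j) * V k ≠ 0
  let W : (Fin d → ZMod p) → (Fin (m + 2) → Fin n → ZMod p) → ℝ :=
    fun x g => cubeWeight sel (fun j => formWeight p ν (ψ j)) x (dir g)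
  let Φ : (Fin d → ZMod p) → (Fin (m + 2) → Fin n → ZMod p) → ℂ :=
    fun x g => cubeProd (fun x => F i₀ (affineMod p (ψ i₀) x)) x (dir g)
  let Nu : (Fin d → ZMod p) → (Fin (m + 2) → Fin n → ZMod p) → ℝ :=
    fun x g => ∏ ω, formWeight p ν (ψ i₀) (cubeVertex x (dir g) ω)
  have hΦN : ∀ x g, ‖Φ x g‖ ≤ Nu x g := fun x g => by
    simp only [Φ, Nu, norm_cubeProd]
    exact Finset.prod_le_prod (fun _ _ => norm_nonneg _) fun ω _ => hF _ _
  have hΦθ : ∀ x z g, Φ (x + castMatrix (ZMod p) θ *ᵥ z) g = Φ x g := fun x z g => by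
    simp only [Φ, cubeProd, cubeVertex_add, hinvθ]
  -- elimination of the other forms
  have helim := norm_expect_pow_le_cubeProd (m + 2) (Λ := Unit) (J := {j : Fin t // j ≠ i₀})
    (fun k => (castMatrix (ZMod p) (V k)).mulVecLin.toAddMonoidHom)
    (fun j k => decide (linMatrix (ψ j) * V k ≠ 0))
    (fun _ x => χ x * F i₀ (affineMod p (ψ i₀) x)) (fun j _ x => F j (affineMod p (ψ j) x))
    (fun j _ x => formWeight p ν (ψ j) x) 2 one_le_two (fun j _ x => hF _ _)
    (fun j k hk _ x y => by
      congr 1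
      exact hinv j k (by simpa using hk) x y)
    (fun j k hk _ x y => congrArg (restrictMod p ν) (hinv j k (by simpa using hk) x y))
    (fun j => Or.inl (by
      obtain ⟨k, hk⟩ := hkill j j.2
      exact ⟨k, by simp [hk]⟩))
    (fun S hS => by
      have := h.expect_cubeWeight_le S (fun j ω hω k hk => by simpa using hS j ω hω k hk)
      rw [Fintype.expect_const]
      refine le_trans ?_ (this.trans (by linarith))
      exact le_rfl)
  simp only [Fintype.expect_const] at helim
  have e1 : ∀ x, χ x * F i₀ (affineMod p (ψ i₀) x) *
      ∏ j : {j : Fin t // j ≠ i₀}, F j (affineMod p (ψ j) x) =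
      χ x * ∏ j, F j (affineMod p (ψ j) x) := fun x => by
    rw [Fintype.prod_eq_mul_prod_subtype_ne _ i₀, mul_assoc]
  -- The parallelepiped has at least two edges, so the character drops out here.
  simp only [e1, cubeProd_mul, cubeProd_addChar, one_mul, decide_eq_true_eq] at helim
  refine helim.trans (mul_le_mul_of_nonneg_left ?_ (by positivity))
  -- comparison of the weight with `1`
  rw [← expect_cubeProd_affineMod (ψ i₀) V D hMV hD]
  exact norm_expect_mul_weight_le (fun z => castMatrix (ZMod p) θ *ᵥ z) W Nu Φ hρ hΦθ hΦN
    (h.abs_one_sub_expect_lt hV hθ)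

end CharacterEstimate

/-! ### Moments supplied by the linear forms condition. -/

section Moments

open Matrix

theorem abs_mul_apply_le {α β γ : Type*} [Fintype β] (M : Matrix α β ℤ) (V : Matrix β γ ℤ)
    {x y : ℝ} (hx : 0 ≤ x) (hM : ∀ a b, |(M a b : ℝ)| ≤ x) (hV : ∀ b c, |(V b c : ℝ)| ≤ y)
    (a : α) (c : γ) : |((M * V) a c : ℝ)| ≤ Fintype.card β * (x * y) := by
  rw [Matrix.mul_apply, Int.cast_sum]
  refine (Finset.abs_sum_le_sum_abs _ _).trans ((Finset.sum_le_card_nsmul _ _ (x * y) ?_).trans ?_)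
  · intro b _
    rw [Int.cast_mul, abs_mul]
    exact mul_le_mul (hM _ _) (hV _ _) (abs_nonneg _) hx
  · simp

/-- The constant in the bound for the coefficients of the auxiliary forms. -/
noncomputable def formConst (d n : ℕ) : ℝ := (1 + n * d) * d.factorial

theorem formConst_pos (d n : ℕ) : 0 < formConst d n := by
  unfold formConst; positivity

variable {n t d s p : ℕ} [Fact p.Prime] {ν : (Fin n → ℤ) → ℝ}
  {ψ : Fin t → (Fin d → ℤ) →ᵃ[ℤ] (Fin n → ℤ)} {ρ L N : ℝ}

/-- The three bounds serve the entries of `M_j`, of `M_j V_k`, and of `M_j θ` with `θ = D_0 • 1 -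
V_0 M_{i₀}`. The last needs the exponent `d + 2`. -/
theorem le_formConst_mul (hn : 0 < n) (hd : 0 < d) (hL : 1 ≤ L) :
    L ≤ formConst d n * L ^ (d + 2) ∧ d * (L * (d.factorial * L ^ d)) ≤ formConst d n * L ^ (d + 2) ∧
      d.factorial * L ^ d * L + n * (d * (L * (d.factorial * L ^ d)) * L) ≤
        formConst d n * L ^ (d + 2) := by
  have hn' : (1 : ℝ) ≤ n := by exact_mod_cast hn
  have hd' : (1 : ℝ) ≤ d := by exact_mod_cast hd
  have hf : (1 : ℝ) ≤ d.factorial := by exact_mod_cast d.factorial_pos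
  have hLd : 1 ≤ L ^ d := one_le_pow₀ hL
  have hL2 : L ^ (d + 2) = L ^ d * (L * L) := by ring
  have hLL : 1 ≤ L * L := one_le_mul_of_one_le_of_one_le hL hL
  have hf0 : (0 : ℝ) ≤ d.factorial * L ^ d := by positivity
  have hLLL : L ≤ L * L := le_mul_of_one_le_left (by linarith) hL
  have hnd : (d : ℝ) ≤ n * d := le_mul_of_one_le_left (by linarith) hn'
  refine ⟨?_, ?_, ?_⟩
  · calc L ≤ L ^ (d + 2) := le_self_pow₀ hL (by omega)
      _ ≤ formConst d n * L ^ (d + 2) := by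
        refine le_mul_of_one_le_left (by positivity) ?_
        unfold formConst
        exact one_le_mul_of_one_le_of_one_le (by nlinarith) hf
  · calc d * (L * (d.factorial * L ^ d)) = d * (d.factorial * L ^ d) * L := by ring
      _ ≤ (1 + n * d) * (d.factorial * L ^ d) * (L * L) :=
          mul_le_mul (mul_le_mul_of_nonneg_right (by linarith) hf0) hLLL (by linarith)
            (by positivity)
      _ = _ := by unfold formConst; ring
  · calc _ = d.factorial * L ^ d * L + n * d * (d.factorial * L ^ d) * (L * L) := by ring
      _ ≤ d.factorial * L ^ d * (L * L) + n * d * (d.factorial * L ^ d) * (L * L) := by gcongr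
      _ = _ := by unfold formConst; ring

/-- The linear forms condition yields all moments needed for the generalized von Neumann
estimate. -/
theorem LinearFormsCondition.cubeMoments
    (h : LinearFormsCondition (t * 2 ^ (s + 1)) (4 * (s + 2) * d) (formConst d n * L ^ (d + 2))
      N ρ ν) (hn : 0 < n) (hnd : n ≤ d) (hL : 1 ≤ L) (hψ : ∀ j, LinCoeffsLE (ψ j) L)
    (hker : ∀ i j, i ≠ j → ∃ x, linMatrix (ψ i) *ᵥ x = 0 ∧ linMatrix (ψ j) *ᵥ x ≠ 0)
    (hcok : ∀ i, ∃ D : ℤ, D ≠ 0 ∧ ∀ b, ∃ x, linMatrix (ψ i) *ᵥ x = Pi.single b D)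
    (i₀ : Fin t) (V : Fin (s + 1) → Matrix (Fin d) (Fin n) ℤ) (D : Fin (s + 1) → ℤ)
    (hD : ∀ k, D k ≠ 0)
    (hkill : ∀ j, j ≠ i₀ → ∃ k, linMatrix (ψ j) * V k = 0)
    (hV : ∀ k a b, |(V k a b : ℝ)| ≤ d.factorial * L ^ d)
    (hDL : ∀ k, |(D k : ℝ)| ≤ d.factorial * L ^ d) (hp : N ≤ p) :
    CubeMoments p ν ψ i₀ V (D 0 • 1 - V 0 * linMatrix (ψ i₀)) ρ := by
  classical
  intro I hI
  obtain ⟨b1, b2, b3⟩ := le_formConst_mul hn (hn.trans_le hnd) hL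
  have hMV : ∀ j k b c, |((linMatrix (ψ j) * V k) b c : ℝ)| ≤ d * (L * (d.factorial * L ^ d)) :=
    fun j k b c => by
      simpa using abs_mul_apply_le (linMatrix (ψ j)) (V k) (by linarith) (hψ j) (hV k) b c
  have hMθ : ∀ j, linMatrix (ψ j) * (D 0 • 1 - V 0 * linMatrix (ψ i₀)) =
      D 0 • linMatrix (ψ j) - linMatrix (ψ j) * V 0 * linMatrix (ψ i₀) := fun j => by
    rw [Matrix.mul_sub, Matrix.mul_smul, Matrix.mul_one, Matrix.mul_assoc]
  have hex : ∀ j, ∃ k, j ≠ i₀ → linMatrix (ψ j) * V k = 0 := fun j => by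
    by_cases hj : j = i₀
    · exact ⟨0, fun h => absurd hj h⟩
    · exact (hkill j hj).imp fun k hk _ => hk
  choose kk hkk using hex
  refine h.cube_system ψ V _ I ?_ ?_ (by linarith) (fun j a b => (hψ j a b).trans b1)
    (fun j k b c => (hMV j k b c).trans b2) ?_ hker hcok ?_ ?_ p hp
  · have hcard : I.card ≤ (Finset.univ : Finset (Fin t × (Fin (s + 1) → Bool))).card := by
      refine Finset.card_le_card_of_injOn
        (fun i => (i.1, if i.1 = i₀ then i.2.1 else Function.update i.2.1 (kk i.1) i.2.2))
        (fun _ _ => Finset.mem_univ _) ?_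
      rintro ⟨j, ω, ε⟩ hi ⟨j', ω', ε'⟩ hi' heq
      obtain ⟨h1, h2⟩ := Prod.mk.inj heq
      simp only at h1 h2
      subst h1
      by_cases hj : j = i₀
      · have e1 := (hI _ hi).1 hj
        have e2 := (hI _ hi').1 hj
        simp only [hj, if_true] at h2 e1 e2
        rw [h2, e1, e2]
      · simp only [hj, if_false] at h2
        have e1 : ε = ε' := by simpa using congrFun h2 (kk j)
        have e2 : ω = ω' := by
          funext k
          by_cases hk : k = kk j
          · have f1 : ω k = false := by
              by_contra hf
              exact (hI _ hi).2 k (by simpa using hf) (hk ▸ hkk j hj)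
            have f2 : ω' k = false := by
              by_contra hf
              exact (hI _ hi').2 k (by simpa using hf) (hk ▸ hkk j hj)
            rw [f1, f2]
          · simpa [hk] using congrFun h2 k
        rw [e1, e2]
    simpa using hcard
  · have := Nat.mul_le_mul_left (s + 1) hnd
    nlinarith
  · intro j b c
    rw [hMθ]
    refine le_trans ?_ b3
    have e1 : ((D 0 • linMatrix (ψ j) - linMatrix (ψ j) * V 0 * linMatrix (ψ i₀)) b c : ℤ) =
        D 0 * linMatrix (ψ j) b c - (linMatrix (ψ j) * V 0 * linMatrix (ψ i₀)) b c := rfl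
    rw [e1]
    push_cast
    refine (abs_sub _ _).trans (add_le_add ?_ ?_)
    · rw [abs_mul]
      exact mul_le_mul (hDL 0) (hψ j b c) (abs_nonneg _) (by positivity)
    · have := abs_mul_apply_le (linMatrix (ψ j) * V 0) (linMatrix (ψ i₀)) (by positivity) (hMV j 0)
        (hψ i₀) b c
      simpa using this
  · intro j ω ω' ε ε' hi hi' hne
    obtain ⟨k, hk⟩ := Function.ne_iff.1 hne
    refine ⟨k, hk, ?_⟩
    by_cases hωk : ω k
    · exact (hI _ hi).2 k hωk
    · exact (hI _ hi').2 k (by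
        by_contra h2
        simp only [Bool.not_eq_true] at hωk h2
        exact hk (hωk.trans h2.symm))
  · intro j ω ε ε' hi hi' hne h0
    have hj : j ≠ i₀ := fun hj => hne (((hI _ hi).1 hj).trans ((hI _ hi').1 hj).symm)
    -- On a vector `z` of `ker M_{i₀}` the map `θ` is multiplication by `D 0`, so `M_j θ z = D 0 •
    -- M_j z ≠ 0`.
    obtain ⟨z, hz, hz'⟩ := hker i₀ j hj.symm
    rw [hMθ] at h0
    have h1 := congrArg (· *ᵥ z) h0
    simp only [sub_mulVec, smul_mulVec, ← mulVec_mulVec, hz, mulVec_zero, sub_zero,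
      zero_mulVec] at h1
    exact hz' ((smul_eq_zero.1 h1).resolve_left (hD 0))

/-- Moments of the product of all weights over two-dimensional parallelepipeds. -/
theorem LinearFormsCondition.abs_one_sub_expect_prod_lt {K : ℝ}
    (h : LinearFormsCondition (t * 2 ^ (s + 1)) (4 * (s + 2) * d) K N ρ ν) (hs : 1 ≤ s)
    (hn : 0 < n) (hK : 0 ≤ K) (hψ : ∀ j, LinCoeffsLE (ψ j) K)
    (hker : ∀ i j, i ≠ j → ∃ x, linMatrix (ψ i) *ᵥ x = 0 ∧ linMatrix (ψ j) *ᵥ x ≠ 0)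
    (hcok : ∀ i, ∃ D : ℤ, D ≠ 0 ∧ ∀ b, ∃ x, linMatrix (ψ i) *ᵥ x = Pi.single b D)
    (hp : N ≤ p) (S : Finset (Fin 2 → Bool)) :
    |1 - 𝔼 X : Fin d → ZMod p, 𝔼 g : Fin 2 → Fin d → ZMod p,
      ∏ ω ∈ S, ∏ j, formWeight p ν (ψ j) (cubeVertex X g ω)| < ρ := by
  classical
  have hne : ∀ j, linMatrix (ψ j) ≠ 0 := fun j h0 => by
    obtain ⟨D, hD, hx⟩ := hcok j
    obtain ⟨x, hx⟩ := hx ⟨0, hn⟩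
    have := congrFun hx ⟨0, hn⟩
    rw [h0] at this
    simp at this
    exact hD this.symm
  obtain ⟨I, hI⟩ : ∃ I : Finset (Fin t × (Fin 2 → Bool) × Bool),
      I = Finset.univ ×ˢ (S ×ˢ {false}) := ⟨_, rfl⟩
  have hcard : I.card ≤ t * 2 ^ (s + 1) := by
    have h1 : S.card ≤ 2 ^ (s + 1) := by
      have h2 : S.card ≤ 2 ^ 2 := by simpa using Finset.card_le_univ S
      exact h2.trans (Nat.pow_le_pow_right (by norm_num) (by omega))
    simpa [hI] using Nat.mul_le_mul_left t h1
  have hvars : d + (2 * d + 2 * d) ≤ 4 * (s + 2) * d := by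
    calc d + (2 * d + 2 * d) = 5 * d := by ring
      _ ≤ 4 * (s + 2) * d := Nat.mul_le_mul_right d (by omega)
  -- Identity directions produce all parallelograms in `𝔽_p^d`, and `θ = 0` makes the translation
  -- variables inert.
  have key := h.cube_system (e := d) (m := 2) ψ (fun _ => 1) 0
    I hcard hvars hK hψ
    (fun j k b c => by rw [Matrix.mul_one]; exact hψ j b c)
    (fun j b c => by simpa using hK) hker hcok
    (fun j ω ω' ε ε' _ _ hω => by
      obtain ⟨k, hk⟩ := Function.ne_iff.1 hω
      exact ⟨k, hk, by rw [Matrix.mul_one]; exact hne j⟩)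
    (fun j ω ε ε' hi hi' hε => by
      simp only [hI, Finset.mem_product, Finset.mem_singleton] at hi hi'
      exact absurd (hi.2.2.trans hi'.2.2.symm) hε) p hp
  have h1 : ∀ (X : Fin d → ZMod p) (g : Fin 2 → Fin d → ZMod p) (w : Bool → Fin d → ZMod p),
      (∏ i ∈ I, restrictMod p ν (affineMod p (ψ i.1)
        (cubeVertex X (fun k => castMatrix (ZMod p) (1 : Matrix (Fin d) (Fin d) ℤ) *ᵥ g k) i.2.1 +
          castMatrix (ZMod p) (0 : Matrix (Fin d) (Fin d) ℤ) *ᵥ w i.2.2))) =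
      ∏ ω ∈ S, ∏ j, formWeight p ν (ψ j) (cubeVertex X g ω) := by
    intro X g w
    have h2 : castMatrix (ZMod p) (1 : Matrix (Fin d) (Fin d) ℤ) = 1 := by
      simp
    rw [hI, Finset.prod_product, Finset.prod_comm]
    simp only [Finset.prod_product, Finset.prod_singleton, h2, castMatrix_zero, one_mulVec,
      zero_mulVec, add_zero]
    rfl
  simpa only [h1, Fintype.expect_const] using key

/-- The Fourier coefficients of `∏ ν - 1` are small. -/
theorem LinearFormsCondition.norm_expect_addChar_pow_le {K : ℝ}
    (h : LinearFormsCondition (t * 2 ^ (s + 1)) (4 * (s + 2) * d) K N ρ ν) (hs : 1 ≤ s)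
    (hn : 0 < n) (hK : 0 ≤ K) (hψ : ∀ j, LinCoeffsLE (ψ j) K)
    (hker : ∀ i j, i ≠ j → ∃ x, linMatrix (ψ i) *ᵥ x = 0 ∧ linMatrix (ψ j) *ᵥ x ≠ 0)
    (hcok : ∀ i, ∃ D : ℤ, D ≠ 0 ∧ ∀ b, ∃ x, linMatrix (ψ i) *ᵥ x = Pi.single b D)
    (hp : N ≤ p) (χ : AddChar (Fin d → ZMod p) ℂ) :
    ‖𝔼 x, χ x * ((∏ j, formWeight p ν (ψ j) x - 1 : ℝ) : ℂ)‖ ^ 4 ≤ 16 * ρ := by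
  set P : (Fin d → ZMod p) → ℝ := fun x => ∏ j, formWeight p ν (ψ j) x with hP
  -- With no other factors and dimension two, this bounds a Fourier coefficient by the `U²` norm of
  -- `P - 1`, where the character disappears.
  have step := norm_expect_pow_le_cubeProd 2 (Λ := Unit) (J := Empty)
    (fun _ => AddMonoidHom.id (Fin d → ZMod p)) (fun j => j.elim)
    (fun _ x => χ x * ((P x - 1 : ℝ) : ℂ)) (fun j => j.elim) (fun j => j.elim) 1 le_rfl
    (fun j => j.elim) (fun j => j.elim) (fun j => j.elim) (fun j => j.elim)
    (fun S _ => by simp [cubeWeight])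
  simp only [Fintype.expect_const, Finset.univ_eq_empty, Finset.prod_empty, mul_one, one_pow,
    one_mul, cubeWeight, Complex.ofReal_one, AddMonoidHom.id_apply, cubeProd_mul,
    cubeProd_addChar, cubeProd_ofReal] at step
  refine step.trans ?_
  have e1 : ∀ (x : Fin d → ZMod p) (g : Fin 2 → Fin d → ZMod p),
      ∏ ω, (P (cubeVertex x g ω) - 1) = ∑ T : Finset (Fin 2 → Bool), (-1) ^ T.card *
        ∏ ω ∈ Finset.univ \ T, P (cubeVertex x g ω) := fun x g => by
    rw [Finset.prod_sub]
    simp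
  -- The main terms of the sixteen moments cancel, leaving sixteen errors of size at most `ρ`.
  have e2 : ∑ T : Finset (Fin 2 → Bool), (-1 : ℝ) ^ T.card = 0 := by
    have := Finset.prod_sub (fun _ => (1 : ℝ)) (fun _ => 1) (Finset.univ : Finset (Fin 2 → Bool))
    simpa using this.symm
  have e3 : 𝔼 x : Fin d → ZMod p, 𝔼 g : Fin 2 → Fin d → ZMod p,
      ∏ ω, (P (cubeVertex x g ω) - 1) = ∑ T : Finset (Fin 2 → Bool), (-1) ^ T.card *
        (𝔼 x : Fin d → ZMod p, 𝔼 g : Fin 2 → Fin d → ZMod p,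
          ∏ ω ∈ Finset.univ \ T, P (cubeVertex x g ω) - 1) := by
    simp only [e1, Finset.expect_sum_comm, ← Finset.mul_expect, mul_sub, Finset.sum_sub_distrib,
      mul_one, e2, sub_zero]
  have e4 : (𝔼 x : Fin d → ZMod p, 𝔼 g : Fin 2 → Fin d → ZMod p,
      ((∏ ω, (P (cubeVertex x g ω) - 1) : ℝ) : ℂ)) = ((𝔼 x : Fin d → ZMod p,
        𝔼 g : Fin 2 → Fin d → ZMod p, ∏ ω, (P (cubeVertex x g ω) - 1) : ℝ) : ℂ) := by
    simp only [Complex.ofReal_expect]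
  rw [e4, Complex.norm_real, e3, Real.norm_eq_abs]
  refine (Finset.abs_sum_le_sum_abs _ _).trans ((Finset.sum_le_card_nsmul _ _ ρ ?_).trans ?_)
  · intro T _
    rw [abs_mul, abs_pow, abs_neg, abs_one, one_pow, one_mul, abs_sub_comm]
    exact (h.abs_one_sub_expect_prod_lt hs hn hK hψ hker hcok hp (Finset.univ \ T)).le
  · simp

theorem LinearFormsCondition.expect_prod_le {K : ℝ}
    (h : LinearFormsCondition (t * 2 ^ (s + 1)) (4 * (s + 2) * d) K N ρ ν) (hs : 1 ≤ s)
    (hn : 0 < n) (hK : 0 ≤ K) (hψ : ∀ j, LinCoeffsLE (ψ j) K)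
    (hker : ∀ i j, i ≠ j → ∃ x, linMatrix (ψ i) *ᵥ x = 0 ∧ linMatrix (ψ j) *ᵥ x ≠ 0)
    (hcok : ∀ i, ∃ D : ℤ, D ≠ 0 ∧ ∀ b, ∃ x, linMatrix (ψ i) *ᵥ x = Pi.single b D)
    (hp : N ≤ p) (hρ : ρ < 1) : 𝔼 x : Fin d → ZMod p, ∏ j, formWeight p ν (ψ j) x ≤ 2 := by
  have := h.abs_one_sub_expect_prod_lt hs hn hK hψ hker hcok hp {fun _ => false}
  simp only [Finset.prod_singleton, cubeVertex_false, Fintype.expect_const] at this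
  linarith [(abs_lt.1 this).1]

end Moments

/-! ### Gowers norms: from the integer cube to the finite field. -/

section Transfer

variable {p n : ℕ}

/-- The coordinatewise representative in `(-p/2, p/2]^n`. -/
def liftMod (y : Fin n → ZMod p) : Fin n → ℤ := fun i => (y i).valMinAbs

/-- Coordinatewise reduction modulo `p`. -/
def reduceMod (p n : ℕ) : (Fin n → ℤ) →+ (Fin n → ZMod p) :=
  (Int.castAddHom (ZMod p)).compLeft (Fin n)

theorem reduceMod_apply (x : Fin n → ℤ) (i : Fin n) : reduceMod p n x i = (x i : ZMod p) := rfl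

theorem reduceMod_liftMod (y : Fin n → ZMod p) : reduceMod p n (liftMod y) = y := by
  funext i
  simp [reduceMod_apply, liftMod]

theorem valMinAbs_intCast_of_two_mul_abs_lt [NeZero p] {a : ℤ} (h : 2 * |a| < p) :
    (a : ZMod p).valMinAbs = a := by
  rw [ZMod.valMinAbs_spec]
  refine ⟨rfl, ?_, ?_⟩ <;> rcases abs_cases a with h1 | h1 <;> omega

theorem liftMod_reduceMod [NeZero p] {x : Fin n → ℤ} {R : ℝ} (hR : 2 * R < p)
    (hx : ∀ i, |(x i : ℝ)| ≤ R) : liftMod (reduceMod p n x) = x := by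
  funext i
  refine valMinAbs_intCast_of_two_mul_abs_lt ?_
  have h1 : (2 : ℝ) * |(x i : ℝ)| < p := by linarith [hx i]
  exact_mod_cast h1

theorem eq_of_reduceMod_eq {x y : Fin n → ℤ} {R R' : ℝ} (hR : R + R' < p)
    (hx : ∀ i, |(x i : ℝ)| ≤ R) (hy : ∀ i, |(y i : ℝ)| ≤ R')
    (h : reduceMod p n x = reduceMod p n y) : x = y := by
  funext i
  have h1 := congrFun h i
  rw [reduceMod_apply, reduceMod_apply, ← sub_eq_zero, ← Int.cast_sub,
    ZMod.intCast_zmod_eq_zero_iff_dvd] at h1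
  have h2 : |(x i : ℝ) - y i| < p :=
    (abs_sub _ _).trans_lt (by linarith [hx i, hy i])
  have h3 : |x i - y i| < p := by exact_mod_cast h2
  exact sub_eq_zero.1 (Int.eq_zero_of_abs_lt_dvd h1 h3)

open Classical in
/-- The function on `𝔽_p^n` which is `f` on the lattice points of the cube `[-R, R]^n` and vanishes
elsewhere. -/
noncomputable def boxMod (p : ℕ) (R : ℝ) (f : (Fin n → ℤ) → ℂ) (y : Fin n → ZMod p) : ℂ :=
  if liftMod y ∈ intBox n R then f (liftMod y) else 0

theorem boxMod_reduceMod [NeZero p] {R : ℝ} (hR : 2 * R < p) (f : (Fin n → ℤ) → ℂ)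
    {x : Fin n → ℤ} (hx : x ∈ intBox n R) : boxMod p R f (reduceMod p n x) = f x := by
  have h1 := liftMod_reduceMod hR (mem_intBox.1 hx)
  rw [boxMod, h1, if_pos hx]

theorem abs_cubeVertex_le {k : ℕ} {x : Fin n → ℤ} {h : Fin k → Fin n → ℤ} {R R' : ℝ}
    (hx : ∀ i, |(x i : ℝ)| ≤ R) (hh : ∀ k i, |(h k i : ℝ)| ≤ R') (hR' : 0 ≤ R')
    (ω : Fin k → Bool) (i : Fin n) : |(cubeVertex x h ω i : ℝ)| ≤ R + k * R' := by
  rw [cubeVertex, Pi.add_apply, Int.cast_add]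
  refine (abs_add_le _ _).trans (add_le_add (hx i) ?_)
  rw [Finset.sum_apply, Int.cast_sum]
  refine (Finset.abs_sum_le_sum_abs _ _).trans ((Finset.sum_le_card_nsmul _ _ R' ?_).trans ?_)
  · intro a _
    split_ifs
    · exact hh a i
    · simpa using hR'
  · simp

/-- The Gowers norm over `𝔽_p^n` of a function supported on a small cube is at most the Gowers norm
over the cube. -/
theorem norm_expect_cubeProd_boxMod_le [NeZero p] {k : ℕ} {R : ℝ} (hR : 0 ≤ R)
    (hp : (2 * k + 2) * R < p) (f : (Fin n → ℤ) → ℂ) :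
    ‖𝔼 y : Fin n → ZMod p, 𝔼 g : Fin k → Fin n → ZMod p, cubeProd (boxMod p R f) y g‖ ≤
      gowersNorm k (intBox n R) f ^ 2 ^ k := by
  have hp2 : 2 * R < p := by
    have : 0 ≤ 2 * k * R := by positivity
    linarith
  have hpow : gowersNorm k (intBox n R) f ^ 2 ^ k =
      ‖Finset.expect (gowersCubes k (intBox n R)) fun c => cubeProd f c.1 c.2‖ := by
    unfold gowersNorm cubeProd
    have h1 : ((1 : ℝ) / 2 ^ k) = ((2 ^ k : ℕ) : ℝ)⁻¹ := by simp
    rw [h1, Real.rpow_inv_natCast_pow (norm_nonneg _) (by positivity)]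
  rw [hpow]
  let e : (Fin n → ℤ) × (Fin k → Fin n → ℤ) → (Fin n → ZMod p) × (Fin k → Fin n → ZMod p) :=
    fun c => (reduceMod p n c.1, fun i => reduceMod p n (c.2 i))
  have hbase : ∀ c ∈ gowersCubes k (intBox n R), c.1 ∈ intBox n R := fun c hc => by
    simpa [cubeVertex] using mem_gowersCubes.1 hc fun _ => false
  have hedge : ∀ c ∈ gowersCubes k (intBox n R), ∀ i, c.1 + c.2 i ∈ intBox n R := fun c hc i => by
    simpa [cubeVertex] using mem_gowersCubes.1 hc fun j => decide (j = i)
  have hinj : Set.InjOn e (gowersCubes k (intBox n R)) := by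
    intro c hc c' hc' h
    obtain ⟨h1, h2⟩ := Prod.mk.inj h
    have e1 : c.1 = c'.1 := eq_of_reduceMod_eq (by linarith)
      (mem_intBox.1 (hbase c hc)) (mem_intBox.1 (hbase c' hc')) h1
    refine Prod.ext e1 (funext fun i => ?_)
    have e2 : c.1 + c.2 i = c'.1 + c'.2 i := eq_of_reduceMod_eq (p := p) (by linarith)
      (mem_intBox.1 (hedge c hc i)) (mem_intBox.1 (hedge c' hc' i))
      (by rw [map_add, map_add, h1]; exact congrArg _ (congrFun h2 i))
    rw [e1] at e2
    exact add_left_cancel e2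
  have hsum : ∑ c ∈ gowersCubes k (intBox n R), cubeProd f c.1 c.2 =
      ∑ c : (Fin n → ZMod p) × (Fin k → Fin n → ZMod p), cubeProd (boxMod p R f) c.1 c.2 := by
    refine Finset.sum_of_injOn e hinj (fun _ _ => Finset.mem_coe.2 (Finset.mem_univ _)) ?_ ?_
    · rintro ⟨y, g⟩ - hyg
      by_contra hne
      apply hyg
      have hall : ∀ ω, liftMod (cubeVertex y g ω) ∈ intBox n R := by
        intro ω
        by_contra hω
        refine hne (Finset.prod_eq_zero (Finset.mem_univ ω) ?_)
        rw [boxMod, if_neg hω, iterate_map_zero]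
      have hy : ∀ i, |(liftMod y i : ℝ)| ≤ R := by
        have := hall fun _ => false
        rw [cubeVertex_false] at this
        exact mem_intBox.1 this
      have hyg' : ∀ a i, |(liftMod (y + g a) i : ℝ)| ≤ R := by
        intro a
        have h1 := hall fun j => decide (j = a)
        have h2 : cubeVertex y g (fun j => decide (j = a)) = y + g a := by simp [cubeVertex]
        rw [h2] at h1
        exact mem_intBox.1 h1
      refine ⟨(liftMod y, fun a => liftMod (y + g a) - liftMod y), ?_, ?_⟩
      · rw [Finset.mem_coe, mem_gowersCubes]
        intro ω
        have h1 : cubeVertex (liftMod y) (fun a => liftMod (y + g a) - liftMod y) ω =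
            liftMod (cubeVertex y g ω) := by
          -- The lifted edges are bounded by `2R`, so a lifted vertex is bounded by `(2k+1)R` and is
          -- compared with a point bounded by `R`; hence the requirement `(2k+2)R < p`.
          refine eq_of_reduceMod_eq (p := p) (R := R + k * (R + R)) (R' := R) ?_
            (abs_cubeVertex_le hy (fun a i => ?_) (by linarith) ω) (mem_intBox.1 (hall ω)) ?_
          · linarith
          · rw [Pi.sub_apply, Int.cast_sub]
            exact (abs_sub _ _).trans (add_le_add (hyg' a i) (hy i))
          · rw [map_cubeVertex, reduceMod_liftMod, reduceMod_liftMod]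
            congr 1
            funext a
            rw [map_sub, reduceMod_liftMod, reduceMod_liftMod, add_sub_cancel_left]
        simp only [h1]
        exact hall ω
      · refine Prod.ext (reduceMod_liftMod y) (funext fun a => ?_)
        simp only [e, map_sub, reduceMod_liftMod, add_sub_cancel_left]
    · intro c hc
      unfold cubeProd
      refine Finset.prod_congr rfl fun ω _ => ?_
      have h1 := mem_gowersCubes.1 hc ω
      have h2 : cubeVertex (e c).1 (e c).2 ω = reduceMod p n (cubeVertex c.1 c.2 ω) :=
        (map_cubeVertex (reduceMod p n) c.1 c.2 ω).symm
      rw [h2, boxMod_reduceMod hp2 f h1]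
  rw [← expect_prod_type (fun c : (Fin n → ZMod p) × (Fin k → Fin n → ZMod p) =>
      cubeProd (boxMod p R f) c.1 c.2),
    Finset.expect_eq_sum_div_card, Finset.expect_eq_sum_div_card, ← hsum, norm_div, norm_div,
    RCLike.norm_natCast, RCLike.norm_natCast]
  -- The sums over parallelepipeds agree, while the finite field average is normalized by the larger
  -- count.
  refine div_le_div_of_nonneg_left (norm_nonneg _) ?_ ?_
  · have : ((0, 0) : (Fin n → ℤ) × (Fin k → Fin n → ℤ)) ∈ gowersCubes k (intBox n R) := by
      rw [mem_gowersCubes]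
      intro ω
      rw [mem_intBox]
      simpa [cubeVertex] using fun _ => hR
    exact_mod_cast Finset.card_pos.2 ⟨_, this⟩
  · exact_mod_cast Finset.card_le_card_of_injOn e
      (fun _ _ => Finset.mem_coe.2 (Finset.mem_univ _)) hinj

end Transfer

/-! ### Counting points near the boundary of a convex set. -/

section Convex

theorem card_le_of_forall_sub_le {A : Finset ℤ} {r : ℝ} (hr : 0 ≤ r)
    (h : ∀ a ∈ A, ∀ b ∈ A, a < b → (b : ℝ) - a ≤ r) : (A.card : ℝ) ≤ r + 1 := by
  rcases A.eq_empty_or_nonempty with rfl | hA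
  · simp; linarith
  · set a := A.min' hA with ha
    have hsub : A ⊆ Finset.Icc a (a + ⌊r⌋) := by
      intro b hb
      have h1 : a ≤ b := A.min'_le b hb
      rw [Finset.mem_Icc]
      refine ⟨h1, ?_⟩
      rcases h1.eq_or_lt with h2 | h2
      · rw [← h2]; linarith [Int.floor_nonneg.2 hr]
      · have h3 := h a (A.min'_mem hA) b hb h2
        have h4 : b - a ≤ ⌊r⌋ := Int.le_floor.2 (by push_cast; exact h3)
        linarith
    have h5 := Finset.card_le_card hsub
    rw [Int.card_Icc] at h5
    have h6 : ((a + ⌊r⌋ + 1 - a).toNat : ℤ) = ⌊r⌋ + 1 := by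
      rw [Int.toNat_of_nonneg] <;> linarith [Int.floor_nonneg.2 hr]
    have h7 : (A.card : ℤ) ≤ ⌊r⌋ + 1 := by rw [← h6]; exact_mod_cast h5
    have h8 : (A.card : ℝ) ≤ (⌊r⌋ : ℝ) + 1 := by exact_mod_cast h7
    linarith [Int.floor_le r]

theorem card_le_of_forall_or {A : Finset ℤ} {r : ℝ} (hr : 0 ≤ r) {P Q : ℤ → Prop}
    (hA : ∀ a ∈ A, P a ∨ Q a)
    (hP : ∀ a ∈ A, ∀ b ∈ A, a < b → P a → P b → (b : ℝ) - a ≤ r)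
    (hQ : ∀ a ∈ A, ∀ b ∈ A, a < b → Q a → Q b → (b : ℝ) - a ≤ r) :
    (A.card : ℝ) ≤ 2 * (r + 1) := by
  classical
  have h1 : (A.card : ℝ) ≤ (A.filter P).card + (A.filter Q).card := by
    have h2 : A ⊆ A.filter P ∪ A.filter Q := fun a ha => by
      rcases hA a ha with h | h <;> simp [ha, h]
    exact_mod_cast (Finset.card_le_card h2).trans (Finset.card_union_le _ _)
  have h2 : ((A.filter P).card : ℝ) ≤ r + 1 := card_le_of_forall_sub_le hr fun a ha b hb hab => by
    rw [Finset.mem_filter] at ha hb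
    exact hP a ha.1 b hb.1 hab ha.2 hb.2
  have h3 : ((A.filter Q).card : ℝ) ≤ r + 1 := card_le_of_forall_sub_le hr fun a ha b hb hab => by
    rw [Finset.mem_filter] at ha hb
    exact hQ a ha.1 b hb.1 hab ha.2 hb.2
  linarith

/-- Split the points according to the side on which `J` is met. Two points on the same side more
than `r` apart would enclose one of them between elements of `J`. -/
theorem card_near_interval_le {J : Set ℝ} (hJ : J.OrdConnected) {r : ℝ} (hr : 0 ≤ r)
    {A : Finset ℤ} (hA : ∀ z ∈ A, (z : ℝ) ∉ J ∧ ∃ u, |u| ≤ r ∧ (z : ℝ) + u ∈ J) :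
    (A.card : ℝ) ≤ 2 * (r + 1) := by
  refine card_le_of_forall_or hr (P := fun z => ∃ u, 0 ≤ u ∧ u ≤ r ∧ (z : ℝ) + u ∈ J)
    (Q := fun z => ∃ u, 0 ≤ u ∧ u ≤ r ∧ (z : ℝ) - u ∈ J) ?_ ?_ ?_
  · intro z hz
    obtain ⟨u, hu, huJ⟩ := (hA z hz).2
    rcases le_total 0 u with h | h
    · exact Or.inl ⟨u, h, (le_abs_self u).trans hu, huJ⟩
    · exact Or.inr ⟨-u, by linarith, (neg_le_abs u).trans hu, by simpa using huJ⟩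
  · rintro a ha b hb hab ⟨u, hu0, hur, hu⟩ ⟨v, hv0, -, hv⟩
    by_contra! hlt
    exact (hA b hb).1 (hJ.out hu hv ⟨by linarith, by linarith⟩)
  · rintro a ha b hb hab ⟨u, hu0, -, hu⟩ ⟨v, hv0, hvr, hv⟩
    by_contra! hlt
    exact (hA a ha).1 (hJ.out hu hv ⟨by linarith, by linarith⟩)

/-- A missing point within `r` to one side cannot lie between two elements of `J`, so the points
that see it on a given side span at most `r`. -/
theorem card_interval_near_compl_le {J : Set ℝ} (hJ : J.OrdConnected) {r : ℝ} (hr : 0 ≤ r)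
    {A : Finset ℤ} (hA : ∀ z ∈ A, (z : ℝ) ∈ J ∧ ∃ u, |u| ≤ r ∧ (z : ℝ) + u ∉ J) :
    (A.card : ℝ) ≤ 2 * (r + 1) := by
  refine card_le_of_forall_or hr (P := fun z => ∃ u, 0 ≤ u ∧ u ≤ r ∧ (z : ℝ) + u ∉ J)
    (Q := fun z => ∃ u, 0 ≤ u ∧ u ≤ r ∧ (z : ℝ) - u ∉ J) ?_ ?_ ?_
  · intro z hz
    obtain ⟨u, hu, huJ⟩ := (hA z hz).2
    rcases le_total 0 u with h | h
    · exact Or.inl ⟨u, h, (le_abs_self u).trans hu, huJ⟩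
    · exact Or.inr ⟨-u, by linarith, (neg_le_abs u).trans hu, by simpa using huJ⟩
  · rintro a ha b hb hab ⟨u, hu0, hur, hu⟩ -
    by_contra! hlt
    exact hu (hJ.out (hA a ha).1 (hA b hb).1 ⟨by linarith, by linarith⟩)
  · rintro a ha b hb hab - ⟨v, hv0, hvr, hv⟩
    by_contra! hlt
    exact hv (hJ.out (hA a ha).1 (hA b hb).1 ⟨by linarith, by linarith⟩)

variable {p d : ℕ}

/-- The representative of a point of `𝔽_p^d`, as a real vector. -/
def realLift (x : Fin d → ZMod p) : Fin d → ℝ := fun i => ((x i).valMinAbs : ℝ)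

theorem ordConnected_update_preimage {C : Set (Fin d → ℝ)} (hC : Convex ℝ C) (w : Fin d → ℝ)
    (j : Fin d) : {z : ℝ | Function.update w j z ∈ C}.OrdConnected := by
  refine Convex.ordConnected fun z₁ h₁ z₂ h₂ a b ha hb hab => ?_
  have h3 := hC h₁ h₂ ha hb hab
  have h4 : Function.update w j (a • z₁ + b • z₂) =
      a • Function.update w j z₁ + b • Function.update w j z₂ := by
    funext i
    by_cases hi : i = j
    · subst hi; simp
    · simp [hi, ← add_mul, hab]
  rw [Set.mem_ofPred_eq, h4]
  exact h3

/-- A set of points of `𝔽_p^d` with at most `B` points on every line in direction `j` has at most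
`B p^(d-1)` points. -/
theorem card_le_of_forall_line [NeZero p] (j : Fin d) (T : Finset (Fin d → ZMod p)) {B : ℝ}
    (hB : ∀ (w : Fin d → ℝ) (A : Finset ℤ),
      (∀ z ∈ A, ∃ x ∈ T, realLift x = Function.update w j (z : ℝ)) → (A.card : ℝ) ≤ B) :
    (T.card : ℝ) ≤ B * p ^ (d - 1) := by
  classical
  let F : (Fin d → ZMod p) → ({i : Fin d // i ≠ j} → ZMod p) := fun x i => x i
  have h1 := Finset.card_eq_sum_card_fiberwise (f := F) (s := T) (t := Finset.univ)
    (fun _ _ => Finset.mem_coe.2 (Finset.mem_univ _))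
  have h2 : ∀ b, ((T.filter fun x => F x = b).card : ℝ) ≤ B := by
    intro b
    let w : Fin d → ℝ := fun i => if h : i ≠ j then ((b ⟨i, h⟩).valMinAbs : ℝ) else 0
    have hinj : Set.InjOn (fun x : Fin d → ZMod p => (x j).valMinAbs)
        (T.filter fun x => F x = b) := by
      intro x hx y hy hxy
      simp only [Finset.coe_filter, Set.mem_ofPred_eq] at hx hy
      funext i
      by_cases hi : i = j
      · subst hi; exact ZMod.injective_valMinAbs hxy
      · exact congrFun (hx.2.trans hy.2.symm) ⟨i, hi⟩
    rw [← Finset.card_image_of_injOn hinj]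
    refine hB w _ fun z hz => ?_
    obtain ⟨x, hx, rfl⟩ := Finset.mem_image.1 hz
    obtain ⟨hxT, hxb⟩ := Finset.mem_filter.1 hx
    refine ⟨x, hxT, funext fun i => ?_⟩
    by_cases hi : i = j
    · subst hi; simp [realLift]
    · simp [hi, w, realLift, ← hxb, F]
  have h3 : (Fintype.card ({i : Fin d // i ≠ j} → ZMod p) : ℝ) = p ^ (d - 1) := by
    rw [Fintype.card_fun, ZMod.card]
    simp [Fintype.card_subtype_compl]
  calc (T.card : ℝ) = ∑ b, ((T.filter fun x => F x = b).card : ℝ) := by exact_mod_cast h1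
    _ ≤ ∑ _b : {i : Fin d // i ≠ j} → ZMod p, B := Finset.sum_le_sum fun b _ => h2 b
    _ = B * p ^ (d - 1) := by
      rw [Finset.sum_const, Finset.card_univ, nsmul_eq_mul, h3, mul_comm]

/-- Sup-norm dilation by `r` in the coordinates `s`. -/
def dilate (Ω : Set (Fin d → ℝ)) (r : ℝ) (s : Finset (Fin d)) : Set (Fin d → ℝ) :=
  {x | ∃ v : Fin d → ℝ, (∀ j, |v j| ≤ r) ∧ (∀ j, j ∉ s → v j = 0) ∧ x + v ∈ Ω}

/-- Sup-norm erosion by `r` in the coordinates `s`. -/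
def erode (Ω : Set (Fin d → ℝ)) (r : ℝ) (s : Finset (Fin d)) : Set (Fin d → ℝ) :=
  {x | ∀ v : Fin d → ℝ, (∀ j, |v j| ≤ r) → (∀ j, j ∉ s → v j = 0) → x + v ∈ Ω}

theorem dilate_empty (Ω : Set (Fin d → ℝ)) {r : ℝ} (hr : 0 ≤ r) : dilate Ω r ∅ = Ω := by
  ext x
  constructor
  · rintro ⟨v, -, h0, hx⟩
    have : v = 0 := funext fun j => h0 j (by simp)
    rwa [this, add_zero] at hx
  · intro hx
    exact ⟨0, fun j => by simpa using hr, fun _ _ => rfl, by simpa using hx⟩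

theorem erode_empty (Ω : Set (Fin d → ℝ)) {r : ℝ} (hr : 0 ≤ r) : erode Ω r ∅ = Ω := by
  ext x
  constructor
  · intro h
    simpa using h 0 (fun j => by simpa using hr) fun _ _ => rfl
  · intro hx v _ h0
    have : v = 0 := funext fun j => h0 j (by simp)
    rwa [this, add_zero]

theorem Convex.dilate {Ω : Set (Fin d → ℝ)} (hΩ : Convex ℝ Ω) (r : ℝ) (s : Finset (Fin d)) :
    Convex ℝ (dilate Ω r s) := by
  rintro x ⟨v, hv, hv0, hxv⟩ y ⟨w, hw, hw0, hyw⟩ a b ha hb hab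
  refine ⟨a • v + b • w, fun j => ?_, fun j hj => ?_, ?_⟩
  · simp only [Pi.add_apply, Pi.smul_apply, smul_eq_mul]
    calc |a * v j + b * w j| ≤ a * |v j| + b * |w j| := by
          refine (abs_add_le _ _).trans_eq ?_
          rw [abs_mul, abs_mul, abs_of_nonneg ha, abs_of_nonneg hb]
      _ ≤ a * r + b * r := add_le_add (mul_le_mul_of_nonneg_left (hv j) ha)
          (mul_le_mul_of_nonneg_left (hw j) hb)
      _ = r := by rw [← add_mul, hab, one_mul]
  · simp [hv0 j hj, hw0 j hj]
  · have := hΩ hxv hyw ha hb hab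
    convert this using 1
    simp only [smul_add]; abel

theorem Convex.erode {Ω : Set (Fin d → ℝ)} (hΩ : Convex ℝ Ω) (r : ℝ) (s : Finset (Fin d)) :
    Convex ℝ (erode Ω r s) := by
  intro x hx y hy a b ha hb hab v hv hv0
  have := hΩ (hx v hv hv0) (hy v hv hv0) ha hb hab
  convert this using 1
  rw [smul_add, smul_add, add_add_add_comm, ← add_smul, hab, one_smul]

theorem add_eq_update_add_update {d : ℕ} (x v : Fin d → ℝ) (j : Fin d) :
    Function.update x j (x j + v j) + Function.update v j 0 = x + v := by
  funext i
  by_cases hi : i = j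
  · subst hi; simp
  · simp [hi]

theorem abs_update_zero_le {v : Fin d → ℝ} {r : ℝ} (hr : 0 ≤ r) (hv : ∀ j, |v j| ≤ r) (j i : Fin d) :
    |Function.update v j 0 i| ≤ r := by
  by_cases hi : i = j
  · subst hi; simpa using hr
  · simpa [hi] using hv i

theorem update_zero_eq_zero {v : Fin d → ℝ} {s : Finset (Fin d)} {j : Fin d}
    (hv : ∀ i, i ∉ insert j s → v i = 0) (i : Fin d) (hi : i ∉ s) :
    Function.update v j 0 i = 0 := by
  by_cases hij : i = j
  · subst hij; simp
  · simpa [hij] using hv i (by simp [hi, hij])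

open Classical in
/-- The number of points of `𝔽_p^d` with representative in `C`. -/
noncomputable def latticeCount (p : ℕ) [NeZero p] (C : Set (Fin d → ℝ)) : ℝ :=
  ((Finset.univ.filter fun x : Fin d → ZMod p => realLift x ∈ C).card : ℝ)

theorem latticeCount_le_add [NeZero p] {C C' : Set (Fin d → ℝ)} {B : ℝ}
    (h : ∀ T : Finset (Fin d → ZMod p), (∀ x ∈ T, realLift x ∈ C' ∧ realLift x ∉ C) →
      (T.card : ℝ) ≤ B) : latticeCount p C' ≤ latticeCount p C + B := by
  classical
  unfold latticeCount
  set S := Finset.univ.filter fun x : Fin d → ZMod p => realLift x ∈ C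
  set S' := Finset.univ.filter fun x : Fin d → ZMod p => realLift x ∈ C'
  have h1 := h (S' \ S) fun x hx => by
    simpa [S, S'] using hx
  have h2 : S'.card ≤ (S' \ S).card + S.card := Finset.card_le_card_sdiff_add_card
  have h3 : (S'.card : ℝ) ≤ (S' \ S).card + S.card := by exact_mod_cast h2
  linarith

/-- Dilating one coordinate at a time, each new point lies on an axis-parallel line within `r` of a
convex slice, so the one-dimensional count applies line by line. -/
theorem latticeCount_dilate_le [NeZero p] {Ω : Set (Fin d → ℝ)} (hΩ : Convex ℝ Ω) {r : ℝ}
    (hr : 0 ≤ r) (s : Finset (Fin d)) :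
    latticeCount p (dilate Ω r s) ≤ latticeCount p Ω + s.card * (2 * (r + 1) * p ^ (d - 1)) := by
  classical
  induction s using Finset.induction_on with
  | empty => simp [dilate_empty Ω hr]
  | insert j s hj ih =>
    rw [Finset.card_insert_of_notMem hj, Nat.cast_add, Nat.cast_one, add_mul, one_mul, ← add_assoc]
    refine (latticeCount_le_add (C := dilate Ω r s) fun T hT => ?_).trans
      (add_le_add ih le_rfl)
    refine card_le_of_forall_line j T fun w A hA => ?_
    refine card_near_interval_le
      (ordConnected_update_preimage (hΩ.dilate r s) w j) hr fun z hz => ?_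
    obtain ⟨x, hx, hxw⟩ := hA z hz
    obtain ⟨⟨v, hv, hv0, hxv⟩, hnot⟩ := hT x hx
    rw [hxw] at hnot hxv
    refine ⟨hnot, v j, hv j, Function.update v j 0, abs_update_zero_le hr hv j,
      update_zero_eq_zero hv0, ?_⟩
    rw [← add_eq_update_add_update _ v j] at hxv
    simpa using hxv

/-- The same coordinatewise argument for the points lost: on a line they lie in a slice within `r`
of its complement. -/
theorem latticeCount_le_erode [NeZero p] {Ω : Set (Fin d → ℝ)} (hΩ : Convex ℝ Ω) {r : ℝ}
    (hr : 0 ≤ r) (s : Finset (Fin d)) :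
    latticeCount p Ω ≤ latticeCount p (erode Ω r s) + s.card * (2 * (r + 1) * p ^ (d - 1)) := by
  classical
  induction s using Finset.induction_on with
  | empty => simp [erode_empty Ω hr]
  | insert j s hj ih =>
    rw [Finset.card_insert_of_notMem hj, Nat.cast_add, Nat.cast_one, add_mul, one_mul,
      add_comm (_ * _) (2 * (r + 1) * p ^ (d - 1) : ℝ), ← add_assoc]
    refine ih.trans (add_le_add ?_ le_rfl)
    refine latticeCount_le_add fun T hT => ?_
    refine card_le_of_forall_line j T fun w A hA => ?_
    refine card_interval_near_compl_le
      (ordConnected_update_preimage (hΩ.erode r s) w j) hr fun z hz => ?_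
    obtain ⟨x, hx, hxw⟩ := hA z hz
    obtain ⟨hin, hnot⟩ := hT x hx
    rw [hxw] at hin hnot
    refine ⟨hin, ?_⟩
    simp only [erode, Set.mem_ofPred_eq, not_forall] at hnot
    obtain ⟨v, hv, hv0, hxv⟩ := hnot
    refine ⟨v j, hv j, fun hmem => hxv ?_⟩
    have := hmem (Function.update v j 0) (abs_update_zero_le hr hv j) (update_zero_eq_zero hv0)
    rw [← add_eq_update_add_update _ v j]
    simpa using this

end Convex

/-! ### Removing a cutoff by smoothing with characters. -/

section Smoothing

variable {Z : Type*} [AddCommGroup Z] [Fintype Z]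

theorem expect_sub_left {M : Type*} [AddCommMonoid M] [Module ℚ≥0 M] (F : Z → M) (x : Z) :
    𝔼 y, F (x - y) = 𝔼 y, F y :=
  Fintype.expect_equiv (Equiv.subLeft x) _ _ fun _ => rfl

/-- Smoothing by a combination of characters turns small Fourier coefficients into a small
average. -/
theorem norm_expect_mul_smoothing_le {ι : Type*} [Fintype ι] (c : ℝ) (hc : 0 ≤ c)
    (χ : ι → AddChar Z ℂ) (K : Z → ℝ) (hK : ∀ z, (K z : ℂ) = c * ∑ i, χ i z) (Ψ : Z → ℂ) {η : ℝ}
    (hΨ : ∀ χ : AddChar Z ℂ, ‖𝔼 x, χ x * Ψ x‖ ≤ η) (g : Z → ℝ) (hg : ∀ x, |g x| ≤ 1) :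
    ‖𝔼 x, ((𝔼 y, g y * K (x - y) : ℝ) : ℂ) * Ψ x‖ ≤ c * Fintype.card ι * η := by
  have hη : 0 ≤ η := (norm_nonneg _).trans (hΨ 1)
  have e1 : 𝔼 x, ((𝔼 y, g y * K (x - y) : ℝ) : ℂ) * Ψ x =
      c * ∑ i, (𝔼 y, (g y : ℂ) * χ i (-y)) * 𝔼 x, χ i x * Ψ x := by
    have h1 : ∀ x, ((𝔼 y, g y * K (x - y) : ℝ) : ℂ) * Ψ x =
        c * ∑ i, (𝔼 y, (g y : ℂ) * χ i (-y)) * (χ i x * Ψ x) := by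
      intro x
      simp only [Complex.ofReal_expect, Complex.ofReal_mul, hK]
      have h2 : ∀ y, (g y : ℂ) * (c * ∑ i, χ i (x - y)) =
          ∑ i, c * ((g y : ℂ) * χ i (-y) * χ i x) := by
        intro y
        rw [Finset.mul_sum, Finset.mul_sum]
        refine Finset.sum_congr rfl fun i _ => ?_
        rw [sub_eq_add_neg, AddChar.map_add_eq_mul]; ring
      simp only [h2, Finset.expect_sum_comm, ← Finset.mul_expect, ← Finset.expect_mul,
        ← Finset.mul_sum]
      rw [mul_assoc, Finset.sum_mul]
      simp only [mul_assoc]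
    simp only [h1, ← Finset.mul_expect, Finset.expect_sum_comm]
  rw [e1, norm_mul, Complex.norm_real, Real.norm_of_nonneg hc, mul_assoc]
  refine mul_le_mul_of_nonneg_left ?_ hc
  refine (norm_sum_le _ _).trans ((Finset.sum_le_card_nsmul _ _ η fun i _ => ?_).trans_eq ?_)
  · rw [norm_mul]
    have h3 : ‖𝔼 y, (g y : ℂ) * χ i (-y)‖ ≤ 1 := by
      refine (RCLike.norm_expect_le (K := ℝ)).trans
        ((Finset.expect_le_expect (g := fun _ => (1 : ℝ)) fun y _ => ?_).trans_eq
          (Fintype.expect_const _))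
      rw [norm_mul, AddChar.norm_apply, mul_one, Complex.norm_real]
      exact hg y
    exact (mul_le_mul h3 (hΨ _) (norm_nonneg _) zero_le_one).trans_eq (one_mul η)
  · simp

/-- An average over all of `Z` weighted by `g`, where `g` is sandwiched between translates of `gm`
and `gp` by small elements, is bounded in terms of Fourier coefficients. -/
theorem norm_expect_cutoff_le {ι : Type*} [Fintype ι] (c : ℝ) (hc : 0 ≤ c)
    (χ : ι → AddChar Z ℂ) (K : Z → ℝ) (hK : ∀ z, (K z : ℂ) = c * ∑ i, χ i z) (hK0 : ∀ z, 0 ≤ K z)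
    (hK1 : 𝔼 z, K z = 1) (Y : Z → Prop) [DecidablePred Y] {ε : ℝ}
    (hε : 𝔼 z, (if Y z then 0 else K z) ≤ ε) (g gp gm : Z → ℝ) (hg0 : ∀ x, 0 ≤ g x)
    (hg1 : ∀ x, g x ≤ 1) (hgp0 : ∀ x, 0 ≤ gp x) (hgp1 : ∀ x, gp x ≤ 1) (hgm0 : ∀ x, 0 ≤ gm x)
    (hgm1 : ∀ x, gm x ≤ 1) (hgp : ∀ x y, Y y → g x ≤ gp (x - y))
    (hgm : ∀ x y, Y y → gm (x - y) ≤ g x) (Φ : Z → ℂ) (P : Z → ℝ) (hΦP : ∀ x, ‖Φ x‖ ≤ P x)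
    {η η' : ℝ} (hΦ : ∀ χ : AddChar Z ℂ, ‖𝔼 x, χ x * Φ x‖ ≤ η)
    (hP : ∀ χ : AddChar Z ℂ, ‖𝔼 x, χ x * ((P x - 1 : ℝ) : ℂ)‖ ≤ η') (hP2 : 𝔼 x, P x ≤ 2) :
    ‖𝔼 x, (g x : ℂ) * Φ x‖ ≤ c * Fintype.card ι * (η + η') + 6 * ε + 𝔼 x, (gp x - gm x) := by
  have hP0 : ∀ x, 0 ≤ P x := fun x => (norm_nonneg _).trans (hΦP x)
  have hε0 : 0 ≤ ε := le_trans (Finset.expect_nonneg fun z _ => by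
    split_ifs
    · exact le_rfl
    · exact hK0 z) hε
  let conv : (Z → ℝ) → Z → ℝ := fun h x => 𝔼 y, h y * K (x - y)
  have hconv : ∀ h x, conv h x = 𝔼 y, h (x - y) * K y := fun h x => by
    rw [← expect_sub_left _ x]
    simp [conv]
  have hmass : ∀ (h : Z → ℝ) (x : Z), h x = 𝔼 y, h x * K y := fun h x => by
    rw [← Finset.mul_expect, hK1, mul_one]
  have upper : ∀ x, g x ≤ conv gp x + ε := fun x => by
    rw [hconv, hmass g x]
    refine le_trans ?_ (add_le_add le_rfl hε)
    rw [← Finset.expect_add_distrib]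
    refine Finset.expect_le_expect fun y _ => ?_
    split_ifs with hy
    · rw [add_zero]
      exact mul_le_mul_of_nonneg_right (hgp x y hy) (hK0 y)
    · have h1 := mul_le_mul_of_nonneg_right (hg1 x) (hK0 y)
      have h2 := mul_nonneg (hgp0 (x - y)) (hK0 y)
      linarith
  have lower : ∀ x, conv gm x ≤ g x + ε := fun x => by
    rw [hconv, hmass g x]
    refine le_trans ?_ (add_le_add le_rfl hε)
    rw [← Finset.expect_add_distrib]
    refine Finset.expect_le_expect fun y _ => ?_
    split_ifs with hy
    · rw [add_zero]
      exact mul_le_mul_of_nonneg_right (hgm x y hy) (hK0 y)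
    · have h1 := mul_le_mul_of_nonneg_right (hgm1 (x - y)) (hK0 y)
      have h2 := mul_nonneg (hg0 x) (hK0 y)
      linarith
  have main := norm_expect_mul_smoothing_le c hc χ K hK Φ hΦ gp
    (fun x => abs_le.2 ⟨by linarith [hgp0 x], hgp1 x⟩)
  -- The smoothed boundary layer is itself a short combination of characters, so it does not
  -- correlate with `P - 1`.
  have err := norm_expect_mul_smoothing_le c hc χ K hK _ hP (fun x => gp x - gm x)
    (fun x => abs_le.2 ⟨by linarith [hgp0 x, hgm1 x], by linarith [hgm0 x, hgp1 x]⟩)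
  have hdiff : ∀ x, conv (fun x => gp x - gm x) x = conv gp x - conv gm x := fun x => by
    simp only [conv, sub_mul, Finset.expect_sub_distrib]
  have err' : 𝔼 x, (conv gp x - conv gm x) * (P x - 1) ≤ c * Fintype.card ι * η' := by
    refine le_trans (le_abs_self _) (le_of_eq_of_le ?_ err)
    rw [← Real.norm_eq_abs, ← Complex.norm_real, Complex.ofReal_expect]
    congr 1
    refine Finset.expect_congr rfl fun x _ => ?_
    rw [Complex.ofReal_mul, ← hdiff]
  have mean : 𝔼 x, (conv gp x - conv gm x) = 𝔼 x, (gp x - gm x) := by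
    have h0 : ∀ x, conv gp x - conv gm x = 𝔼 y, (gp (x - y) - gm (x - y)) * K y := fun x => by
      rw [← hdiff, hconv]
    simp only [h0]
    rw [Finset.expect_comm]
    have : ∀ y, 𝔼 x, (gp (x - y) - gm (x - y)) * K y = (𝔼 x, (gp x - gm x)) * K y := fun y => by
      rw [← Finset.expect_mul]
      congr 1
      simp only [sub_eq_add_neg]
      exact expect_add_right (fun x => gp x + -gm x) (-y)
    simp only [this]
    rw [← Finset.mul_expect, hK1, mul_one]
  have split : 𝔼 x, (g x : ℂ) * Φ x =
      𝔼 x, (conv gp x : ℂ) * Φ x + 𝔼 x, ((g x - conv gp x : ℝ) : ℂ) * Φ x := by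
    rw [← Finset.expect_add_distrib]
    refine Finset.expect_congr rfl fun x _ => ?_
    push_cast; ring
  have rest : ‖𝔼 x, ((g x - conv gp x : ℝ) : ℂ) * Φ x‖ ≤
      𝔼 x, (conv gp x - conv gm x) * (P x - 1) + 𝔼 x, (conv gp x - conv gm x) +
        3 * ε * 𝔼 x, P x := by
    rw [Finset.mul_expect, ← Finset.expect_add_distrib, ← Finset.expect_add_distrib]
    refine (RCLike.norm_expect_le (K := ℝ)).trans (Finset.expect_le_expect fun x _ => ?_)
    rw [norm_mul, Complex.norm_real, Real.norm_eq_abs]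
    -- The difference `conv gp - conv gm` is only known to be at least `-2ε`, so the upper bound `g
    -- - conv gp ≤ ε` requires `3ε` here.
    have h1 : |g x - conv gp x| ≤ conv gp x - conv gm x + 3 * ε :=
      abs_le.2 ⟨by linarith [lower x], by linarith [upper x, lower x]⟩
    calc |g x - conv gp x| * ‖Φ x‖ ≤ (conv gp x - conv gm x + 3 * ε) * P x :=
          mul_le_mul h1 (hΦP x) (norm_nonneg _) ((abs_nonneg _).trans h1)
      _ = _ := by ring
  have h6 : 3 * ε * 𝔼 x, P x ≤ 3 * ε * 2 := mul_le_mul_of_nonneg_left hP2 (by linarith)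
  rw [split]
  refine (norm_add_le _ _).trans ?_
  have main' : ‖𝔼 x, (conv gp x : ℂ) * Φ x‖ ≤ c * Fintype.card ι * η := main
  rw [mul_add]
  linarith

/-- The trivial cutoff estimate by full Fourier inversion. -/
theorem norm_expect_mul_le_card_mul (g : Z → ℝ) (hg : ∀ x, |g x| ≤ 1) (Φ : Z → ℂ) {η : ℝ}
    (hΦ : ∀ χ : AddChar Z ℂ, ‖𝔼 x, χ x * Φ x‖ ≤ η) :
    ‖𝔼 x, (g x : ℂ) * Φ x‖ ≤ Fintype.card Z * η := by
  classical
  have h1 := norm_expect_mul_smoothing_le (Z := Z) 1 zero_le_one (fun χ : AddChar Z ℂ => χ)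
    (fun z => if z = 0 then (Fintype.card Z : ℝ) else 0)
    (fun z => by
      rw [AddChar.sum_apply_eq_ite]
      split_ifs <;> simp) Φ hΦ g hg
  rw [one_mul, AddChar.card_eq] at h1
  refine le_of_eq_of_le ?_ h1
  congr 1
  refine Finset.expect_congr rfl fun x _ => ?_
  congr 2
  rw [Finset.expect_eq_sum_div_card, Finset.sum_eq_single x]
  · simp
  · intro y _ hy
    rw [if_neg (sub_ne_zero.2 hy.symm), mul_zero]
  · simp

end Smoothing

/-! ### Fejér kernels: mass, tail and Fourier expansion. -/

section Fejer

variable {p : ℕ} [NeZero p]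

/-- The Fejér kernel of order `m` on `ℤ/p`. -/
noncomputable def fejer (p : ℕ) [NeZero p] (m : ℕ) (y : ZMod p) : ℝ :=
  ‖∑ a ∈ Finset.range m, ZMod.stdAddChar y ^ a‖ ^ 2 / m

theorem fejer_nonneg (m : ℕ) (y : ZMod p) : 0 ≤ fejer p m y := by
  unfold fejer; positivity

theorem fejer_eq_sum (m : ℕ) (y : ZMod p) : (fejer p m y : ℂ) =
    (m : ℂ)⁻¹ * ∑ i : Fin m × Fin m,
      ZMod.stdAddChar ((((i.1 : ℕ) : ZMod p) - ((i.2 : ℕ) : ZMod p)) * y) := by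
  have h1 : ∀ a : ℕ, ZMod.stdAddChar y ^ a = ZMod.stdAddChar ((a : ZMod p) * y) := fun a => by
    rw [← AddChar.map_nsmul_eq_pow, nsmul_eq_mul]
  unfold fejer
  rw [Complex.ofReal_div, Complex.ofReal_pow, ← Complex.mul_conj', Complex.ofReal_natCast,
    div_eq_inv_mul, map_sum, Finset.sum_range, Finset.sum_range, Fintype.sum_mul_sum,
    Fintype.sum_prod_type]
  congr 1
  refine Finset.sum_congr rfl fun a _ => Finset.sum_congr rfl fun b _ => ?_
  rw [h1, h1, ← AddChar.map_neg_eq_conj, ← AddChar.map_add_eq_mul]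
  congr 1; ring

/-- Only the trivial frequencies survive, and for `m ≤ p` these are the `m` diagonal pairs. -/
theorem expect_fejer {m : ℕ} (hm : 0 < m) (hmp : m ≤ p) : 𝔼 y, fejer p m y = 1 := by
  have hp0 : (p : ℂ) ≠ 0 := by exact_mod_cast NeZero.ne p
  have hm0 : (m : ℂ) ≠ 0 := by exact_mod_cast hm.ne'
  have h1 : ∀ i : Fin m × Fin m, ∑ y : ZMod p, ZMod.stdAddChar
      ((((i.1 : ℕ) : ZMod p) - ((i.2 : ℕ) : ZMod p)) * y) = if i.1 = i.2 then (p : ℂ) else 0 := by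
    intro i
    have h2 := AddChar.sum_mulShift (((i.1 : ℕ) : ZMod p) - ((i.2 : ℕ) : ZMod p))
      (ZMod.isPrimitive_stdAddChar p)
    simp only [mul_comm _ (((i.1 : ℕ) : ZMod p) - ((i.2 : ℕ) : ZMod p))] at h2
    rw [h2, ZMod.card]
    by_cases h3 : i.1 = i.2
    · simp [h3]
    · have h4 : ¬ (((i.1 : ℕ) : ZMod p) = ((i.2 : ℕ) : ZMod p)) := by
        rw [ZMod.natCast_eq_natCast_iff', Nat.mod_eq_of_lt (i.1.2.trans_le hmp),
          Nat.mod_eq_of_lt (i.2.2.trans_le hmp)]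
        exact fun h => h3 (Fin.ext h)
      simp [h3, sub_eq_zero, h4]
  have h5 : ((𝔼 y, fejer p m y : ℝ) : ℂ) = 1 := by
    rw [Complex.ofReal_expect, Finset.expect_eq_sum_div_card]
    simp only [fejer_eq_sum]
    rw [← Finset.mul_sum, Finset.sum_comm]
    simp only [h1, Fintype.sum_prod_type, Finset.sum_ite_eq, Finset.mem_univ, if_true,
      Finset.sum_const, Finset.card_univ, Fintype.card_fin, nsmul_eq_mul, ZMod.card]
    field_simp
  exact_mod_cast h5

theorem four_mul_abs_le_norm_stdAddChar_sub_one (y : ZMod p) :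
    4 * |(y.valMinAbs : ℝ)| / p ≤ ‖ZMod.stdAddChar y - 1‖ := by
  have hp0 : (0 : ℝ) < p := by exact_mod_cast NeZero.pos p
  have h1 : ZMod.stdAddChar y = Complex.exp (Complex.I * ((2 * Real.pi * y.valMinAbs / p : ℝ) : ℂ)) := by
    conv_lhs => rw [← ZMod.coe_valMinAbs y]
    rw [ZMod.stdAddChar_coe]
    congr 1
    push_cast; ring
  rw [h1, Complex.norm_exp_I_mul_ofReal_sub_one, Real.norm_eq_abs, abs_mul, abs_two]
  have h2 : (2 * Real.pi * y.valMinAbs / p) / 2 = Real.pi * (y.valMinAbs / p) := by ring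
  rw [h2]
  have h3 : |(y.valMinAbs : ℝ)| ≤ p / 2 := by
    have h4 := ZMod.natAbs_valMinAbs_le y
    have h5 : 2 * y.valMinAbs.natAbs ≤ p := by omega
    have h6 : (2 : ℝ) * (y.valMinAbs.natAbs : ℝ) ≤ p := by exact_mod_cast h5
    rw [Nat.cast_natAbs, Int.cast_abs] at h6
    linarith
  have h7 : |Real.pi * (y.valMinAbs / p)| = Real.pi * (|(y.valMinAbs : ℝ)| / p) := by
    rw [abs_mul, abs_div, abs_of_pos Real.pi_pos, abs_of_pos hp0]
  have h8 : |(y.valMinAbs : ℝ)| / p ≤ 1 / 2 := by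
    rw [div_le_iff₀ hp0]; linarith
  have h9 := Real.mul_abs_le_abs_sin (x := Real.pi * (y.valMinAbs / p)) (by
    rw [h7]
    have := mul_le_mul_of_nonneg_left h8 Real.pi_pos.le
    linarith)
  rw [h7] at h9
  have h10 : 2 / Real.pi * (Real.pi * (|(y.valMinAbs : ℝ)| / p)) = 2 * (|(y.valMinAbs : ℝ)| / p) := by
    field_simp
  rw [h10] at h9
  calc 4 * |(y.valMinAbs : ℝ)| / p = 2 * (2 * (|(y.valMinAbs : ℝ)| / p)) := by ring
    _ ≤ _ := mul_le_mul_of_nonneg_left h9 zero_le_two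

/-- The geometric sum is at most `2 / |e(y/p) - 1|`, hence at most `p / (2|y|)`. -/
theorem fejer_le {m : ℕ} (hm : 0 < m) {y : ZMod p} (hy : y ≠ 0) :
    fejer p m y ≤ (p : ℝ) ^ 2 / (4 * m) * ((y.valMinAbs.natAbs : ℝ) ^ 2)⁻¹ := by
  have hp0 : (0 : ℝ) < p := by exact_mod_cast NeZero.pos p
  have hm0 : (0 : ℝ) < m := by exact_mod_cast hm
  have hv : (0 : ℝ) < |(y.valMinAbs : ℝ)| := by
    rw [abs_pos]
    exact_mod_cast fun h => hy ((ZMod.valMinAbs_eq_zero y).1 h)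
  have h1 := four_mul_abs_le_norm_stdAddChar_sub_one y
  have h2 : ‖ZMod.stdAddChar y - 1‖ * ‖∑ a ∈ Finset.range m, ZMod.stdAddChar y ^ a‖ ≤ 2 := by
    rw [← norm_mul, mul_geom_sum]
    refine (norm_sub_le _ _).trans ?_
    rw [norm_pow, AddChar.norm_apply]
    norm_num
  have h3 : 4 * |(y.valMinAbs : ℝ)| / p * ‖∑ a ∈ Finset.range m, ZMod.stdAddChar y ^ a‖ ≤ 2 :=
    (mul_le_mul_of_nonneg_right h1 (norm_nonneg _)).trans h2
  have h4 : ‖∑ a ∈ Finset.range m, ZMod.stdAddChar y ^ a‖ ≤ p / (2 * |(y.valMinAbs : ℝ)|) := by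
    rw [le_div_iff₀ (by positivity)]
    rw [div_mul_eq_mul_div, div_le_iff₀ hp0] at h3
    linarith
  unfold fejer
  rw [Nat.cast_natAbs, Int.cast_abs]
  calc _ ≤ (p / (2 * |(y.valMinAbs : ℝ)|)) ^ 2 / m := by gcongr
    _ = _ := by field_simp; ring

/-- Each absolute value is attained by at most two residues, so the quadratic decay leaves the tail
of `∑ 1/k²` beyond `r`. -/
theorem expect_fejer_tail_le {m : ℕ} (hm : 0 < m) {r : ℝ} (hr : 0 < r) :
    𝔼 y : ZMod p, (if |(y.valMinAbs : ℝ)| ≤ r then 0 else fejer p m y) ≤ p / (m * r) := by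
  classical
  have hp0 : (0 : ℝ) < p := by exact_mod_cast NeZero.pos p
  have hm0 : (0 : ℝ) < m := by exact_mod_cast hm
  rw [Finset.expect_eq_sum_div_card, Finset.card_univ, ZMod.card, div_le_iff₀ hp0]
  set T : Finset (ZMod p) := Finset.univ.filter fun y => ¬ |(y.valMinAbs : ℝ)| ≤ r with hT
  have h1 : ∑ y : ZMod p, (if |(y.valMinAbs : ℝ)| ≤ r then 0 else fejer p m y) =
      ∑ y ∈ T, fejer p m y := by
    rw [hT, Finset.sum_filter]
    refine Finset.sum_congr rfl fun y _ => ?_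
    split_ifs <;> rfl
  have hmaps : ∀ y ∈ T, y.valMinAbs.natAbs ∈ Finset.Ioo ⌊r⌋₊ (p + 1) := by
    intro y hy
    have h2 := (Finset.mem_filter.1 hy).2
    rw [Finset.mem_Ioo]
    refine ⟨?_, ?_⟩
    · rw [Nat.floor_lt hr.le, Nat.cast_natAbs, Int.cast_abs]
      exact not_le.1 h2
    · have := ZMod.natAbs_valMinAbs_le y
      omega
  have h2 : ∑ y ∈ T, ((y.valMinAbs.natAbs : ℝ) ^ 2)⁻¹ ≤ 2 * (2 / r) := by
    rw [← Finset.sum_fiberwise_of_maps_to hmaps]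
    have h3 : ∀ k ∈ Finset.Ioo ⌊r⌋₊ (p + 1), ∑ y ∈ T with y.valMinAbs.natAbs = k,
        ((y.valMinAbs.natAbs : ℝ) ^ 2)⁻¹ ≤ 2 * ((k : ℝ) ^ 2)⁻¹ := by
      intro k _
      have h4 : (T.filter fun y => y.valMinAbs.natAbs = k).card ≤ 2 := by
        have h5 : (T.filter fun y => y.valMinAbs.natAbs = k) ⊆ {(k : ZMod p), -(k : ZMod p)} := by
          intro y hy
          have h6 := (Finset.mem_filter.1 hy).2
          rw [Finset.mem_insert, Finset.mem_singleton]
          rcases Int.natAbs_eq y.valMinAbs with h7 | h7 <;> rw [h6] at h7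
          · left; rw [← ZMod.coe_valMinAbs y, h7]; simp
          · right; rw [← ZMod.coe_valMinAbs y, h7]; simp
        exact (Finset.card_le_card h5).trans Finset.card_le_two
      refine (Finset.sum_le_card_nsmul _ _ ((k : ℝ) ^ 2)⁻¹ fun y hy => ?_).trans ?_
      · rw [(Finset.mem_filter.1 hy).2]
      · rw [nsmul_eq_mul]
        exact mul_le_mul_of_nonneg_right (by exact_mod_cast h4) (by positivity)
    refine (Finset.sum_le_sum h3).trans ?_
    rw [← Finset.mul_sum]
    refine mul_le_mul_of_nonneg_left ((sum_Ioo_inv_sq_le _ _).trans ?_) zero_le_two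
    exact div_le_div_of_nonneg_left zero_le_two hr (Nat.lt_floor_add_one r).le
  rw [h1]
  calc ∑ y ∈ T, fejer p m y
      ≤ ∑ y ∈ T, (p : ℝ) ^ 2 / (4 * m) * ((y.valMinAbs.natAbs : ℝ) ^ 2)⁻¹ := by
        refine Finset.sum_le_sum fun y hy => fejer_le hm ?_
        rintro rfl
        have := (Finset.mem_filter.1 hy).2
        simp at this
        linarith
    _ = (p : ℝ) ^ 2 / (4 * m) * ∑ y ∈ T, ((y.valMinAbs.natAbs : ℝ) ^ 2)⁻¹ := by
        rw [Finset.mul_sum]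
    _ ≤ (p : ℝ) ^ 2 / (4 * m) * (2 * (2 / r)) := mul_le_mul_of_nonneg_left h2 (by positivity)
    _ = p / (m * r) * p := by field_simp; ring

theorem expect_pi_prod {d : ℕ} {A : Type*} [Fintype A] (F : Fin d → A → ℝ) :
    𝔼 y : Fin d → A, ∏ j, F j (y j) = ∏ j, 𝔼 a, F j a := by
  simp only [Finset.expect_eq_sum_div_card, Finset.prod_div_distrib, Finset.prod_univ_sum,
    Fintype.piFinset_univ]
  simp

/-- The product Fejér kernel on `(ℤ/p)^d`. -/
noncomputable def fejerPi (p : ℕ) [NeZero p] (m : ℕ) {d : ℕ} (y : Fin d → ZMod p) : ℝ :=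
  ∏ j, fejer p m (y j)

theorem expect_fejerPi {m d : ℕ} (hm : 0 < m) (hmp : m ≤ p) :
    𝔼 y : Fin d → ZMod p, fejerPi p m y = 1 := by
  unfold fejerPi
  rw [expect_pi_prod]
  simp [expect_fejer hm hmp]

theorem expect_fejerPi_tail_le {m d : ℕ} (hm : 0 < m) (hmp : m ≤ p) {r : ℝ} (hr : 0 < r)
    [DecidablePred fun y : Fin d → ZMod p => ∀ j, |((y j).valMinAbs : ℝ)| ≤ r] :
    𝔼 y : Fin d → ZMod p, (if ∀ j, |((y j).valMinAbs : ℝ)| ≤ r then 0 else fejerPi p m y) ≤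
      d * (p / (m * r)) := by
  classical
  let G : Fin d → Fin d → ZMod p → ℝ := fun j i a =>
    if i = j then (if |(a.valMinAbs : ℝ)| ≤ r then 0 else fejer p m a) else fejer p m a
  have hG0 : ∀ j i a, 0 ≤ G j i a := fun j i a => by
    simp only [G]
    split_ifs
    · exact le_rfl
    · exact fejer_nonneg _ _
    · exact fejer_nonneg _ _
  calc _ ≤ 𝔼 y : Fin d → ZMod p, ∑ j, ∏ i, G j i (y i) := by
        refine Finset.expect_le_expect fun y _ => ?_
        split_ifs with h
        · exact Finset.sum_nonneg fun j _ => Finset.prod_nonneg fun i _ => hG0 _ _ _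
        · push Not at h
          obtain ⟨j, hj⟩ := h
          refine le_trans (le_of_eq ?_) (Finset.single_le_sum
            (f := fun j => ∏ i, G j i (y i))
            (fun j _ => Finset.prod_nonneg fun i _ => hG0 _ _ _) (Finset.mem_univ j))
          refine Finset.prod_congr rfl fun i _ => ?_
          simp only [G]
          by_cases hi : i = j
          · subst hi; simp [not_le.2 hj]
          · simp [hi]
    _ = ∑ j, ∏ i, 𝔼 a, G j i a := by
        rw [Finset.expect_sum_comm]
        exact Finset.sum_congr rfl fun j _ => expect_pi_prod _
    _ ≤ ∑ _j : Fin d, p / (m * r) := by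
        refine Finset.sum_le_sum fun j _ => ?_
        rw [Finset.prod_eq_single j]
        · simp only [G, if_true]
          exact expect_fejer_tail_le hm hr
        · intro i _ hi
          simp [G, hi, expect_fejer hm hmp]
        · simp
    _ = _ := by simp

/-- The characters occurring in the product Fejér kernel. -/
noncomputable def fejerChar (p : ℕ) [NeZero p] (m : ℕ) {d : ℕ} (q : Fin d → Fin m × Fin m) :
    AddChar (Fin d → ZMod p) ℂ :=
  ZMod.stdAddChar.compAddMonoidHom (AddMonoidHom.mk'
    (fun y => ∑ j, ((((q j).1 : ℕ) : ZMod p) - (((q j).2 : ℕ) : ZMod p)) * y j)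
    (fun y z => by simp only [Pi.add_apply, mul_add, Finset.sum_add_distrib]))

/-- There are `m^(2d)` characters, each with coefficient `m^(-d)`: the total mass `m^d` becomes the
factor `X^d`. -/
theorem fejerPi_eq_sum {m d : ℕ} (y : Fin d → ZMod p) :
    (fejerPi p m y : ℂ) = (((m : ℝ) ^ d)⁻¹ : ℝ) *
      ∑ q : Fin d → Fin m × Fin m, fejerChar p m q y := by
  unfold fejerPi
  rw [Complex.ofReal_prod]
  simp only [fejer_eq_sum, Finset.prod_mul_distrib, Finset.prod_univ_sum, Fintype.piFinset_univ]
  congr 1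
  · simp
  · refine Finset.sum_congr rfl fun q _ => ?_
    exact (map_prod ZMod.stdAddChar.toMonoidHom (fun j => Multiplicative.ofAdd
      (((((q j).1 : ℕ) : ZMod p) - (((q j).2 : ℕ) : ZMod p)) * y j)) Finset.univ).symm

end Fejer

/-! ### Convex cutoffs over the finite field. -/

section Cutoff

variable {p d : ℕ} [NeZero p]

theorem realLift_sub {x y : Fin d → ZMod p} {N r : ℝ} (hNr : 2 * (N + r) < p)
    (hx : ∀ j, |realLift x j| ≤ N) (hy : ∀ j, |realLift y j| ≤ r) :
    realLift (x - y) = realLift x - realLift y := by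
  funext j
  have h1 : ((x j).valMinAbs - (y j).valMinAbs : ℤ) = ((x - y) j).valMinAbs := by
    have h2 : (((x j).valMinAbs - (y j).valMinAbs : ℤ) : ZMod p) = (x - y) j := by simp
    rw [← h2]
    refine (valMinAbs_intCast_of_two_mul_abs_lt ?_).symm
    have h3 : 2 * |((x j).valMinAbs : ℝ) - (y j).valMinAbs| < p := by
      have h4 := abs_sub ((x j).valMinAbs : ℝ) (y j).valMinAbs
      have h5 : |((x j).valMinAbs : ℝ)| ≤ N := hx j
      have h6 : |((y j).valMinAbs : ℝ)| ≤ r := hy j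
      linarith
    exact_mod_cast h3
  simp only [realLift, Pi.sub_apply] at h1 ⊢
  rw [← h1]; push_cast; ring

theorem realLift_add {x y : Fin d → ZMod p} {N r : ℝ} (hNr : 2 * (N + r) < p)
    (hx : ∀ j, |realLift x j| ≤ N) (hy : ∀ j, |realLift y j| ≤ r) :
    realLift (x + y) = realLift x + realLift y := by
  funext j
  have h1 : ((x j).valMinAbs + (y j).valMinAbs : ℤ) = ((x + y) j).valMinAbs := by
    have h2 : (((x j).valMinAbs + (y j).valMinAbs : ℤ) : ZMod p) = (x + y) j := by simp
    rw [← h2]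
    refine (valMinAbs_intCast_of_two_mul_abs_lt ?_).symm
    have h3 : 2 * |((x j).valMinAbs : ℝ) + (y j).valMinAbs| < p := by
      have h4 := abs_add_le ((x j).valMinAbs : ℝ) (y j).valMinAbs
      have h5 : |((x j).valMinAbs : ℝ)| ≤ N := hx j
      have h6 : |((y j).valMinAbs : ℝ)| ≤ r := hy j
      linarith
    exact_mod_cast h3
  simp only [realLift, Pi.add_apply] at h1 ⊢
  rw [← h1]; push_cast; ring

open Classical in
theorem expect_indicator_realLift (C : Set (Fin d → ℝ)) :
    𝔼 x : Fin d → ZMod p, C.indicator (fun _ => (1 : ℝ)) (realLift x) =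
      latticeCount p C / p ^ d := by
  rw [Finset.expect_eq_sum_div_card, latticeCount]
  congr 1
  · simp only [Set.indicator_apply]
    rw [Finset.sum_boole]
  · simp [ZMod.card]

/-- A convex cutoff can be removed from an average over `𝔽_p^d` at the cost of `X^d` characters. -/
theorem norm_expect_convex_cutoff_le (hd : 0 < d) {Ω : Set (Fin d → ℝ)} (hΩ : Convex ℝ Ω)
    {N M X : ℝ} (hΩN : Ω ⊆ Set.Icc (fun _ => -N) (fun _ => N)) (hN : 4 * N < p)
    (hM : 4 ≤ M) (hMX : M ≤ X) (hXp : X < p) (Φ : (Fin d → ZMod p) → ℂ)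
    (P : (Fin d → ZMod p) → ℝ) (hΦP : ∀ x, ‖Φ x‖ ≤ P x) {η η' : ℝ}
    (hΦ : ∀ χ : AddChar (Fin d → ZMod p) ℂ, ‖𝔼 x, χ x * Φ x‖ ≤ η)
    (hP : ∀ χ : AddChar (Fin d → ZMod p) ℂ, ‖𝔼 x, χ x * ((P x - 1 : ℝ) : ℂ)‖ ≤ η')
    (hP2 : 𝔼 x, P x ≤ 2) :
    ‖𝔼 x, ((Ω.indicator (fun _ => (1 : ℝ)) (realLift x) : ℝ) : ℂ) * Φ x‖ ≤
      X ^ d * (η + η') + 12 * d * (M / X) + 8 * d / M := by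
  classical
  have hp0 : (0 : ℝ) < p := by linarith
  have hM0 : 0 < M := by linarith
  have hX0 : 0 < X := by linarith
  have hη : 0 ≤ η + η' := add_nonneg ((norm_nonneg _).trans (hΦ 1)) ((norm_nonneg _).trans (hP 1))
  -- A boundary layer of width `p / M` has proportion `O(1/M)`, and a kernel of order `m = ⌊X⌋` has
  -- tail `p / (m r) = M / m` beyond it in each coordinate.
  set r : ℝ := p / M with hr
  have hr1 : 1 ≤ r := by rw [hr, le_div_iff₀ hM0]; linarith
  have hr4 : 4 * r ≤ p := by
    rw [hr, ← mul_div_assoc, div_le_iff₀ hM0]; nlinarith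
  set m : ℕ := ⌊X⌋₊ with hm
  have hmX : (m : ℝ) ≤ X := Nat.floor_le hX0.le
  have hXm : X / 2 ≤ m := by
    have := Nat.lt_floor_add_one X
    rw [← hm] at this
    linarith
  have hm0 : 0 < m := by
    have : (0 : ℝ) < m := by linarith
    exact_mod_cast this
  have hmp : m ≤ p := by
    have : (m : ℝ) ≤ p := by linarith
    exact_mod_cast this
  have hNr : 2 * (N + r) < p := by linarith
  have hbound : ∀ x : Fin d → ZMod p, realLift x ∈ Ω → ∀ j, |realLift x j| ≤ N := fun x hx j =>
    abs_le.2 ⟨(hΩN hx).1 j, (hΩN hx).2 j⟩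
  have ind0 : ∀ (C : Set (Fin d → ℝ)) y, 0 ≤ C.indicator (fun _ => (1 : ℝ)) y := fun C y =>
    Set.indicator_nonneg (fun _ _ => zero_le_one) y
  have ind1 : ∀ (C : Set (Fin d → ℝ)) y, C.indicator (fun _ => (1 : ℝ)) y ≤ 1 := fun C y =>
    Set.indicator_le_self' (fun _ _ => zero_le_one) y
  have key := norm_expect_cutoff_le ((m : ℝ) ^ d)⁻¹ (by positivity) (fejerChar p m (d := d))
    (fejerPi p m) fejerPi_eq_sum (fun z => Finset.prod_nonneg fun j _ => fejer_nonneg _ _)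
    (expect_fejerPi hm0 hmp) (fun y => ∀ j, |((y j).valMinAbs : ℝ)| ≤ r)
    (expect_fejerPi_tail_le hm0 hmp (by linarith))
    (fun x => Ω.indicator (fun _ => (1 : ℝ)) (realLift x))
    (fun x => (dilate Ω r Finset.univ).indicator (fun _ => (1 : ℝ)) (realLift x))
    (fun x => (erode Ω r Finset.univ).indicator (fun _ => (1 : ℝ)) (realLift x))
    (fun _ => ind0 _ _) (fun _ => ind1 _ _) (fun _ => ind0 _ _) (fun _ => ind1 _ _)
    (fun _ => ind0 _ _) (fun _ => ind1 _ _)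
    (fun x y hy => by
      by_cases hx : realLift x ∈ Ω
      · have h1 : realLift (x - y) ∈ dilate Ω r Finset.univ := by
          refine ⟨realLift y, hy, fun j hj => absurd (Finset.mem_univ j) hj, ?_⟩
          rw [realLift_sub hNr (hbound x hx) hy, sub_add_cancel]
          exact hx
        rw [Set.indicator_of_mem h1]
        exact ind1 _ _
      · rw [Set.indicator_of_notMem hx]
        exact ind0 _ _)
    (fun x y hy => by
      by_cases hxy : realLift (x - y) ∈ erode Ω r Finset.univ
      · have h1 : realLift (x - y) ∈ Ω := by
          simpa using hxy 0 (fun j => by simpa using by linarith) (fun _ _ => rfl)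
        have h2 : realLift x ∈ Ω := by
          have h3 := realLift_add hNr (hbound _ h1) hy
          rw [sub_add_cancel] at h3
          rw [h3]
          exact hxy _ hy (fun j hj => absurd (Finset.mem_univ j) hj)
        rw [Set.indicator_of_mem h2]
        exact ind1 _ _
      · rw [Set.indicator_of_notMem hxy]
        exact ind0 _ _)
    Φ P hΦP hΦ hP hP2
  refine key.trans (add_le_add (add_le_add ?_ ?_) ?_)
  · refine mul_le_mul_of_nonneg_right ?_ hη
    have hmd : (0 : ℝ) < (m : ℝ) ^ d := by positivity
    have h1 : ((m : ℝ) ^ d)⁻¹ * (Fintype.card (Fin d → Fin m × Fin m) : ℝ) = (m : ℝ) ^ d := by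
      simp only [Fintype.card_fun, Fintype.card_prod, Fintype.card_fin]
      push_cast
      rw [mul_pow, inv_mul_cancel_left₀ hmd.ne']
    rw [h1]
    exact pow_le_pow_left₀ (by positivity) hmX d
  · have hm0' : (0 : ℝ) < m := by exact_mod_cast hm0
    have h1 : (p : ℝ) / (m * r) = M / m := by rw [hr]; field_simp
    have h2 : M / m ≤ 2 * (M / X) := by
      rw [← mul_div_assoc, div_le_div_iff₀ hm0' hX0]
      nlinarith
    rw [h1]
    have hd0 : (0 : ℝ) ≤ d := by positivity
    nlinarith [mul_le_mul_of_nonneg_left h2 hd0]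
  · rw [Finset.expect_sub_distrib, expect_indicator_realLift, expect_indicator_realLift, ← sub_div]
    have h1 := latticeCount_dilate_le (p := p) hΩ (by linarith : 0 ≤ r) Finset.univ
    have h2 := latticeCount_le_erode (p := p) hΩ (by linarith : 0 ≤ r) Finset.univ
    rw [Finset.card_univ, Fintype.card_fin] at h1 h2
    have h3 : (p : ℝ) ^ d = p ^ (d - 1) * p := by
      rw [← pow_succ, Nat.sub_add_cancel hd]
    rw [div_le_iff₀ (by positivity)]
    have hpd : (0 : ℝ) ≤ (p : ℝ) ^ (d - 1) := by positivity
    have h4 : 8 * d / M * (p : ℝ) ^ d = 8 * (d * (r * (p : ℝ) ^ (d - 1))) := by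
      rw [h3, hr]; field_simp
    -- Here `r ≥ 1`; dilation and erosion each contribute this much, which gives the constant `8`.
    have h5 : (d : ℝ) * (2 * (r + 1) * (p : ℝ) ^ (d - 1)) ≤ d * (4 * r * (p : ℝ) ^ (d - 1)) :=
      mul_le_mul_of_nonneg_left (mul_le_mul_of_nonneg_right (by linarith) hpd) (by positivity)
    rw [h4]
    linarith

end Cutoff

/-! ### From box averages to averages over the finite field. -/

section BoxAverage

variable {n d t p : ℕ}

theorem affineMod_reduceMod (ψ : (Fin d → ℤ) →ᵃ[ℤ] (Fin n → ℤ)) (x : Fin d → ℤ) :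
    affineMod p ψ (reduceMod p d x) = reduceMod p n (ψ x) := by
  have h1 : ψ x = Matrix.mulVec (linMatrix ψ) x + ψ 0 := by
    rw [← linear_eq_linMatrix_mulVec]
    simpa using congrFun ψ.decomp x
  funext i
  rw [h1, reduceMod_apply, Pi.add_apply]
  simp [affineMod, reduceMod_apply, Matrix.mulVec, dotProduct, linMatrix]

theorem AffineSizeLE.mem_intBox {ψ : (Fin d → ℤ) →ᵃ[ℤ] (Fin n → ℤ)} {N L : ℝ}
    (h : AffineSizeLE ψ N L) (hL : 0 ≤ L) {x : Fin d → ℤ} (hx : x ∈ intBox d N) :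
    ψ x ∈ intBox n ((d + 1) * L * N) := by
  rw [_root_.mem_intBox] at hx ⊢
  intro i
  have h1 : ψ x = Matrix.mulVec (linMatrix ψ) x + ψ 0 := by
    rw [← linear_eq_linMatrix_mulVec]
    simpa using congrFun ψ.decomp x
  have h2 : |((Matrix.mulVec (linMatrix ψ) x i : ℤ) : ℝ)| ≤ d * (L * N) := by
    rw [Matrix.mulVec, dotProduct, Int.cast_sum]
    refine (Finset.abs_sum_le_sum_abs _ _).trans ((Finset.sum_le_card_nsmul _ _ (L * N) ?_).trans ?_)
    · intro j _
      rw [Int.cast_mul, abs_mul]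
      exact mul_le_mul (h.1 i j) (hx j) (abs_nonneg _) hL
    · simp
  rw [h1, Pi.add_apply, Int.cast_add]
  refine (abs_add_le _ _).trans ?_
  linarith [h.2 i]

theorem pow_le_card_intBox (d : ℕ) {N : ℝ} (hN : 0 ≤ N) : N ^ d ≤ (intBox d N).card := by
  rw [intBox, Fintype.card_piFinset, Finset.prod_const, Finset.card_univ, Fintype.card_fin,
    Nat.cast_pow]
  refine pow_le_pow_left₀ hN ?_ d
  rw [Int.card_Icc, Int.ceil_neg]
  have h0 : 0 ≤ ⌊N⌋ := Int.floor_nonneg.2 hN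
  have h1 : N < ⌊N⌋ + 1 := Int.lt_floor_add_one N
  have h2 : ((⌊N⌋ + 1 - -⌊N⌋).toNat : ℤ) = 2 * ⌊N⌋ + 1 := by omega
  have h3 : (((⌊N⌋ + 1 - -⌊N⌋).toNat : ℕ) : ℝ) = 2 * ⌊N⌋ + 1 := by exact_mod_cast h2
  have h4 : (0 : ℝ) ≤ ⌊N⌋ := by exact_mod_cast h0
  rw [h3]; linarith

theorem norm_boxMod_le {f : (Fin n → ℤ) → ℂ} {ν : (Fin n → ℤ) → ℝ} {R : ℝ} (hν : ∀ x, 0 ≤ ν x)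
    (hf : ∀ x ∈ intBox n R, ‖f x‖ ≤ ν x) (y : Fin n → ZMod p) :
    ‖boxMod p R f y‖ ≤ restrictMod p ν y := by
  rw [boxMod]
  split_ifs with h
  · exact hf _ h
  · simpa [restrictMod] using hν _

/-- Reduction is injective on the box and on the cube containing the values of the forms, so terms
match; residues outside the image of the box are removed by the cutoff. -/
theorem sum_intBox_eq_sum_boxMod [NeZero p] {ψ : Fin t → (Fin d → ℤ) →ᵃ[ℤ] (Fin n → ℤ)} {N L : ℝ}
    (hψ : ∀ i, AffineSizeLE (ψ i) N L) (hL : 0 ≤ L) (hN : 2 * N < p)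
    (hR : 2 * ((d + 1) * L * N) < p) (f : Fin t → (Fin n → ℤ) → ℂ) {Ω : Set (Fin d → ℝ)}
    (hΩ : Ω ⊆ Set.Icc (fun _ => -N) (fun _ => N)) :
    ∑ x ∈ intBox d N, Ω.indicator (fun _ => (1 : ℂ)) (fun j => (x j : ℝ)) * ∏ i, f i (ψ i x) =
      ∑ y : Fin d → ZMod p, ((Ω.indicator (fun _ => (1 : ℝ)) (realLift y) : ℝ) : ℂ) *
        ∏ i, boxMod p ((d + 1) * L * N) (f i) (affineMod p (ψ i) y) := by
  have hlift : ∀ x ∈ intBox d N, liftMod (reduceMod p d x) = x := fun x hx =>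
    liftMod_reduceMod hN (mem_intBox.1 hx)
  refine Finset.sum_of_injOn (reduceMod p d) ?_ (fun _ _ => by simp) ?_ ?_
  · intro x hx y hy hxy
    rw [← hlift x hx, ← hlift y hy, hxy]
  · intro y _ hy
    rw [Set.indicator_of_notMem, Complex.ofReal_zero, zero_mul]
    intro hyΩ
    refine hy ⟨liftMod y, ?_, reduceMod_liftMod y⟩
    exact mem_intBox.2 fun j => abs_le.2 ⟨(hΩ hyΩ).1 j, (hΩ hyΩ).2 j⟩
  · intro x hx
    have h1 : realLift (reduceMod p d x) = fun j => (x j : ℝ) := by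
      funext j
      exact congrArg (Int.cast (R := ℝ)) (congrFun (hlift x hx) j)
    rw [h1]
    congr 1
    · by_cases h : (fun j => (x j : ℝ)) ∈ Ω <;> simp [h]
    · refine Finset.prod_congr rfl fun i _ => ?_
      rw [affineMod_reduceMod, boxMod_reduceMod hR _ ((hψ i).mem_intBox hL hx)]

theorem norm_expect_intBox_le [NeZero p] {ψ : Fin t → (Fin d → ℤ) →ᵃ[ℤ] (Fin n → ℤ)} {N L : ℝ}
    (hψ : ∀ i, AffineSizeLE (ψ i) N L) (hL : 0 ≤ L) (hN0 : 0 < N) (hN : 2 * N < p)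
    (hR : 2 * ((d + 1) * L * N) < p) (f : Fin t → (Fin n → ℤ) → ℂ) {Ω : Set (Fin d → ℝ)}
    (hΩ : Ω ⊆ Set.Icc (fun _ => -N) (fun _ => N)) :
    ‖Finset.expect (intBox d N) fun x =>
        Ω.indicator (fun _ => (1 : ℂ)) (fun j => (x j : ℝ)) * ∏ i, f i (ψ i x)‖ ≤
      (p / N) ^ d * ‖𝔼 y : Fin d → ZMod p, ((Ω.indicator (fun _ => (1 : ℝ)) (realLift y) : ℝ) : ℂ) *
        ∏ i, boxMod p ((d + 1) * L * N) (f i) (affineMod p (ψ i) y)‖ := by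
  have hcard := pow_le_card_intBox d hN0.le
  have hNd : 0 < N ^ d := by positivity
  have hp0 : (0 : ℝ) < p := by linarith
  rw [Finset.expect_eq_sum_div_card, Finset.expect_eq_sum_div_card,
    sum_intBox_eq_sum_boxMod hψ hL hN hR f hΩ, norm_div, norm_div, Complex.norm_natCast,
    Complex.norm_natCast, Finset.card_univ, Fintype.card_fun, Fintype.card_fin, ZMod.card,
    Nat.cast_pow, div_pow, div_mul_div_comm, mul_comm (N ^ d), mul_div_mul_left _ _ (by positivity)]
  exact div_le_div_of_nonneg_left (norm_nonneg _) hNd hcard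

end BoxAverage

/-! ### Extraction of roots. -/

section Numerics

theorem le_of_pow_le_two_pow_mul {a δ ρ : ℝ} (s : ℕ) (hδ : 0 ≤ δ) (hρ : 0 ≤ ρ)
    (h : a ^ 2 ^ (s + 1) ≤ 2 ^ (2 ^ (s + 1) - 1) * (δ ^ 2 ^ (s + 1) + √(8 * ρ))) :
    a ≤ 2 * (δ + 3 * ρ ^ ((1 : ℝ) / 2 ^ (s + 2))) := by
  set β : ℝ := ρ ^ ((1 : ℝ) / 2 ^ (s + 2)) with hβ
  have hβ0 : 0 ≤ β := Real.rpow_nonneg hρ _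
  have hk : 2 ^ (s + 1) ≠ 0 := by positivity
  have h1 : √ρ = β ^ 2 ^ (s + 1) := by
    rw [hβ, Real.sqrt_eq_rpow, ← Real.rpow_natCast, ← Real.rpow_mul hρ]
    congr 1
    push_cast
    rw [pow_succ 2 (s + 1)]
    field_simp
  -- The `3` comes from `√8 ≤ 3`; the root in `√ρ` is why the exponent has `s + 2`.
  have h2 : √(8 * ρ) ≤ (3 * β) ^ 2 ^ (s + 1) := by
    rw [Real.sqrt_mul (by norm_num), h1, mul_pow]
    refine mul_le_mul_of_nonneg_right ?_ (by positivity)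
    refine le_trans ?_ (le_self_pow₀ (by norm_num : (1 : ℝ) ≤ 3) hk)
    exact (Real.sqrt_le_left (by norm_num)).2 (by norm_num)
  have h3 : δ ^ 2 ^ (s + 1) + (3 * β) ^ 2 ^ (s + 1) ≤ (δ + 3 * β) ^ 2 ^ (s + 1) :=
    pow_add_pow_le hδ (by positivity) hk
  refine le_of_pow_le_pow_left₀ hk (by positivity) (h.trans ?_)
  rw [mul_pow]
  refine mul_le_mul (pow_le_pow_right₀ (by norm_num) (Nat.sub_le _ _)) ?_ (by positivity)
    (by positivity)
  linarith

theorem le_two_mul_rpow_of_pow_four_le {a ρ : ℝ} {s : ℕ} (hs : 1 ≤ s) (hρ : 0 < ρ)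
    (hρ1 : ρ ≤ 1) (h : a ^ 4 ≤ 16 * ρ) : a ≤ 2 * ρ ^ ((1 : ℝ) / 2 ^ (s + 1)) := by
  refine le_of_pow_le_pow_left₀ (n := 4) (by norm_num) (by positivity) (h.trans ?_)
  rw [mul_pow, ← Real.rpow_natCast (ρ ^ _), ← Real.rpow_mul hρ.le]
  norm_num1
  refine mul_le_mul_of_nonneg_left ?_ (by norm_num)
  conv_lhs => rw [← Real.rpow_one ρ]
  refine Real.rpow_le_rpow_of_exponent_ge hρ hρ1 ?_
  have : (4 : ℝ) ≤ 2 ^ (s + 1) := by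
    calc (4 : ℝ) = 2 ^ (1 + 1) := by norm_num
      _ ≤ 2 ^ (s + 1) := pow_le_pow_right₀ (by norm_num) (by omega)
  rw [one_div_mul_eq_div, div_le_one (by positivity)]
  exact_mod_cast this

end Numerics

/-! ### Choice of the prime and assembly. -/

section Main

variable {n d t s : ℕ}

theorem exists_prime_for_directions (hd : 0 < d) {L N : ℝ} (hL : 1 ≤ L)
    (hN : (d.factorial : ℝ) ≤ N) (D : Fin (s + 1) → ℤ) (hD : ∀ k, D k ≠ 0)
    (hDL : ∀ k, |(D k : ℝ)| ≤ d.factorial * L ^ d) :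
    ∃ p : ℕ, p.Prime ∧ (2 * s + 8) * ((d + 1) * L * N) < p ∧
      p ≤ 2 ^ (d * (s + 1)) * (2 * (2 * s + 8) * (d + 1)) * L * N ∧ ∀ k, (D k : ZMod p) ≠ 0 := by
  have hf : (1 : ℝ) ≤ d.factorial := by exact_mod_cast d.factorial_pos
  have hLN : 1 ≤ L * N := one_le_mul_of_one_le_of_one_le hL (hf.trans hN)
  -- The factor `2s + 8` exceeds the `2(s+1) + 2` needed for lifting parallelepipeds and the `4`
  -- needed for the cutoff.
  set Y : ℝ := (2 * s + 8) * ((d + 1) * L * N) with hY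
  have hYLN : 2 * (L * N) ≤ Y := by
    have h1 : (2 : ℝ) ≤ (2 * s + 8) * (d + 1) := by
      have : (0 : ℝ) ≤ s * d := by positivity
      have : (0 : ℝ) ≤ s := by positivity
      have : (0 : ℝ) ≤ d := by positivity
      nlinarith
    calc 2 * (L * N) ≤ (2 * s + 8) * (d + 1) * (L * N) :=
          mul_le_mul_of_nonneg_right h1 (by linarith)
      _ = Y := by rw [hY]; ring
  set P := ⌈Y⌉₊ with hP
  have hPY : Y ≤ P := Nat.le_ceil Y
  have hPY2 : (P : ℝ) ≤ 2 * Y := by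
    have := Nat.ceil_lt_add_one (by linarith : 0 ≤ Y)
    linarith
  have hP0 : P ≠ 0 := by
    have : (0 : ℝ) < P := by linarith
    exact_mod_cast this.ne'
  have hYf : d.factorial * L < P := by
    have h1 : d.factorial * L ≤ L * N := by nlinarith
    linarith
  have hprod : (∏ k, D k).natAbs < P ^ (d * (s + 1)) := by
    have h1 : |((∏ k, D k : ℤ) : ℝ)| < (P : ℝ) ^ (d * (s + 1)) := by
      rw [Int.cast_prod, Finset.abs_prod]
      calc ∏ k, |(D k : ℝ)| ≤ ∏ _k : Fin (s + 1), d.factorial * L ^ d :=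
            Finset.prod_le_prod (fun _ _ => abs_nonneg _) fun k _ => hDL k
        _ = (d.factorial * L ^ d) ^ (s + 1) := by simp
        _ ≤ ((d.factorial * L) ^ d) ^ (s + 1) := by
            refine pow_le_pow_left₀ (by positivity) ?_ _
            rw [mul_pow]
            exact mul_le_mul_of_nonneg_right (le_self_pow₀ hf hd.ne') (by positivity)
        _ = (d.factorial * L) ^ (d * (s + 1)) := by rw [pow_mul]
        _ < _ := pow_lt_pow_left₀ hYf (by positivity) (Nat.mul_pos hd s.succ_pos).ne'
    rw [← Int.cast_abs, Int.abs_eq_natAbs] at h1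
    exact_mod_cast h1
  obtain ⟨p, hp, h1, h2, h3⟩ := exists_prime_not_dvd (d * (s + 1)) P (∏ k, D k) hP0
    (Finset.prod_ne_zero_iff.2 fun k _ => hD k) hprod
  refine ⟨p, hp, ?_, ?_, fun k hk => h3 ?_⟩
  · exact hPY.trans_lt (by exact_mod_cast h1)
  · calc (p : ℝ) ≤ 2 ^ (d * (s + 1)) * P := by exact_mod_cast h2
      _ ≤ 2 ^ (d * (s + 1)) * (2 * Y) := mul_le_mul_of_nonneg_left hPY2 (by positivity)
      _ = _ := by rw [hY]; ring
  · exact ((ZMod.intCast_zmod_eq_zero_iff_dvd _ _).1 hk).trans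
      (Finset.dvd_prod_of_mem _ (Finset.mem_univ k))

/-- The dimensions of a matrix with a scaled right inverse. -/
theorem le_of_mul_eq_smul_one {M : Matrix (Fin n) (Fin d) ℤ} {V : Matrix (Fin d) (Fin n) ℤ} {D : ℤ}
    (hD : D ≠ 0) (h : M * V = D • 1) : n ≤ d := by
  have hinj : Function.Injective V.mulVecLin := by
    rw [injective_iff_map_eq_zero]
    intro x hx
    have h1 : M.mulVec (V.mulVec x) = D • x := by
      rw [Matrix.mulVec_mulVec, h, Matrix.smul_mulVec, Matrix.one_mulVec]
    rw [Matrix.mulVecLin_apply] at hx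
    rw [hx, Matrix.mulVec_zero] at h1
    exact (smul_eq_zero.1 h1.symm).resolve_left hD
  simpa using LinearMap.finrank_le_finrank_of_injective hinj

/-- Complexity at `j` gives a direction that kills the form `i` and on which the form `j` is a
nonzero multiple of the identity. -/
theorem ComplexityLE.exists_mulVec_eq_zero (hn : 0 < n)
    {ψ : Fin t → (Fin d → ℤ) →ᵃ[ℤ] (Fin n → ℤ)}
    (h : ComplexityLE (fun i => (ψ i).linear) s) {L : ℝ} (hL1 : 1 ≤ L)
    (hL : ∀ j, LinCoeffsLE (ψ j) L) {i j : Fin t} (hij : i ≠ j) :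
    ∃ x, Matrix.mulVec (linMatrix (ψ i)) x = 0 ∧ Matrix.mulVec (linMatrix (ψ j)) x ≠ 0 := by
  obtain ⟨V, D, hD, hMV, hkill, -⟩ := exists_directions ψ j (h j) hL1 hL
  obtain ⟨k, hk⟩ := hkill i hij
  refine ⟨(V k).mulVec (Pi.single ⟨0, hn⟩ 1), ?_, fun h0 => ?_⟩
  · rw [Matrix.mulVec_mulVec, hk, Matrix.zero_mulVec]
  · rw [Matrix.mulVec_mulVec, hMV, Matrix.smul_mulVec, Matrix.one_mulVec] at h0
    have := congrFun h0 ⟨0, hn⟩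
    simp [hD k] at this

theorem ComplexityLE.exists_mulVec_eq_single {ψ : Fin t → (Fin d → ℤ) →ᵃ[ℤ] (Fin n → ℤ)}
    (h : ComplexityLE (fun i => (ψ i).linear) s) {L : ℝ} (hL1 : 1 ≤ L)
    (hL : ∀ j, LinCoeffsLE (ψ j) L) (i : Fin t) :
    ∃ D : ℤ, D ≠ 0 ∧ ∀ b, ∃ x, Matrix.mulVec (linMatrix (ψ i)) x = Pi.single b D := by
  obtain ⟨V, D, hD, hMV, -⟩ := exists_directions ψ i (h i) hL1 hL
  refine ⟨D 0, hD 0, fun b => ⟨(V 0).mulVec (Pi.single b 1), ?_⟩⟩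
  rw [Matrix.mulVec_mulVec, hMV, Matrix.smul_mulVec, Matrix.one_mulVec]
  ext c
  by_cases hc : c = b
  · subst hc; simp
  · simp [hc]

/-- `norm_expect_convex_cutoff_le` without restrictions on the parameters. -/
theorem norm_expect_convex_cutoff_le_log {p : ℕ} [NeZero p] (hd : 0 < d) {Ω : Set (Fin d → ℝ)}
    (hΩ : Convex ℝ Ω) {N M X E : ℝ} (hΩN : Ω ⊆ Set.Icc (fun _ => -N) (fun _ => N))
    (hN : 4 * N < p) (hM : 0 < M) (hX : 2 ≤ X) (Φ : (Fin d → ZMod p) → ℂ)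
    (P : (Fin d → ZMod p) → ℝ) (hΦP : ∀ x, ‖Φ x‖ ≤ P x) {η η' : ℝ}
    (hΦ : ∀ χ : AddChar (Fin d → ZMod p) ℂ, ‖𝔼 x, χ x * Φ x‖ ≤ η)
    (hP : ∀ χ : AddChar (Fin d → ZMod p) ℂ, ‖𝔼 x, χ x * ((P x - 1 : ℝ) : ℂ)‖ ≤ η')
    (hP2 : 𝔼 x, P x ≤ 2) (hE : η + η' ≤ 6 * E) :
    ‖𝔼 x, ((Ω.indicator (fun _ => (1 : ℝ)) (realLift x) : ℝ) : ℂ) * Φ x‖ ≤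
      (24 * d + 8) * (X ^ d * E + 1 / M + M * (Real.log X / X)) := by
  have hX0 : 0 < X := by linarith
  have hη : 0 ≤ η := (norm_nonneg _).trans (hΦ 1)
  have hη' : 0 ≤ η' := (norm_nonneg _).trans (hP 1)
  have hd1 : (1 : ℝ) ≤ d := by exact_mod_cast hd
  have hXd : 0 < X ^ d := by positivity
  have hlog : 1 / 2 ≤ Real.log X := by
    have h1 : Real.log 2 ≤ Real.log X := Real.log_le_log (by norm_num) hX
    linarith [Real.log_two_gt_d9]
  have hA : 0 ≤ X ^ d * E := mul_nonneg hXd.le (by linarith)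
  have hA' : X ^ d * (η + η') ≤ 6 * (X ^ d * E) := by
    linarith [mul_le_mul_of_nonneg_left hE hXd.le]
  have hB : 0 < 1 / M := by positivity
  have hMX0 : 0 < M / X := by positivity
  have hC : M / X ≤ 2 * (M * (Real.log X / X)) := by
    have : M * (Real.log X / X) = M / X * Real.log X := by ring
    rw [this]
    nlinarith
  have hgX : ∀ x, |Ω.indicator (fun _ => (1 : ℝ)) (realLift x)| ≤ 1 := fun x : Fin d → ZMod p => by
    by_cases h : realLift x ∈ Ω <;> simp [h]
  set A := X ^ d * E
  set B := 1 / M with hBdef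
  set T := M * (Real.log X / X)
  have htriv : ‖𝔼 x, ((Ω.indicator (fun _ => (1 : ℝ)) (realLift x) : ℝ) : ℂ) * Φ x‖ ≤ 2 := by
    refine ((RCLike.norm_expect_le (K := ℂ)).trans (Finset.expect_le_expect fun x _ => ?_)).trans hP2
    rw [norm_mul, Complex.norm_real, Real.norm_eq_abs]
    exact (mul_le_of_le_one_left (norm_nonneg _) (hgX x)).trans (hΦP x)
  have hdA : 0 ≤ d * A := by positivity
  have hdB : 0 ≤ d * B := by positivity
  have hdC : d * (M / X) ≤ 2 * (d * T) := by nlinarith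
  have hdC0 : 0 < d * (M / X) := by positivity
  have expand : (24 * d + 8) * (A + B + T) =
      24 * (d * A) + 24 * (d * B) + 24 * (d * T) + 8 * A + 8 * B + 8 * T := by ring
  rw [expand]
  -- For `M < 4` or `M > X` the right-hand side exceeds the trivial bound `2`.
  by_cases hM4 : M < 4
  · have : 1 / 4 ≤ B := one_div_le_one_div_of_le hM hM4.le
    linarith
  by_cases hMX : X < M
  · have : 1 ≤ M / X := (one_le_div hX0).2 hMX.le
    linarith
  by_cases hXp : X < p
  · have h1 := norm_expect_convex_cutoff_le hd hΩ hΩN hN (not_lt.1 hM4) (not_lt.1 hMX) hXp Φ P hΦP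
      hΦ hP hP2
    have h2 : 8 * d / M = 8 * (d * B) := by rw [hBdef]; ring
    linarith
  -- For `X ≥ p` even the expansion into all `p^d` characters costs at most `X^d`.
  · have h1 := norm_expect_mul_le_card_mul _ hgX Φ hΦ
    rw [Fintype.card_fun, Fintype.card_fin, ZMod.card, Nat.cast_pow] at h1
    have h2 : (p : ℝ) ^ d * η ≤ X ^ d * (η + η') :=
      mul_le_mul (pow_le_pow_left₀ (by positivity) (not_lt.1 hXp) d) (by linarith) hη hXd.le
    linarith

end Main

theorem mainTheorem10 (n : ℕ) (hn : 0 < n) :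
    ∃ A₀ : ℕ, ∀ d : ℕ, 0 < d → ∃ (A : ℕ) (K : ℝ), 0 < K ∧ ∀ s : ℕ, 1 ≤ s → ∃ C : ℝ, 0 < C ∧
      ∀ (t : ℕ) (L N : ℝ), 0 < t → 0 < L → K * L ^ A₀ < N →
      ∀ (ψ : Fin t → (Fin d → ℤ) →ᵃ[ℤ] (Fin n → ℤ)),
        (∀ i, AffineSizeLE (ψ i) N L) →
        ComplexityLE (fun i => (ψ i).linear) s →
      ∀ (f : Fin t → (Fin n → ℤ) → ℂ) (ν : (Fin n → ℤ) → ℝ) (δ ρ : ℝ),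
        0 < δ → 0 < ρ → ρ < 1 →
        (∃ i, gowersNorm (s + 1) (intBox n ((d + 1) * L * N)) (f i) ≤ δ) →
        (∀ x, 0 ≤ ν x) →
        (∀ i, ∀ x ∈ intBox n ((d + 1) * L * N), ‖f i x‖ ≤ ν x) →
        LinearFormsCondition (t * 2 ^ (s + 1)) (4 * (s + 2) * d) (K * L ^ A) N ρ ν →
      ∀ Ω : Set (Fin d → ℝ), Convex ℝ Ω → Ω ⊆ Set.Icc (fun _ => -N) (fun _ => N) →
      ∀ M X : ℝ, 0 < M → 2 ≤ X →
        ‖Finset.expect (intBox d N) fun x =>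
            Ω.indicator (fun _ => (1 : ℂ)) (fun j => (x j : ℝ)) * ∏ i, f i (ψ i x)‖ ≤
          C * (L ^ d * (X ^ d * (δ + ρ ^ ((1 : ℝ) / 2 ^ (s + 2))
              + 2 ^ t * ρ ^ ((1 : ℝ) / 2 ^ (s + 1)))
            + 1 / M + M * (Real.log X / X))) := by
  -- The exponent `A₀ = 0` suffices because `N > K` is used only through `d! ≤ N`. The constant `C`
  -- is the `d`-th power of the bound for `p / (L N)` times the cutoff constant `24 d + 8`.
  refine ⟨0, fun d hd => ⟨d + 2, formConst d n, formConst_pos d n, fun s hs =>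
    ⟨(2 ^ (d * (s + 1)) * (2 * (2 * s + 8) * (d + 1))) ^ d * (24 * d + 8), by positivity, ?_⟩⟩⟩
  intro t L N ht hL0 hNK ψ hψ hcomp f ν δ ρ hδ hρ hρ1 hgow hν hf hlin Ω hΩ hΩN M X hM hX
  obtain ⟨i₀, hi₀⟩ := hgow
  have hcoef : ∀ j, LinCoeffsLE (ψ j) L := fun j => (hψ j).1
  have hL : 1 ≤ L := one_le_of_complexityLEAt hn ψ i₀ (hcomp i₀) (hcoef i₀)
  have hNf : (d.factorial : ℝ) ≤ N := by
    rw [pow_zero, mul_one, formConst] at hNK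
    refine le_trans (le_mul_of_one_le_left (by positivity) ?_) hNK.le
    have : (0 : ℝ) ≤ n * d := by positivity
    linarith
  have hN1 : 1 ≤ N := le_trans (by exact_mod_cast d.factorial_pos) hNf
  have hN0 : 0 < N := by linarith
  obtain ⟨V, D, hD, hMV, hkill, hV, hDL⟩ := exists_directions ψ i₀ (hcomp i₀) hL hcoef
  have hnd : n ≤ d := le_of_mul_eq_smul_one (hD 0) (hMV 0)
  obtain ⟨p, hp, hpl, hpu, hDp⟩ := exists_prime_for_directions hd hL hNf D hD hDL
  have : Fact p.Prime := ⟨hp⟩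
  set R : ℝ := (d + 1) * L * N with hR
  have hNR : N ≤ R := by
    refine le_mul_of_one_le_left hN0.le (one_le_mul_of_one_le_of_one_le ?_ hL)
    have : (0 : ℝ) ≤ d := by positivity
    linarith
  have hsR : 0 ≤ s * R := by positivity
  have hpN : N ≤ p := by linarith
  have hker := fun i j (hij : i ≠ j) => hcomp.exists_mulVec_eq_zero hn hL hcoef hij
  have hcok := hcomp.exists_mulVec_eq_single hL hcoef
  have hK : 0 ≤ formConst d n * L ^ (d + 2) := mul_nonneg (formConst_pos d n).le (by positivity)
  have hψK : ∀ j, LinCoeffsLE (ψ j) (formConst d n * L ^ (d + 2)) := fun j a b =>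
    (hcoef j a b).trans (le_formConst_mul hn hd hL).1
  have hF : ∀ j y, ‖boxMod p R (f j) y‖ ≤ restrictMod p ν y := fun j => norm_boxMod_le hν (hf j)
  have hgow' : ‖𝔼 y : Fin n → ZMod p, 𝔼 g : Fin (s + 1) → Fin n → ZMod p,
      cubeProd (boxMod p R (f i₀)) y g‖ ≤ δ ^ 2 ^ (s + 1) := by
    refine (norm_expect_cubeProd_boxMod_le (by linarith) ?_ (f i₀)).trans
      (pow_le_pow_left₀ (Real.rpow_nonneg (norm_nonneg _) _) hi₀ _)
    push_cast
    linarith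
  have hΦ : ∀ χ : AddChar (Fin d → ZMod p) ℂ,
      ‖𝔼 x, χ x * ∏ j, boxMod p R (f j) (affineMod p (ψ j) x)‖ ≤
        2 * (δ + 3 * ρ ^ ((1 : ℝ) / 2 ^ (s + 2))) := by
    intro χ
    refine le_of_pow_le_two_pow_mul s hδ.le hρ.le ?_
    have hmom := hlin.cubeMoments hn hnd hL hcoef hker hcok i₀ V D hD hkill hV hDL hpN
    have hθ : linMatrix (ψ i₀) * (D 0 • 1 - V 0 * linMatrix (ψ i₀)) = 0 := by
      rw [Matrix.mul_sub, ← Matrix.mul_assoc, hMV, Matrix.mul_smul, Matrix.smul_mul,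
        Matrix.mul_one, Matrix.one_mul, sub_self]
    -- This is where `s ≥ 1` provides the two edges that cancel a character.
    obtain ⟨m, rfl⟩ : ∃ m, s = m + 1 := ⟨s - 1, by omega⟩
    refine (hmom.norm_expect_addChar_pow_le hρ1 hn hMV hDp hkill hθ
      (fun j => boxMod p R (f j)) hF χ).trans (mul_le_mul_of_nonneg_left ?_ (by positivity))
    exact add_le_add hgow' le_rfl
  have hP : ∀ χ : AddChar (Fin d → ZMod p) ℂ,
      ‖𝔼 x, χ x * ((∏ j, formWeight p ν (ψ j) x - 1 : ℝ) : ℂ)‖ ≤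
        2 * ρ ^ ((1 : ℝ) / 2 ^ (s + 1)) := fun χ =>
    le_two_mul_rpow_of_pow_four_le hs hρ hρ1.le
      (hlin.norm_expect_addChar_pow_le hs hn hK hψK hker hcok hpN χ)
  have hP2 := hlin.expect_prod_le hs hn hK hψK hker hcok hpN hρ1
  set E : ℝ := δ + ρ ^ ((1 : ℝ) / 2 ^ (s + 2)) + 2 ^ t * ρ ^ ((1 : ℝ) / 2 ^ (s + 1)) with hE
  have hηE : 2 * (δ + 3 * ρ ^ ((1 : ℝ) / 2 ^ (s + 2))) + 2 * ρ ^ ((1 : ℝ) / 2 ^ (s + 1)) ≤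
      6 * E := by
    have h1 : ρ ^ ((1 : ℝ) / 2 ^ (s + 1)) ≤ 2 ^ t * ρ ^ ((1 : ℝ) / 2 ^ (s + 1)) :=
      le_mul_of_one_le_left (by positivity) (one_le_pow₀ (by norm_num))
    have h2 : 0 ≤ ρ ^ ((1 : ℝ) / 2 ^ (s + 1)) := by positivity
    linarith
  have hcut := norm_expect_convex_cutoff_le_log hd hΩ hΩN (by linarith : 4 * N < p) hM hX
    (fun x => ∏ j, boxMod p R (f j) (affineMod p (ψ j) x))
    (fun x => ∏ j, formWeight p ν (ψ j) x)
    (fun x => by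
      rw [norm_prod]
      exact Finset.prod_le_prod (fun _ _ => norm_nonneg _) fun j _ => hF j _)
    hΦ hP hP2 hηE
  refine (norm_expect_intBox_le hψ hL0.le hN0 (by linarith : 2 * N < p) (by linarith) f
    hΩN).trans ?_
  have hpNL : (p : ℝ) / N ≤ 2 ^ (d * (s + 1)) * (2 * (2 * s + 8) * (d + 1)) * L :=
    (div_le_iff₀ hN0).2 hpu
  refine (mul_le_mul (pow_le_pow_left₀ (by positivity) hpNL d) hcut (norm_nonneg _)
    (by positivity)).trans ?_
  rw [mul_pow]
  exact le_of_eq (by ring)
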